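/- **Theorem (Bound for pseudorandom Komlós instances).** For a real $n\times n$ matrix $A$ let $A^{\odot 2}$ be the matrix with entries $A_{ij}^2$, and let $$\lambda(A)=\sup\{\|A^{\odot 2}u\|_2 : u\in\mathbb{R}^n,\ \|u\|_2=1,\ \langle u,\mathbf 1\rangle=0\},$$ where $\mathbf 1$ is the all-ones vector (and $\lambda(A)=0$ if $n\le 1$, when there is no such $u$). There are a universal constant $C$, a polynomial $T$ and one deterministic algorithm with the following property. For every $n$ and every $A\in\mathbb{R}^{n\times n}$ all of whose columns have $\ell_2$-norm at most $1$, the algorithm, given $n$ and $A$, halts after at most $T(n)$ steps and outputs $x\in\{\pm1\}^n$ with $$\|Ax\|_\infty\le C\left(1+\sqrt{\lambda(A)\log n}\right)$$ (for $n=0$ the quantity $\lambda(A)\log n$ is read as $0$). Here algorithms are programs for a real random access machine: exact addition, subtraction, multiplication, division and comparison of real numbers, rational constants, and the usual operations on natural-number indices, each at unit cost. In particular, for every constant $K$ there is a constant $C_K$ such that, for every $n$ and every $A\in\mathbb{R}^{n\times n}$ whose columns have $\ell_2$-norm at most $1$ and which satisfies $\lambda(A)\le K/\log n$ if $n\ge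 2$, there is $x\in\{\pm1\}^n$ with $\|Ax\|_\infty\le C_K$. That is, the Komlós conjecture holds for matrices with $\lambda(A)=O(1/\log n)$. -/

import Mathlib

open scoped Matrix

/-- The largest factor by which the entrywise square `A ⊙ A` of a real matrix stretches a unit
vector orthogonal to the all-ones vector:
`lam A = sup { ‖(A ⊙ A) u‖₂ : ‖u‖₂ = 1, ⟨u, 𝟏⟩ = 0 }`.
The supremum is over a bounded set of nonnegative reals; it is `0` if there is no such `u`
(at most one column). -/
noncomputable def lam {m n : ℕ} (A : Matrix (Fin m) (Fin n) ℝ) : ℝ :=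
  sSup {r : ℝ | ∃ u : Fin n → ℝ,
    ‖WithLp.toLp 2 u‖ = 1 ∧ ∑ j, u j = 0 ∧ r = ‖WithLp.toLp 2 ((A ⊙ A) *ᵥ u)‖}

/-- Every column of `A` has Euclidean norm at most `1`. -/
def IsKomlosInstance {n : ℕ} (A : Matrix (Fin n) (Fin n) ℝ) : Prop :=
  ∀ j, ‖WithLp.toLp 2 (fun i => A i j)‖ ≤ 1

/-- `x` is a vector of signs. -/
def IsColoring {n : ℕ} (x : Fin n → ℝ) : Prop :=
  ∀ j, x j = 1 ∨ x j = -1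

/-!
A real random access machine with structured control flow. Its memory consists of index registers
holding natural numbers, and of two-dimensional arrays of cells holding real numbers. Real numbers
can be added, subtracted, multiplied, divided and compared, exactly and at unit cost; there is no
rounding, and no way to turn a real number into an index. The only constants that a program can
mention are rational. A program is a finite object that does not depend on the input.
-/
namespace RealRAM

/-- A memory state: index registers `idx v`, and array cells `arr a i j` (the entry `(i, j)` of the
array with name `a`). -/
structure State where
  idx : ℕ → ℕ
  arr : ℕ → ℕ → ℕ → ℝ

/-- Index expressions. -/
inductive IExpr where
  | const (k : ℕ)
  | var (v : ℕ)
  | add (e f : IExpr)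
  | sub (e f : IExpr)

/-- The value of an index expression; subtraction is truncated at `0`. -/
def IExpr.eval (s : State) : IExpr → ℕ
  | const k => k
  | var v => s.idx v
  | add e f => e.eval s + f.eval s
  | sub e f => e.eval s - f.eval s

/-- The cost of evaluating an index expression: one step for every node. -/
def IExpr.cost : IExpr → ℕ
  | const _ => 1
  | var _ => 1
  | add e f => e.cost + f.cost + 1
  | sub e f => e.cost + f.cost + 1

/-- Real expressions. -/
inductive RExpr where
  | const (q : ℚ)
  | ofIdx (e : IExpr)
  | entry (a : ℕ) (i j : IExpr)
  | add (e f : RExpr)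
  | sub (e f : RExpr)
  | mul (e f : RExpr)
  | div (e f : RExpr)

/-- The value of a real expression. A division by zero returns `0`; a program can test the
denominator first, so this convention does not matter. -/
noncomputable def RExpr.eval (s : State) : RExpr → ℝ
  | const q => (q : ℝ)
  | ofIdx e => (e.eval s : ℝ)
  | entry a i j => s.arr a (i.eval s) (j.eval s)
  | add e f => e.eval s + f.eval s
  | sub e f => e.eval s - f.eval s
  | mul e f => e.eval s * f.eval s
  | div e f => e.eval s / f.eval s

/-- The cost of evaluating a real expression: one step for every node. -/
def RExpr.cost : RExpr → ℕ
  | const _ => 1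
  | ofIdx e => e.cost + 1
  | entry _ i j => i.cost + j.cost + 1
  | add e f => e.cost + f.cost + 1
  | sub e f => e.cost + f.cost + 1
  | mul e f => e.cost + f.cost + 1
  | div e f => e.cost + f.cost + 1

/-- Tests: comparisons of indices and of real numbers, and their Boolean combinations. -/
inductive Test where
  | idxLt (e f : IExpr)
  | realLt (e f : RExpr)
  | neg (b : Test)
  | conj (b c : Test)

/-- The truth value of a test. -/
def Test.holds (s : State) : Test → Prop
  | idxLt e f => e.eval s < f.eval s
  | realLt e f => e.eval s < f.eval s
  | neg b => ¬ b.holds s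
  | conj b c => b.holds s ∧ c.holds s

/-- The cost of a test: one step for every node. -/
def Test.cost : Test → ℕ
  | idxLt e f => e.cost + f.cost + 1
  | realLt e f => e.cost + f.cost + 1
  | neg b => b.cost + 1
  | conj b c => b.cost + c.cost + 1

/-- Programs. -/
inductive Prog where
  | skip
  | setIdx (v : ℕ) (e : IExpr)
  | setEntry (a : ℕ) (i j : IExpr) (e : RExpr)
  | seq (p q : Prog)
  | ite (b : Test) (p q : Prog)
  | loop (b : Test) (p : Prog)

/-- Store `k` in the index register `v`. -/
def State.setIdx (s : State) (v k : ℕ) : State where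
  idx := fun w => if w = v then k else s.idx w
  arr := s.arr

/-- Store `r` in the cell `(i, j)` of the array `a`. -/
noncomputable def State.setEntry (s : State) (a i j : ℕ) (r : ℝ) : State where
  idx := s.idx
  arr := fun a' i' j' => if a' = a ∧ i' = i ∧ j' = j then r else s.arr a' i' j'

/-- `p.Run s t s'` says that the program `p`, started in the state `s`, halts in the state `s'`
after exactly `t` steps. -/
inductive Prog.Run : Prog → State → ℕ → State → Prop
  | skip (s : State) : Prog.Run Prog.skip s 1 s
  | setIdx (v : ℕ) (e : IExpr) (s : State) :
      Prog.Run (Prog.setIdx v e) s (e.cost + 1) (s.setIdx v (e.eval s))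
  | setEntry (a : ℕ) (i j : IExpr) (e : RExpr) (s : State) :
      Prog.Run (Prog.setEntry a i j e) s (i.cost + j.cost + e.cost + 1)
        (s.setEntry a (i.eval s) (j.eval s) (e.eval s))
  | seq {p q : Prog} {s₁ s₂ s₃ : State} {t₁ t₂ : ℕ} :
      Prog.Run p s₁ t₁ s₂ → Prog.Run q s₂ t₂ s₃ → Prog.Run (Prog.seq p q) s₁ (t₁ + t₂) s₃
  | ite_true {b : Test} {p q : Prog} {s s' : State} {t : ℕ} :
      b.holds s → Prog.Run p s t s' → Prog.Run (Prog.ite b p q) s (b.cost + t + 1) s'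
  | ite_false {b : Test} {p q : Prog} {s s' : State} {t : ℕ} :
      ¬ b.holds s → Prog.Run q s t s' → Prog.Run (Prog.ite b p q) s (b.cost + t + 1) s'
  | loop_done {b : Test} {p : Prog} {s : State} :
      ¬ b.holds s → Prog.Run (Prog.loop b p) s (b.cost + 1) s
  | loop_step {b : Test} {p : Prog} {s₁ s₂ s₃ : State} {t₁ t₂ : ℕ} :
      b.holds s₁ → Prog.Run p s₁ t₁ s₂ → Prog.Run (Prog.loop b p) s₂ t₂ s₃ →
      Prog.Run (Prog.loop b p) s₁ (b.cost + t₁ + t₂ + 1) s₃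

/-- Programs are deterministic: the state determines the running time and the final state. -/
theorem Prog.Run.deterministic {p : Prog} {s s₁ s₂ : State} {t₁ t₂ : ℕ}
    (h₁ : p.Run s t₁ s₁) (h₂ : p.Run s t₂ s₂) : t₁ = t₂ ∧ s₁ = s₂ := by
  induction h₁ generalizing t₂ s₂ with
  | skip => cases h₂; exact ⟨rfl, rfl⟩
  | setIdx => cases h₂; exact ⟨rfl, rfl⟩
  | setEntry => cases h₂; exact ⟨rfl, rfl⟩
  | seq _ _ ih₁ ih₂ =>
    cases h₂ with
    | seq h h' =>
      obtain ⟨rfl, rfl⟩ := ih₁ h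
      obtain ⟨rfl, rfl⟩ := ih₂ h'
      exact ⟨rfl, rfl⟩
  | ite_true hb _ ih =>
    cases h₂ with
    | ite_true _ h => obtain ⟨rfl, rfl⟩ := ih h; exact ⟨rfl, rfl⟩
    | ite_false hb' _ => exact absurd hb hb'
  | ite_false hb _ ih =>
    cases h₂ with
    | ite_true hb' _ => exact absurd hb' hb
    | ite_false _ h => obtain ⟨rfl, rfl⟩ := ih h; exact ⟨rfl, rfl⟩
  | loop_done hb =>
    cases h₂ with
    | loop_done => exact ⟨rfl, rfl⟩
    | loop_step hb' => exact absurd hb' hb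
  | loop_step hb _ _ ih₁ ih₂ =>
    cases h₂ with
    | loop_done hb' => exact absurd hb hb'
    | loop_step _ h h' =>
      obtain ⟨rfl, rfl⟩ := ih₁ h
      obtain ⟨rfl, rfl⟩ := ih₂ h'
      exact ⟨rfl, rfl⟩

/-- The initial state on the input `A`: index register `0` holds `n`, array `0` holds the entries
of `A`, and everything else is `0`. -/
noncomputable def input {n : ℕ} (A : Matrix (Fin n) (Fin n) ℝ) : State where
  idx := fun v => if v = 0 then n else 0
  arr := fun a i j =>
    if h : a = 0 ∧ i < n ∧ j < n then A ⟨i, h.2.1⟩ ⟨j, h.2.2⟩ else 0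

/-- The output of length `n` is read off row `0` of array `1`. -/
def output (n : ℕ) (s : State) : Fin n → ℝ :=
  fun j => s.arr 1 0 j

end RealRAM

/-! A point `x` starts at `0` and moves inside the cube in steps of ℓ¹-length `1 / n`, always
orthogonally to itself, so `‖x‖²` grows by at least `1 / n ^ 3` per step. A coordinate within `1 /
n` of a sign is frozen. After `O(n ^ 4)` steps fewer than `20` coordinates are alive, and rounding
costs `O(1)`.

Each row `i` that may move has a scale `h` and two weights `P i`, `M i`, which dominate `exp (± h *
movement - 8 * h ^ 2 * gain)`. Here the gain is that of `∑ a ^ 2 x ^ 2`, and `a` is the row without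
the entries that are large compared to `1 / h`. The gain term pays for the second-order growth: in a
direction that is stationary to first order and satisfies a quadratic inequality, the total weight
grows by at most four times the growth of `‖x‖²` (`weight_step`). Such a direction exists,
orthogonal also to the few protected rows, by a trace argument on a Gram-Schmidt basis
(`IsOrthogonalization.exists_small`). Rows of weight above `900` are protected, so their weight
cannot grow. Hence all weights stay bounded, and this bounds the movement of the rows
(`Watched.bound`).

A new stage begins when the number `m` of alive coordinates has halved. If energy were spread
evenly, row `i` would have energy `b = m / n * rowSq n A i` on the alive columns. Applying `A ⊙ A`
to the centred indicator of the alive set shows that at most `m / 100` rows exceed `b + θ` once `θ >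
10 * lam A` (`sq_mul_badN_le`). These rows, and the at most `m / 100` rows with `b > 100`, stand
still during the stage. A row with `b > θ` moves by `O(b ^ (1/4))` in the stage
(`Watched.bound_stage`); `b` at least halves from stage to stage, so these movements sum
geometrically. Once `b ≤ θ` and the row is not in excess, it is locked: it keeps its scale to the
end and moves by `O(√(θ log n))` in total (`Watched.bound_locked`). The number `lam A` is never
computed: `θ` starts at `1 / harm n` and is doubled while too many rows are in excess. Invariance is
`GoodDir.inv_move` within a stage and `Inv.stage` between stages.

The algorithm needs only field operations and comparisons in loops of length at most `3 * n + 2`. It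
is written in a small language of bounded sums and loops, all of whose programs compile to
polynomial time (`Cmd.exists_prog`). -/

namespace RealRAM

/-! ### Hoare-style rules with time bounds -/

/-- `Halts p s T Q`: started in `s`, the program `p` halts within `T` steps in a state with `Q`. -/
def Halts (p : Prog) (s : State) (T : ℕ) (Q : State → Prop) : Prop :=
  ∃ t s', p.Run s t s' ∧ t ≤ T ∧ Q s'

theorem Halts.mono {p : Prog} {s : State} {T T' : ℕ} {Q Q' : State → Prop}
    (h : Halts p s T Q) (hT : T ≤ T') (hQ : ∀ s', Q s' → Q' s') : Halts p s T' Q' := by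
  obtain ⟨t, s', h1, h2, h3⟩ := h
  exact ⟨t, s', h1, h2.trans hT, hQ _ h3⟩

theorem Halts.seq {p q : Prog} {s : State} {T₁ T₂ : ℕ} {R Q : State → Prop}
    (h₁ : Halts p s T₁ R) (h₂ : ∀ s', R s' → Halts q s' T₂ Q) :
    Halts (Prog.seq p q) s (T₁ + T₂) Q := by
  obtain ⟨t, s', h1, h2, h3⟩ := h₁
  obtain ⟨t', s'', h1', h2', h3'⟩ := h₂ s' h3
  exact ⟨t + t', s'', .seq h1 h1', by omega, h3'⟩

theorem Halts.setIdx {v : ℕ} {e : IExpr} {s : State} {Q : State → Prop}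
    (h : Q (s.setIdx v (e.eval s))) : Halts (Prog.setIdx v e) s (e.cost + 1) Q :=
  ⟨_, _, .setIdx v e s, le_rfl, h⟩

theorem Halts.setEntry {a : ℕ} {i j : IExpr} {e : RExpr} {s : State} {Q : State → Prop}
    (h : Q (s.setEntry a (i.eval s) (j.eval s) (e.eval s))) :
    Halts (Prog.setEntry a i j e) s (i.cost + j.cost + e.cost + 1) Q :=
  ⟨_, _, .setEntry a i j e s, le_rfl, h⟩

/-- A bounded loop in the register `v`, which is `0` before and after. -/
def Prog.for (v : ℕ) (b : IExpr) (p : Prog) : Prog :=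
  .seq (.loop (.idxLt (.var v) b) (.seq p (.setIdx v (.add (.var v) (.const 1)))))
    (.setIdx v (.const 0))

/-- The loop bound is re-evaluated in every round, so `hb` asks for the constant value `N`
throughout. The reset of the register stays visible in the postcondition because the next run of the
same loop needs it to be `0`. -/
theorem Halts.for {v : ℕ} {b : IExpr} {p : Prog} {N T : ℕ} (I : ℕ → State → Prop) {s : State}
    (hv : s.idx v = 0) (h0 : I 0 s) (hb : ∀ k s', I k s' → s'.idx v = k → b.eval s' = N)
    (step : ∀ k < N, ∀ s', s'.idx v = k → I k s' →
      Halts p s' T (fun s'' => s''.idx v = k ∧ I (k + 1) (s''.setIdx v (k + 1)))) :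
    Halts (Prog.for v b p) s (N * (T + b.cost + 10) + b.cost + 10)
      (fun s' => ∃ s₀, I N s₀ ∧ s' = s₀.setIdx v 0) := by
  have key : ∀ j k, k + j = N → ∀ s', s'.idx v = k → I k s' →
      Halts (.loop (.idxLt (.var v) b) (.seq p (.setIdx v (.add (.var v) (.const 1))))) s'
        (j * (T + b.cost + 10) + b.cost + 3) (I N) := by
    intro j
    induction j with
    | zero =>
      intro k hk s' hs hI
      refine ⟨_, s', .loop_done ?_, ?_, ?_⟩
      · simp [Test.holds, IExpr.eval, hs, hb k s' hI hs]; omega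
      · simp [Test.cost, IExpr.cost]; omega
      · have : k = N := by omega
        exact this ▸ hI
    | succ j ih =>
      intro k hk s' hs hI
      obtain ⟨t, s'', h1, h2, h3, h4⟩ := step k (by omega) s' hs hI
      obtain ⟨t', s₃, g1, g2, g3⟩ := ih (k + 1) (by omega) (s''.setIdx v (k + 1))
        (by simp [State.setIdx]) h4
      refine ⟨_, s₃, .loop_step (t₂ := t') ?_ (.seq h1 (.setIdx _ _ _)) ?_, ?_, g3⟩
      · simp [Test.holds, IExpr.eval, hs, hb k s' hI hs]; omega
      · simpa [IExpr.eval, h3] using g1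
      · simp only [Test.cost, IExpr.cost]
        rw [Nat.succ_mul]
        omega
  refine ((key N 0 (by omega) s hv h0).seq (T₂ := 2) (Q := fun s' => ∃ s₀, I N s₀ ∧
    s' = s₀.setIdx v 0) ?_).mono (by omega) (fun _ h => h)
  intro s' hs'
  exact Halts.setIdx ⟨s', hs', rfl⟩

/-! ### Terms with bounded sums and their compilation -/

/-- The value of an index expression in terms of the index registers alone. -/
def IExpr.val (ρ : ℕ → ℕ) (e : IExpr) : ℕ := e.eval ⟨ρ, fun _ _ _ => 0⟩

theorem IExpr.eval_eq_val (e : IExpr) (s : State) : e.eval s = e.val s.idx := by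
  unfold IExpr.val
  induction e <;> simp_all [IExpr.eval]

@[simp] theorem IExpr.val_const (ρ : ℕ → ℕ) (k : ℕ) : (IExpr.const k).val ρ = k := rfl
@[simp] theorem IExpr.val_var (ρ : ℕ → ℕ) (v : ℕ) : (IExpr.var v).val ρ = ρ v := rfl
@[simp] theorem IExpr.val_add (ρ : ℕ → ℕ) (e f : IExpr) :
    (IExpr.add e f).val ρ = e.val ρ + f.val ρ := rfl
@[simp] theorem IExpr.val_sub (ρ : ℕ → ℕ) (e f : IExpr) :
    (IExpr.sub e f).val ρ = e.val ρ - f.val ρ := rfl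

/-- The contents of all arrays. -/
abbrev Arr := ℕ → ℕ → ℕ → ℝ

/-- Loop bounds: `1`, `n` or `3 * n + 2`, where `n` is in register `0`. -/
inductive Bd where
  | one
  | dim
  | big

def Bd.expr : Bd → IExpr
  | one => .const 1
  | dim => .var 0
  | big => .add (.add (.var 0) (.add (.var 0) (.var 0))) (.const 2)

def Bd.val (n : ℕ) : Bd → ℕ
  | one => 1
  | dim => n
  | big => 3 * n + 2

theorem Bd.val_expr (b : Bd) (ρ : ℕ → ℕ) : b.expr.val ρ = b.val (ρ 0) := by
  cases b <;> simp [Bd.expr, Bd.val]; omega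

theorem Bd.val_le (b : Bd) (n : ℕ) : b.val n ≤ 3 * n + 2 := by
  cases b <;> simp only [Bd.val] <;> omega

theorem Bd.cost_le (b : Bd) : b.expr.cost ≤ 7 := by
  cases b <;> simp [Bd.expr, IExpr.cost]

/-- Real terms with conditionals and bounded sums. A sum in a context with `d` bound variables
binds register `d + 1`. -/
inductive Tm where
  | rat (q : ℚ)
  | idx (e : IExpr)
  | get (a : ℕ) (i j : IExpr)
  | add (t u : Tm)
  | sub (t u : Tm)
  | mul (t u : Tm)
  | div (t u : Tm)
  | ite (t u v w : Tm)
  | sum (b : Bd) (t : Tm)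

open Classical in
/-- The value of a term; `ite t u v w` means `if t < u then v else w`. -/
noncomputable def Tm.eval (M : Arr) : Tm → ℕ → (ℕ → ℕ) → ℝ
  | rat q, _, _ => (q : ℝ)
  | idx e, _, ρ => (e.val ρ : ℝ)
  | get a i j, _, ρ => M a (i.val ρ) (j.val ρ)
  | add t u, d, ρ => t.eval M d ρ + u.eval M d ρ
  | sub t u, d, ρ => t.eval M d ρ - u.eval M d ρ
  | mul t u, d, ρ => t.eval M d ρ * u.eval M d ρ
  | div t u, d, ρ => t.eval M d ρ / u.eval M d ρ
  | ite t u v w, d, ρ => if t.eval M d ρ < u.eval M d ρ then v.eval M d ρ else w.eval M d ρ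
  | sum b t, d, ρ =>
    ∑ k ∈ Finset.range (b.val (ρ 0)), t.eval M (d + 1) (Function.update ρ (d + 1) k)

/-- Physical array `2` is scratch space. -/
def phys (a : ℕ) : ℕ := if a < 2 then a else a + 1

theorem phys_ne (a : ℕ) : phys a ≠ 2 := by unfold phys; split_ifs <;> omega

theorem phys_inj {a b : ℕ} : phys a = phys b ↔ a = b := by unfold phys; split_ifs <;> omega

/-- The scratch cell `p` as an expression. -/
def tmp (p : ℕ) : RExpr := .entry 2 (.const 0) (.const p)

/-- Store the value of an expression in the scratch cell `p`. -/
def setTmp (p : ℕ) (e : RExpr) : Prog := .setEntry 2 (.const 0) (.const p) e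

/-- Evaluate a term in a context with `d` bound variables into the scratch cell `p`. -/
def Tm.compile : Tm → ℕ → ℕ → Prog
  | rat q, _, p => setTmp p (.const q)
  | idx e, _, p => setTmp p (.ofIdx e)
  | get a i j, _, p => setTmp p (.entry (phys a) i j)
  | add t u, d, p => .seq (.seq (t.compile d p) (u.compile d (p + 1)))
      (setTmp p (.add (tmp p) (tmp (p + 1))))
  | sub t u, d, p => .seq (.seq (t.compile d p) (u.compile d (p + 1)))
      (setTmp p (.sub (tmp p) (tmp (p + 1))))
  | mul t u, d, p => .seq (.seq (t.compile d p) (u.compile d (p + 1)))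
      (setTmp p (.mul (tmp p) (tmp (p + 1))))
  | div t u, d, p => .seq (.seq (t.compile d p) (u.compile d (p + 1)))
      (setTmp p (.div (tmp p) (tmp (p + 1))))
  | ite t u v w, d, p => .seq (.seq (t.compile d p) (u.compile d (p + 1)))
      (.ite (.realLt (tmp p) (tmp (p + 1))) (v.compile d p) (w.compile d p))
  | sum b t, d, p => .seq (setTmp p (.const 0))
      (.for (d + 1) b.expr (.seq (t.compile (d + 1) (p + 1))
        (setTmp p (.add (tmp p) (tmp (p + 1))))))

/-- A bound for the time to evaluate a term. -/
def Tm.cost : Tm → ℕ → ℕ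
  | rat _, _ => 10
  | idx e, _ => e.cost + 10
  | get _ i j, _ => i.cost + j.cost + 10
  | add t u, n => t.cost n + u.cost n + 20
  | sub t u, n => t.cost n + u.cost n + 20
  | mul t u, n => t.cost n + u.cost n + 20
  | div t u, n => t.cost n + u.cost n + 20
  | ite t u v w, n => t.cost n + u.cost n + v.cost n + w.cost n + 20
  | sum _ t, n => (3 * n + 2) * (t.cost n + 50) + 50

/-- The state `s` holds the registers `ρ` and the arrays `M`. -/
structure Holds (ρ : ℕ → ℕ) (M : Arr) (s : State) : Prop where
  idx : s.idx = ρ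
  arr : ∀ a, s.arr (phys a) = M a

/-- The scratch space of `s` and `s'` agrees outside of the cells from `p` on in row `0`. -/
def ScratchEq (p : ℕ) (s s' : State) : Prop :=
  ∀ i j, (i ≠ 0 ∨ j < p) → s'.arr 2 i j = s.arr 2 i j

theorem ScratchEq.trans {p q : ℕ} {s s' s'' : State} (h : ScratchEq p s s')
    (h' : ScratchEq q s' s'') (hpq : p ≤ q) : ScratchEq p s s'' := by
  intro i j hij
  rw [h' i j (by omega), h i j hij]

/-- The effect of evaluating a term. -/
def EvalTo (ρ : ℕ → ℕ) (M : Arr) (p : ℕ) (s : State) (r : ℝ) (s' : State) : Prop :=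
  Holds ρ M s' ∧ s'.arr 2 0 p = r ∧ ScratchEq p s s'

theorem setTmp_spec {ρ : ℕ → ℕ} {M : Arr} {s : State} (hs : Holds ρ M s) (p : ℕ) (e : RExpr) :
    Halts (setTmp p e) s (e.cost + 3) (EvalTo ρ M p s (e.eval s)) := by
  refine (Halts.setEntry ?_).mono (by simp [IExpr.cost]; omega) (fun _ h => h)
  refine ⟨⟨hs.idx, fun a => ?_⟩, ?_, ?_⟩
  · funext i j
    simp [State.setEntry, phys_ne, ← hs.arr]
  · simp [State.setEntry, IExpr.eval]
  · intro i j hij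
    simp [State.setEntry, IExpr.eval]
    omega

/-- The second operand is evaluated one scratch cell higher, so the first value in cell `p`
survives. -/
theorem binop_spec {ρ : ℕ → ℕ} {M : Arr} {s : State} {pt pu : Prog} {p ct cu : ℕ} {x y : ℝ}
    (ht : ∀ s, Holds ρ M s → Halts pt s ct (EvalTo ρ M p s x))
    (hu : ∀ s, Holds ρ M s → Halts pu s cu (EvalTo ρ M (p + 1) s y)) (hs : Holds ρ M s) :
    Halts (.seq pt pu) s (ct + cu) (fun s' => Holds ρ M s' ∧ s'.arr 2 0 p = x ∧
      s'.arr 2 0 (p + 1) = y ∧ ScratchEq p s s') := by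
  refine (ht s hs).seq ?_
  rintro s₁ ⟨h1, h2, h3⟩
  refine (hu s₁ h1).mono le_rfl ?_
  rintro s₂ ⟨g1, g2, g3⟩
  exact ⟨g1, by rw [g3 0 p (by omega), h2], g2, h3.trans g3 (by omega)⟩

theorem arith_spec {ρ : ℕ → ℕ} {M : Arr} {s : State} {pt pu : Prog} {p ct cu : ℕ} {x y : ℝ}
    (f : RExpr → RExpr → RExpr) (g : ℝ → ℝ → ℝ)
    (hf : ∀ e e' s, (f e e').eval s = g (e.eval s) (e'.eval s))
    (hc : ∀ e e', (f e e').cost = e.cost + e'.cost + 1)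
    (ht : ∀ s, Holds ρ M s → Halts pt s ct (EvalTo ρ M p s x))
    (hu : ∀ s, Holds ρ M s → Halts pu s cu (EvalTo ρ M (p + 1) s y)) (hs : Holds ρ M s) :
    Halts (.seq (.seq pt pu) (setTmp p (f (tmp p) (tmp (p + 1))))) s (ct + cu + 20)
      (EvalTo ρ M p s (g x y)) := by
  refine ((binop_spec ht hu hs).seq (T₂ := 20) (Q := EvalTo ρ M p s (g x y)) ?_).mono
    (by omega) (fun _ h => h)
  rintro s₁ ⟨h1, h2, h3, h4⟩
  refine (setTmp_spec h1 p _).mono (by simp [hc, tmp, RExpr.cost, IExpr.cost]) ?_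
  rintro s₂ ⟨g1, g2, g3⟩
  refine ⟨g1, ?_, h4.trans g3 le_rfl⟩
  rw [g2, hf]
  simp [tmp, RExpr.eval, IExpr.eval, h2, h3]

theorem Holds.setIdx {ρ : ℕ → ℕ} {M : Arr} {s : State} (h : Holds ρ M s) (v k : ℕ) :
    Holds (Function.update ρ v k) M (s.setIdx v k) := by
  refine ⟨?_, h.arr⟩
  funext w
  simp [State.setIdx, Function.update_apply, h.idx]

theorem Bd.eval_expr {b : Bd} {ρ : ℕ → ℕ} {M : Arr} {s : State} (h : Holds ρ M s) :
    b.expr.eval s = b.val (ρ 0) := by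
  rw [IExpr.eval_eq_val, h.idx, Bd.val_expr]

theorem update_vanish {ρ : ℕ → ℕ} {d : ℕ} (h : ∀ v, d < v → ρ v = 0) (k : ℕ) :
    ∀ v, d + 1 < v → Function.update ρ (d + 1) k v = 0 := by
  intro v hv
  rw [Function.update_of_ne (by omega), h v (by omega)]

theorem update_self_zero {ρ : ℕ → ℕ} {d : ℕ} (h : ∀ v, d < v → ρ v = 0) (k : ℕ) :
    Function.update (Function.update ρ (d + 1) k) (d + 1) 0 = ρ := by
  rw [Function.update_idem, ← h (d + 1) (by omega), Function.update_eq_self]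

/-- A bounded loop at depth `d` whose body preserves `Holds` and turns `J k` into `J (k + 1)`. -/
theorem for_spec {ρ : ℕ → ℕ} {d : ℕ} (hρ : ∀ v, d < v → ρ v = 0) {b : Bd} {p : Prog} {T : ℕ}
    (N : ℕ → Arr) (J : ℕ → (ℕ → ℕ → ℝ) → Prop) {s : State} (hs : Holds ρ (N 0) s)
    (h0 : J 0 (s.arr 2))
    (step : ∀ k < b.val (ρ 0), ∀ s', Holds (Function.update ρ (d + 1) k) (N k) s' →
      J k (s'.arr 2) → Halts p s' T (fun s'' =>
        Holds (Function.update ρ (d + 1) k) (N (k + 1)) s'' ∧ J (k + 1) (s''.arr 2))) :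
    Halts (.for (d + 1) b.expr p) s ((3 * ρ 0 + 2) * (T + 17) + 17)
      (fun s' => Holds ρ (N (b.val (ρ 0))) s' ∧ J (b.val (ρ 0)) (s'.arr 2)) := by
  have h0ρ : ∀ k, Function.update ρ (d + 1) k 0 = ρ 0 := fun k =>
    Function.update_of_ne (by omega) _ _
  refine (Halts.for (v := d + 1) (b := b.expr) (p := p) (N := b.val (ρ 0)) (T := T)
    (fun k s' => Holds (Function.update ρ (d + 1) k) (N k) s' ∧ J k (s'.arr 2))
    (by rw [hs.idx]; exact hρ _ (by omega)) ⟨?_, h0⟩ ?_ ?_).mono ?_ ?_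
  · have h1 : Function.update ρ (d + 1) 0 = ρ := by
      rw [← hρ (d + 1) (by omega), Function.update_eq_self]
    rwa [h1]
  · rintro k s' ⟨h, -⟩ -
    rw [Bd.eval_expr h, h0ρ]
  · rintro k hk s' - ⟨h, hJ⟩
    refine (step k hk s' h hJ).mono le_rfl ?_
    rintro s'' ⟨g, gJ⟩
    refine ⟨by rw [g.idx]; simp, ?_, gJ⟩
    have := g.setIdx (d + 1) (k + 1)
    rwa [Function.update_idem] at this
  · have h1 := b.val_le (ρ 0)
    have h2 := b.cost_le
    have h3 : b.val (ρ 0) * (T + b.expr.cost + 10) ≤ (3 * ρ 0 + 2) * (T + 17) :=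
      Nat.mul_le_mul h1 (by omega)
    omega
  · rintro s' ⟨s₀, ⟨h, hJ⟩, rfl⟩
    refine ⟨?_, hJ⟩
    have := h.setIdx (d + 1) 0
    rwa [update_self_zero hρ] at this

/-- Induction on the term. Since all registers above `d` vanish, a sum can use register `d + 1` as a
fresh counter and return to the same `ρ`. -/
theorem Tm.compile_spec (t : Tm) : ∀ (d p : ℕ) (ρ : ℕ → ℕ) (M : Arr) (s : State),
    (∀ v, d < v → ρ v = 0) → Holds ρ M s →
    Halts (t.compile d p) s (t.cost (ρ 0)) (EvalTo ρ M p s (t.eval M d ρ)) := by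
  induction t with
  | rat q =>
    intro d p ρ M s _ hs
    exact (setTmp_spec hs p _).mono (by simp [RExpr.cost, Tm.cost]) (fun _ h => h)
  | idx e =>
    intro d p ρ M s _ hs
    refine (setTmp_spec hs p _).mono (by simp [RExpr.cost, Tm.cost]) ?_
    simp [RExpr.eval, IExpr.eval_eq_val, hs.idx, Tm.eval]
  | get a i j =>
    intro d p ρ M s _ hs
    refine (setTmp_spec hs p _).mono (by simp [RExpr.cost, Tm.cost]) ?_
    simp [RExpr.eval, IExpr.eval_eq_val, hs.idx, hs.arr, Tm.eval]
  | add t u iht ihu =>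
    intro d p ρ M s hρ hs
    exact arith_spec .add (· + ·) (fun _ _ _ => rfl) (fun _ _ => rfl)
      (fun s hs => iht d p ρ M s hρ hs) (fun s hs => ihu d _ ρ M s hρ hs) hs
  | sub t u iht ihu =>
    intro d p ρ M s hρ hs
    exact arith_spec .sub (· - ·) (fun _ _ _ => rfl) (fun _ _ => rfl)
      (fun s hs => iht d p ρ M s hρ hs) (fun s hs => ihu d _ ρ M s hρ hs) hs
  | mul t u iht ihu =>
    intro d p ρ M s hρ hs
    exact arith_spec .mul (· * ·) (fun _ _ _ => rfl) (fun _ _ => rfl)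
      (fun s hs => iht d p ρ M s hρ hs) (fun s hs => ihu d _ ρ M s hρ hs) hs
  | div t u iht ihu =>
    intro d p ρ M s hρ hs
    exact arith_spec .div (· / ·) (fun _ _ _ => rfl) (fun _ _ => rfl)
      (fun s hs => iht d p ρ M s hρ hs) (fun s hs => ihu d _ ρ M s hρ hs) hs
  | ite t u v w iht ihu ihv ihw =>
    intro d p ρ M s hρ hs
    refine ((binop_spec (fun s hs => iht d p ρ M s hρ hs)
      (fun s hs => ihu d (p + 1) ρ M s hρ hs) hs).seq
      (T₂ := v.cost (ρ 0) + w.cost (ρ 0) + 20) (Q := EvalTo ρ M p s _) ?_).mono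
      (by simp only [Tm.cost]; omega) (fun _ h => h)
    rintro s₁ ⟨h1, h2, h3, h4⟩
    have e1 : (tmp p).eval s₁ = t.eval M d ρ := by simp [tmp, RExpr.eval, IExpr.eval, h2]
    have e2 : (tmp (p + 1)).eval s₁ = u.eval M d ρ := by simp [tmp, RExpr.eval, IExpr.eval, h3]
    by_cases hlt : t.eval M d ρ < u.eval M d ρ
    · obtain ⟨t', s', g1, g2, g3, g4, g5⟩ := ihv d p ρ M s₁ hρ h1
      refine ⟨_, s', .ite_true (by simpa [Test.holds, e1, e2] using hlt) g1, ?_, g3, ?_,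
        h4.trans g5 le_rfl⟩
      · simp [Test.cost, tmp, RExpr.cost, IExpr.cost]; omega
      · rw [g4]; simp [Tm.eval, hlt]
    · obtain ⟨t', s', g1, g2, g3, g4, g5⟩ := ihw d p ρ M s₁ hρ h1
      refine ⟨_, s', .ite_false (by simpa [Test.holds, e1, e2] using hlt) g1, ?_, g3, ?_,
        h4.trans g5 le_rfl⟩
      · simp [Test.cost, tmp, RExpr.cost, IExpr.cost]; omega
      · rw [g4]; simp [Tm.eval, hlt]
  | sum b t iht =>
    intro d p ρ M s hρ hs
    refine ((setTmp_spec hs p _).seq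
      (T₂ := (3 * ρ 0 + 2) * (t.cost (ρ 0) + 50) + 17) (Q := EvalTo ρ M p s _) ?_).mono
      (by simp only [Tm.cost, RExpr.cost]; omega) (fun _ h => h)
    rintro s₁ ⟨h1, h2, h3⟩
    -- Loop invariant: cell `p` holds the partial sum and the cells below `p` are untouched.
    refine (for_spec hρ (T := t.cost (ρ 0) + 20) (fun _ => M)
      (fun k J => J 0 p = ∑ l ∈ Finset.range k,
          t.eval M (d + 1) (Function.update ρ (d + 1) l) ∧
        ∀ i j, (i ≠ 0 ∨ j < p) → J i j = s.arr 2 i j) h1 ⟨?_, h3⟩ ?_).mono ?_ ?_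
    · rw [h2]; simp [RExpr.eval]
    · rintro k hk s' hs' ⟨hJ1, hJ2⟩
      have h0ρ : Function.update ρ (d + 1) k 0 = ρ 0 := Function.update_of_ne (by omega) _ _
      have hc := iht (d + 1) (p + 1) _ M s' (update_vanish hρ k) hs'
      rw [h0ρ] at hc
      refine (hc.seq (T₂ := 20) (Q := fun s'' => _) ?_).mono le_rfl (fun _ h => h)
      rintro s₂ ⟨g1, g2, g3⟩
      refine (setTmp_spec g1 p _).mono (by simp [tmp, RExpr.cost, IExpr.cost]) ?_
      rintro s₃ ⟨f1, f2, f3⟩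
      refine ⟨f1, ?_, ?_⟩
      · rw [f2, Finset.sum_range_succ]
        simp [tmp, RExpr.eval, IExpr.eval, g2]
        rw [g3 0 p (by omega), hJ1]
      · intro i j hij
        rw [f3 i j hij, g3 i j (by omega), hJ2 i j hij]
    · have : (3 * ρ 0 + 2) * (t.cost (ρ 0) + 20 + 17) ≤
        (3 * ρ 0 + 2) * (t.cost (ρ 0) + 50) := Nat.mul_le_mul le_rfl (by omega)
      omega
    · rintro s' ⟨g1, g2, g3⟩
      exact ⟨g1, g2, g3⟩

/-! ### Loop programs and their compilation -/

/-- Loop programs. At depth `d`, `map a b c t` simultaneously assigns the value of `t` to every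
entry `(i, j)` of the array `a` with `i < b` and `j < c`, where `i` and `j` are in the registers
`d + 1` and `d + 2`, and `rep b p` repeats `p` for all values below `b` of the register `d + 1`. -/
inductive Cmd where
  | map (a : ℕ) (b c : Bd) (t : Tm)
  | seq (p q : Cmd)
  | rep (b : Bd) (p : Cmd)

/-- The effect of the body of a loop, repeated `k` times. -/
def iter (f : ℕ → Arr → Arr) (M : Arr) : ℕ → Arr
  | 0 => M
  | k + 1 => f k (iter f M k)

noncomputable def Cmd.exec : Cmd → ℕ → (ℕ → ℕ) → Arr → Arr
  | map a b c t, d, ρ, M => Function.update M a fun i j =>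
      if i < b.val (ρ 0) ∧ j < c.val (ρ 0) then
        t.eval M (d + 2) (Function.update (Function.update ρ (d + 1) i) (d + 2) j)
      else M a i j
  | seq p q, d, ρ, M => q.exec d ρ (p.exec d ρ M)
  | rep b p, d, ρ, M =>
      iter (fun k => p.exec (d + 1) (Function.update ρ (d + 1) k)) M (b.val (ρ 0))

/-- A simultaneous assignment needs a buffer, since `t` may read the array that is written. The
values first go to the scratch array, shifted by one row because row `0` serves the evaluation of
terms; a second double loop copies them. -/
def Cmd.compile : Cmd → ℕ → Prog
  | map a b c t, d => .seq
      (.for (d + 1) b.expr (.for (d + 2) c.expr (.seq (t.compile (d + 2) 0)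
        (.setEntry 2 (.add (.var (d + 1)) (.const 1)) (.var (d + 2)) (tmp 0)))))
      (.for (d + 1) b.expr (.for (d + 2) c.expr
        (.setEntry (phys a) (.var (d + 1)) (.var (d + 2))
          (.entry 2 (.add (.var (d + 1)) (.const 1)) (.var (d + 2))))))
  | seq p q, d => .seq (p.compile d) (q.compile d)
  | rep b p, d => .for (d + 1) b.expr (p.compile (d + 1))

def Cmd.cost : Cmd → ℕ → ℕ
  | map _ _ _ t, n => (3 * n + 2) * ((3 * n + 2) * (t.cost n + 50) + 50) + 50 +
      ((3 * n + 2) * ((3 * n + 2) * 50 + 50) + 50)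
  | seq p q, n => p.cost n + q.cost n
  | rep _ p, n => (3 * n + 2) * (p.cost n + 17) + 17

theorem Cmd.compile_spec (p : Cmd) : ∀ (d : ℕ) (ρ : ℕ → ℕ) (M : Arr) (s : State),
    (∀ v, d < v → ρ v = 0) → Holds ρ M s →
    Halts (p.compile d) s (p.cost (ρ 0)) (Holds ρ (p.exec d ρ M)) := by
  induction p with
  | seq p q ihp ihq =>
    intro d ρ M s hρ hs
    exact (ihp d ρ M s hρ hs).seq (fun s' hs' => ihq d ρ _ s' hρ hs')
  | rep b p ih =>
    intro d ρ M s hρ hs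
    refine (for_spec hρ (T := p.cost (ρ 0))
      (iter (fun k => p.exec (d + 1) (Function.update ρ (d + 1) k)) M) (fun _ _ => True) hs
      trivial ?_).mono le_rfl (fun _ h => h.1)
    intro k hk s' hs' _
    have h0ρ : Function.update ρ (d + 1) k 0 = ρ 0 := Function.update_of_ne (by omega) _ _
    have := ih (d + 1) _ _ s' (update_vanish hρ k) hs'
    rw [h0ρ] at this
    exact this.mono le_rfl (fun _ h => ⟨h, trivial⟩)
  | map a b c t =>
    intro d ρ M s hρ hs
    have h0ρ : ∀ k, Function.update ρ (d + 1) k 0 = ρ 0 := fun k =>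
      Function.update_of_ne (by omega) _ _
    have h0ρ' : ∀ k l, Function.update (Function.update ρ (d + 1) k) (d + 2) l 0 = ρ 0 := by
      intro k l
      rw [Function.update_of_ne (by omega), h0ρ]
    have hd1 : ∀ k l, Function.update (Function.update ρ (d + 1) k) (d + 2) l (d + 1) = k := by
      intro k l
      rw [Function.update_of_ne (by omega), Function.update_self]
    have hd2 : ∀ k l, Function.update (Function.update ρ (d + 1) k) (d + 2) l (d + 2) = l := by
      intro k l
      rw [Function.update_self]
    set F : ℕ → ℕ → ℝ := fun i j =>
      t.eval M (d + 2) (Function.update (Function.update ρ (d + 1) i) (d + 2) j) with hF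
    have first : Halts (.for (d + 1) b.expr (.for (d + 2) c.expr (.seq (t.compile (d + 2) 0)
        (.setEntry 2 (.add (.var (d + 1)) (.const 1)) (.var (d + 2)) (tmp 0))))) s
        ((3 * ρ 0 + 2) * ((3 * ρ 0 + 2) * (t.cost (ρ 0) + 50) + 50) + 50)
        (fun s' => Holds ρ M s' ∧ ∀ i < b.val (ρ 0), ∀ j < c.val (ρ 0),
          s'.arr 2 (i + 1) j = F i j) := by
      refine (for_spec hρ (T := (3 * ρ 0 + 2) * (t.cost (ρ 0) + 50) + 17) (fun _ => M)
        (fun k J => ∀ i < k, ∀ j < c.val (ρ 0), J (i + 1) j = F i j) hs (by simp) ?_).mono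
        ?_ (fun _ h => h)
      · intro k hk s' hs' hJ
        have := for_spec (update_vanish hρ k) (b := c) (T := t.cost (ρ 0) + 20)
          (p := .seq (t.compile (d + 2) 0)
            (.setEntry 2 (.add (.var (d + 1)) (.const 1)) (.var (d + 2)) (tmp 0)))
          (fun _ => M) (fun l J => (∀ i < k, ∀ j < c.val (ρ 0), J (i + 1) j = F i j) ∧
            ∀ j < l, J (k + 1) j = F k j) hs' ⟨hJ, by simp⟩ ?_
        · rw [h0ρ] at this
          refine this.mono ?_ ?_
          · have : (3 * ρ 0 + 2) * (t.cost (ρ 0) + 20 + 17) ≤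
              (3 * ρ 0 + 2) * (t.cost (ρ 0) + 50) := Nat.mul_le_mul le_rfl (by omega)
            omega
          · rintro s'' ⟨g1, g2, g3⟩
            refine ⟨g1, fun i hi j hj => ?_⟩
            rcases Nat.lt_succ_iff_lt_or_eq.mp hi with h | rfl
            · exact g2 i h j hj
            · exact g3 j hj
        · rintro l hl s₁ hs₁ ⟨hJ1, hJ2⟩
          have hc := t.compile_spec (d + 2) 0 _ M s₁ (update_vanish (update_vanish hρ k) l) hs₁
          rw [h0ρ'] at hc
          refine (hc.seq (T₂ := 20) (Q := fun s'' => _) ?_).mono le_rfl (fun _ h => h)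
          rintro s₂ ⟨g1, g2, g3⟩
          refine (Halts.setEntry (Q := fun s'' => _) ⟨⟨g1.idx, ?_⟩, ?_, ?_⟩).mono
            (by simp [tmp, RExpr.cost, IExpr.cost]) (fun _ h => h)
          · intro a'
            funext i j
            simp [State.setEntry, phys_ne, ← g1.arr]
          · intro i hi j hj
            simp only [State.setEntry, IExpr.eval_eq_val, g1.idx, IExpr.val_add, IExpr.val_var,
              IExpr.val_const, hd1]
            rw [if_neg (by omega), g3 _ _ (by omega), hJ1 i hi j hj]
          · intro j hj
            simp only [State.setEntry, IExpr.eval_eq_val, g1.idx, IExpr.val_add, IExpr.val_var,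
              IExpr.val_const, hd1, hd2]
            by_cases hjl : j = l
            · subst hjl
              simp [tmp, RExpr.eval, IExpr.eval, g2, hF]
            · rw [if_neg (by omega), g3 _ _ (by omega), hJ2 j (by omega)]
      · have : (3 * ρ 0 + 2) * ((3 * ρ 0 + 2) * (t.cost (ρ 0) + 50) + 17 + 17) ≤
          (3 * ρ 0 + 2) * ((3 * ρ 0 + 2) * (t.cost (ρ 0) + 50) + 50) :=
            Nat.mul_le_mul le_rfl (by omega)
        omega
    refine first.seq ?_
    rintro s₁ ⟨hs₁, hbuf⟩
    -- The memory when the copying has finished the rows below `k` and the first `l` entries of row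
    -- `k`.
    let N : ℕ → ℕ → Arr := fun k l => Function.update M a fun i j =>
      if j < c.val (ρ 0) ∧ (i < k ∨ (i = k ∧ j < l)) then F i j else M a i j
    refine (for_spec hρ (T := (3 * ρ 0 + 2) * 50 + 17) (fun k => N k 0)
        (fun _ J => ∀ i < b.val (ρ 0), ∀ j < c.val (ρ 0), J (i + 1) j = F i j)
        (s := s₁) ?_ hbuf ?_).mono ?_ ?_
    · have : N 0 0 = M := by simp [N]
      rwa [this]
    · intro k hk s' hs' hJ
      have := for_spec (update_vanish hρ k) (b := c) (T := 20)
        (p := .setEntry (phys a) (.var (d + 1)) (.var (d + 2))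
          (.entry 2 (.add (.var (d + 1)) (.const 1)) (.var (d + 2)))) (N k)
        (fun _ J => ∀ i < b.val (ρ 0), ∀ j < c.val (ρ 0), J (i + 1) j = F i j) hs' hJ ?_
      · rw [h0ρ] at this
        refine this.mono ?_ ?_
        · have : (3 * ρ 0 + 2) * (20 + 17) ≤ (3 * ρ 0 + 2) * 50 :=
            Nat.mul_le_mul le_rfl (by omega)
          omega
        · rintro s'' ⟨g1, g2⟩
          have : N k (c.val (ρ 0)) = N (k + 1) 0 := by
            simp only [N]
            congr 1
            funext i j
            congr 1
            apply propext
            constructor <;> (rintro ⟨h, h'⟩; refine ⟨h, ?_⟩; omega)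
          exact ⟨this ▸ g1, g2⟩
      · intro l hl s₂ hs₂ hJ2
        rw [h0ρ] at hl
        refine (Halts.setEntry (Q := fun s'' => _) ⟨⟨hs₂.idx, ?_⟩, ?_⟩).mono
          (by simp [RExpr.cost, IExpr.cost]) (fun _ h => h)
        · intro a'
          funext i j
          simp only [State.setEntry, IExpr.eval_eq_val, hs₂.idx, IExpr.val_var, hd1, hd2,
            RExpr.eval, IExpr.val_add, IExpr.val_const, hJ2 k hk l hl, hs₂.arr, phys_inj]
          by_cases ha : a' = a
          · subst ha
            by_cases hi : i = k <;> by_cases hj : j = l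
            · subst hi hj; simp [N, hl]
            · subst hi
              simp only [N, Function.update_self, hj, and_false, if_false]
              simp only [show (j < l) = (j < l + 1) from propext (by omega)]
            all_goals
              simp only [N, Function.update_self, hi, false_and, and_false, if_false]
          · simp [N, ha]
        · simpa [State.setEntry, (phys_ne a).symm] using hJ2
    · have : (3 * ρ 0 + 2) * ((3 * ρ 0 + 2) * 50 + 17 + 17) ≤
          (3 * ρ 0 + 2) * ((3 * ρ 0 + 2) * 50 + 50) := Nat.mul_le_mul le_rfl (by omega)
      omega
    · rintro s' ⟨g, -⟩
      have : N (b.val (ρ 0)) 0 = (Cmd.map a b c t).exec d ρ M := by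
        simp only [N, Cmd.exec, hF]
        congr 1
        funext i j
        congr 1
        apply propext
        constructor <;> (intro h; omega)
      exact this ▸ g

/-! ### Polynomial running time -/

/-- A function that is at most a polynomial. -/
def PolyBounded (f : ℕ → ℕ) : Prop := ∃ p : Polynomial ℕ, ∀ n, f n ≤ p.eval n

theorem PolyBounded.const (c : ℕ) : PolyBounded fun _ => c := ⟨Polynomial.C c, by simp⟩

theorem PolyBounded.add {f g : ℕ → ℕ} (hf : PolyBounded f) (hg : PolyBounded g) :
    PolyBounded fun n => f n + g n := by
  obtain ⟨p, hp⟩ := hf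
  obtain ⟨q, hq⟩ := hg
  exact ⟨p + q, fun n => by rw [Polynomial.eval_add]; exact add_le_add (hp n) (hq n)⟩

theorem PolyBounded.mul {f g : ℕ → ℕ} (hf : PolyBounded f) (hg : PolyBounded g) :
    PolyBounded fun n => f n * g n := by
  obtain ⟨p, hp⟩ := hf
  obtain ⟨q, hq⟩ := hg
  exact ⟨p * q, fun n => by rw [Polynomial.eval_mul]; exact Nat.mul_le_mul (hp n) (hq n)⟩

theorem PolyBounded.bound : PolyBounded fun n => 3 * n + 2 :=
  ⟨3 * Polynomial.X + 2, fun n => by simp⟩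

theorem Tm.cost_polyBounded (t : Tm) : PolyBounded t.cost := by
  induction t with
  | rat q => exact .const _
  | idx e => exact .const _
  | get a i j => exact .const _
  | add t u iht ihu => exact (iht.add ihu).add (.const _)
  | sub t u iht ihu => exact (iht.add ihu).add (.const _)
  | mul t u iht ihu => exact (iht.add ihu).add (.const _)
  | div t u iht ihu => exact (iht.add ihu).add (.const _)
  | ite t u v w iht ihu ihv ihw => exact (((iht.add ihu).add ihv).add ihw).add (.const _)
  | sum b t ih => exact (PolyBounded.bound.mul (ih.add (.const _))).add (.const _)

/-- Every loop has length at most `3 * n + 2`, and the nesting depth is fixed by the program text.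
-/
theorem Cmd.cost_polyBounded (p : Cmd) : PolyBounded p.cost := by
  induction p with
  | map a b c t =>
    have hb := PolyBounded.bound
    exact ((hb.mul ((hb.mul (t.cost_polyBounded.add (.const _))).add (.const _))).add
      (.const _)).add ((hb.mul ((hb.mul (.const _)).add (.const _))).add (.const _))
  | seq p q ihp ihq => exact ihp.add ihq
  | rep b p ih => exact (PolyBounded.bound.mul (ih.add (.const _))).add (.const _)

/-- The registers at the start. -/
def startIdx (n : ℕ) : ℕ → ℕ := fun v => if v = 0 then n else 0

/-- The arrays at the start. -/
noncomputable def startArr {n : ℕ} (A : Matrix (Fin n) (Fin n) ℝ) : Arr :=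
  fun a i j => if h : a = 0 ∧ i < n ∧ j < n then A ⟨i, h.2.1⟩ ⟨j, h.2.2⟩ else 0

/-- Every loop program is carried out by a polynomial-time program. -/
theorem Cmd.exists_prog (c : Cmd) : ∃ (P : Prog) (T : Polynomial ℕ),
    ∀ (n : ℕ) (A : Matrix (Fin n) (Fin n) ℝ), ∃ t s, P.Run (input A) t s ∧ t ≤ T.eval n ∧
      ∀ j : Fin n, output n s j = c.exec 0 (startIdx n) (startArr A) 1 0 j := by
  obtain ⟨T, hT⟩ := c.cost_polyBounded
  refine ⟨c.compile 0, T, fun n A => ?_⟩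
  have hs : Holds (startIdx n) (startArr A) (input A) := by
    refine ⟨rfl, fun a => ?_⟩
    funext i j
    have : phys a = 0 ↔ a = 0 := phys_inj (b := 0)
    simp only [input, startArr, this]
  obtain ⟨t, s, h1, h2, h3⟩ := c.compile_spec 0 (startIdx n) _ _
    (fun v hv => if_neg (Nat.pos_iff_ne_zero.mp hv)) hs
  refine ⟨t, s, h1, h2.trans (hT n), fun j => ?_⟩
  rw [← h3.arr]
  rfl

end RealRAM

/-! ### Gram-Schmidt orthogonalization for a weighted inner product -/

namespace PseudoKomlos
open Finset RealRAM

/-- The inner product with weights `D` of the first `n` coordinates. -/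
def ip (n : ℕ) (D u v : ℕ → ℝ) : ℝ := ∑ j ∈ range n, D j * u j * v j

theorem ip_comm (n : ℕ) (D u v : ℕ → ℝ) : ip n D u v = ip n D v u :=
  sum_congr rfl fun _ _ => by ring

theorem ip_self_nonneg {n : ℕ} {D : ℕ → ℝ} (hD : ∀ j, 0 < D j) (u : ℕ → ℝ) : 0 ≤ ip n D u u :=
  sum_nonneg fun j _ => by
    have := mul_nonneg (hD j).le (mul_self_nonneg (u j))
    nlinarith

theorem eq_zero_of_ip_self {n : ℕ} {D u : ℕ → ℝ} (hD : ∀ j, 0 < D j) (h : ip n D u u = 0)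
    {j : ℕ} (hj : j < n) : u j = 0 := by
  have h1 := (sum_eq_zero_iff_of_nonneg fun j _ => by
    have := mul_nonneg (hD j).le (mul_self_nonneg (u j))
    nlinarith).mp h j (mem_range.mpr hj)
  have := (hD j).ne'
  simpa [this] using h1

/-- In each division by `ip n D (U l) (U l)` below, a zero denominator thus comes with a zero
numerator, and `x / 0 = 0` is the right value. Linearly dependent vectors need no special treatment.
-/
theorem ip_eq_zero_of_self {n : ℕ} {D u : ℕ → ℝ} (hD : ∀ j, 0 < D j) (h : ip n D u u = 0)
    (v : ℕ → ℝ) : ip n D v u = 0 :=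
  sum_eq_zero fun j hj => by rw [eq_zero_of_ip_self hD h (mem_range.mp hj), mul_zero]

theorem ip_sub_sum (n : ℕ) (D w v : ℕ → ℝ) (s : Finset ℕ) (c : ℕ → ℝ) (U : ℕ → ℕ → ℝ) :
    ip n D (fun j => v j - ∑ l ∈ s, c l * U l j) w = ip n D v w - ∑ l ∈ s, c l * ip n D (U l) w := by
  unfold ip
  simp_rw [mul_sum]
  rw [sum_comm, ← sum_sub_distrib]
  refine sum_congr rfl fun j _ => ?_
  rw [mul_sub, sub_mul, mul_sum, sum_mul]
  congr 1
  exact sum_congr rfl fun l _ => by ring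

/-- `U` is the result of orthogonalizing the first `N` of the vectors `V`. -/
def IsOrthogonalization (n N : ℕ) (D : ℕ → ℝ) (V U : ℕ → ℕ → ℝ) : Prop :=
  ∀ k < N, ∀ j < n,
    U k j = V k j - ∑ l ∈ range k, ip n D (V k) (U l) / ip n D (U l) (U l) * U l j

section
variable {n N : ℕ} {D : ℕ → ℝ} {V U : ℕ → ℕ → ℝ}

theorem ip_congr_left {u u' : ℕ → ℝ} (h : ∀ j < n, u j = u' j) (v : ℕ → ℝ) :
    ip n D u v = ip n D u' v :=
  sum_congr rfl fun j hj => by rw [h j (mem_range.mp hj)]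

theorem IsOrthogonalization.ip_left (h : IsOrthogonalization n N D V U) {k : ℕ} (hk : k < N)
    (w : ℕ → ℝ) : ip n D (U k) w = ip n D (V k) w -
      ∑ l ∈ range k, ip n D (V k) (U l) / ip n D (U l) (U l) * ip n D (U l) w := by
  rw [ip_congr_left (h k hk), ip_sub_sum]

theorem IsOrthogonalization.orthogonal (h : IsOrthogonalization n N D V U) (hD : ∀ j, 0 < D j) :
    ∀ k < N, ∀ l < k, ip n D (U k) (U l) = 0 := by
  intro k
  induction k using Nat.strong_induction_on with
  | _ k ih =>
    intro hk l hl
    rw [h.ip_left hk, sum_eq_single l]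
    · by_cases h0 : ip n D (U l) (U l) = 0
      · rw [ip_eq_zero_of_self hD h0, h0]; simp
      · rw [div_mul_cancel₀ _ h0, sub_self]
    · intro l' hl' hne
      have hl'k := mem_range.mp hl'
      rcases lt_or_gt_of_ne hne with h1 | h1
      · rw [ip_comm n D (U l') (U l), ih l hl (hl.trans hk) l' h1, mul_zero]
      · rw [ih l' hl'k (hl'k.trans hk) l h1, mul_zero]
    · exact fun h => absurd (mem_range.mpr hl) h

theorem IsOrthogonalization.orthogonal' (h : IsOrthogonalization n N D V U)
    (hD : ∀ j, 0 < D j) {k l : ℕ} (hk : k < N) (hl : l < N) (hne : k ≠ l) :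
    ip n D (U k) (U l) = 0 := by
  rcases lt_or_gt_of_ne hne with h1 | h1
  · rw [ip_comm]; exact h.orthogonal hD l hl k h1
  · exact h.orthogonal hD k hk l h1

theorem IsOrthogonalization.ip_V (h : IsOrthogonalization n N D V U) {k : ℕ} (hk : k < N)
    (w : ℕ → ℝ) : ip n D (V k) w = ip n D (U k) w +
      ∑ l ∈ range k, ip n D (V k) (U l) / ip n D (U l) (U l) * ip n D (U l) w := by
  rw [h.ip_left hk]; ring

theorem IsOrthogonalization.ip_V_self (h : IsOrthogonalization n N D V U) (hD : ∀ j, 0 < D j)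
    {k : ℕ} (hk : k < N) : ip n D (V k) (U k) = ip n D (U k) (U k) := by
  rw [h.ip_V hk, add_eq_left]
  refine sum_eq_zero fun l hl => ?_
  rw [ip_comm n D (U l) (U k), h.orthogonal hD k hk l (mem_range.mp hl), mul_zero]

theorem IsOrthogonalization.ip_V_eq_zero (h : IsOrthogonalization n N D V U)
    (hD : ∀ j, 0 < D j) {k l : ℕ} (hk : k < N) (hl : l < k) : ip n D (V l) (U k) = 0 := by
  rw [h.ip_V (hl.trans hk), ip_comm, h.orthogonal hD k hk l hl, zero_add]
  refine sum_eq_zero fun l' hl' => ?_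
  rw [ip_comm n D (U l') (U k), h.orthogonal hD k hk l' ((mem_range.mp hl').trans hl), mul_zero]

/-- `V k` is a combination of `U 0, ..., U k`, so Bessel's inequality is an equality for it. -/
theorem IsOrthogonalization.parseval (h : IsOrthogonalization n N D V U) (hD : ∀ j, 0 < D j)
    {k : ℕ} (hk : k < N) : ip n D (V k) (V k) =
      ∑ l ∈ range N, ip n D (V k) (U l) ^ 2 / ip n D (U l) (U l) := by
  have hsub : range (k + 1) ⊆ range N := range_subset_range.mpr hk
  rw [← sum_subset hsub, sum_range_succ, h.ip_V hk, ip_comm n D (U k) (V k), add_comm]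
  · congr 1
    · refine sum_congr rfl fun l _ => ?_
      rw [ip_comm n D (U l) (V k)]; ring
    · rw [h.ip_V_self hD hk]
      by_cases h0 : ip n D (U k) (U k) = 0
      · rw [h0]; simp
      · field_simp
  · intro l hl hl'
    rw [h.ip_V_eq_zero hD (mem_range.mp hl) (by simpa using hl')]; simp

/-- The difference of the two sides is the squared length of the residual `p`. -/
theorem IsOrthogonalization.bessel (h : IsOrthogonalization n N D V U) (hD : ∀ j, 0 < D j)
    (v : ℕ → ℝ) : ∑ l ∈ range N, ip n D v (U l) ^ 2 / ip n D (U l) (U l) ≤ ip n D v v := by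
  set c : ℕ → ℝ := fun l => ip n D v (U l) / ip n D (U l) (U l) with hc
  set p : ℕ → ℝ := fun j => v j - ∑ l ∈ range N, c l * U l j with hp
  have hpU : ∀ l < N, ip n D p (U l) = 0 := by
    intro l hl
    rw [hp, ip_sub_sum, sum_eq_single l]
    · by_cases h0 : ip n D (U l) (U l) = 0
      · rw [ip_eq_zero_of_self hD h0, h0]; simp
      · rw [hc]; simp only; rw [div_mul_cancel₀ _ h0, sub_self]
    · intro l' hl' hne
      rw [h.orthogonal' hD (mem_range.mp hl') hl hne, mul_zero]
    · exact fun h => absurd (mem_range.mpr hl) h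
  have h1 : ip n D p p = ip n D p v := by
    conv_lhs => rw [ip_comm]
    nth_rw 1 [hp]
    rw [ip_sub_sum, sum_eq_zero, sub_zero, ip_comm]
    intro l hl
    rw [ip_comm, hpU l (mem_range.mp hl), mul_zero]
  have h2 : ip n D p v = ip n D v v -
      ∑ l ∈ range N, ip n D v (U l) ^ 2 / ip n D (U l) (U l) := by
    rw [hp, ip_sub_sum]
    congr 1
    refine sum_congr rfl fun l _ => ?_
    rw [hc, ip_comm n D (U l) v]; ring
  have h3 := ip_self_nonneg (n := n) hD p
  linarith

theorem IsOrthogonalization.ip_self_eq_zero (h : IsOrthogonalization n N D V U) {k : ℕ}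
    (hk : k < N) (hV : ∀ j < n, V k j = 0) : ip n D (U k) (U k) = 0 := by
  have h0 : ∀ w, ip n D (V k) w = 0 := fun w =>
    sum_eq_zero fun j hj => by rw [hV j (mem_range.mp hj)]; ring
  rw [h.ip_left hk]
  simp [h0]

/-- If the unit vectors of `S` come last among the orthogonalized vectors, and at most `q`
of the others are nonzero, then a quadratic form whose diagonal is at most `3 D` is at most `4 D` at
one of the resulting vectors that are orthogonal to all the first `K` vectors. -/
theorem IsOrthogonalization.exists_small {K : ℕ} (h : IsOrthogonalization n (K + n) D V U)
    (hD : ∀ j, 0 < D j) (S : Finset ℕ) (hS : S ⊆ range n)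
    (hVS : ∀ k < K + n, ∀ j < n, j ∉ S → V k j = 0)
    (hVe : ∀ i ∈ S, ∀ j < n, V (K + i) j = if j = i then 1 else 0) (Z : Finset ℕ)
    (hZ : ∀ k < K, k ∉ Z → ∀ j < n, V k j = 0) (hq : 4 * Z.card < S.card)
    (s t : ℕ → ℝ) (a b : ℕ → ℕ → ℝ) (hs : ∀ i, 0 ≤ s i) (ht : ∀ i, 0 ≤ t i)
    (hab : ∀ j ∈ S, ∑ i ∈ range n, (s i * a i j ^ 2 + t i * b i j ^ 2) ≤ 3 * D j) :
    ∃ k, K ≤ k ∧ k < K + n ∧ 0 < ip n D (U k) (U k) ∧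
      ∑ i ∈ range n, (s i * (∑ j ∈ range n, a i j * U k j) ^ 2 +
        t i * (∑ j ∈ range n, b i j * U k j) ^ 2) ≤ 4 * ip n D (U k) (U k) := by
  classical
  set W : ℕ → ℝ := fun k => ip n D (U k) (U k) with hW
  set Q : ℕ → ℝ := fun k => ∑ i ∈ range n, (s i * (∑ j ∈ range n, a i j * U k j) ^ 2 +
        t i * (∑ j ∈ range n, b i j * U k j) ^ 2) with hQ
  by_contra hcon
  push Not at hcon
  have hUS : ∀ k < K + n, ∀ j < n, j ∉ S → U k j = 0 := by
    intro k
    induction k using Nat.strong_induction_on with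
    | _ k ih =>
      intro hk j hj hjS
      rw [h k hk j hj, hVS k hk j hj hjS, sum_eq_zero, sub_zero]
      intro l hl
      rw [ih l (mem_range.mp hl) ((mem_range.mp hl).trans hk) j hj hjS, mul_zero]
  have hW0 : ∀ k, 0 ≤ W k := fun k => ip_self_nonneg hD _
  have hUW : ∀ k, W k = 0 → ∀ v, ip n D v (U k) = 0 := fun k hk v => ip_eq_zero_of_self hD hk v
  -- the number of nonzero vectors
  have hone : ∀ i ∈ S, (1 : ℝ) = ∑ l ∈ range (K + n), D i * U l i ^ 2 / W l := by
    intro i hi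
    have hin := mem_range.mp (hS hi)
    have hip : ∀ w : ℕ → ℝ, ip n D (V (K + i)) w = D i * w i := by
      intro w
      unfold ip
      rw [sum_eq_single i]
      · rw [hVe i hi i hin]; simp
      · intro j hj hji
        rw [hVe i hi j (mem_range.mp hj)]; simp [hji]
      · exact fun h => absurd (hS hi) h
    -- The unit vector at `i` has squared length `D i`, and its inner product with `U l` is `D i * U
    -- l i`.
    have hp := h.parseval hD (k := K + i) (by omega)
    simp only [hip] at hp
    rw [hVe i hi i hin, if_pos rfl, mul_one] at hp
    have hDi := (hD i).ne'
    calc (1 : ℝ) = D i / D i := (div_self hDi).symm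
      _ = _ := by
        nth_rw 1 [hp]
        rw [sum_div]
        refine sum_congr rfl fun l _ => ?_
        rw [hW]; field_simp
  have hSip : ∀ l < K + n, ∑ i ∈ S, D i * U l i ^ 2 = W l := by
    intro l hl
    rw [sum_subset hS fun j hj hjS => by rw [hUS l hl j (mem_range.mp hj) hjS]; ring]
    exact sum_congr rfl fun _ _ => by ring
  -- `W l / W l` is `0` or `1`, so the right side counts the nonzero `U l`, which form an orthogonal
  -- basis of the vectors supported on `S`.
  have hcount : (S.card : ℝ) = ∑ l ∈ range (K + n), W l / W l := by
    rw [card_eq_sum_ones, Nat.cast_sum, Nat.cast_one, sum_congr rfl hone, sum_comm]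
    refine sum_congr rfl fun l hl => ?_
    rw [← sum_div, hSip l (mem_range.mp hl)]
  have hfirst : ∑ l ∈ range K, W l / W l ≤ Z.card := by
    calc ∑ l ∈ range K, W l / W l ≤ ∑ l ∈ range K, if l ∈ Z then (1 : ℝ) else 0 := by
          refine sum_le_sum fun l hl => ?_
          have hlK := mem_range.mp hl
          split_ifs with hlZ
          · exact div_self_le_one _
          · have : W l = 0 := h.ip_self_eq_zero (by omega) (hZ l hlK hlZ)
            rw [this]; simp
      _ = ((range K).filter (· ∈ Z)).card := by rw [sum_boole]
      _ ≤ Z.card := by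
          exact_mod_cast card_le_card fun l hl => (mem_filter.mp hl).2
  -- the trace of the quadratic form
  have hbes : ∀ (c : ℕ → ℝ), ∑ l ∈ range (K + n), (∑ j ∈ range n, c j * U l j) ^ 2 / W l ≤
      ∑ j ∈ S, c j ^ 2 / D j := by
    intro c
    -- Bessel is applied to `c / D` on `S`, whose weighted inner product with `U l` is the plain one
    -- of `c` and `U l`.
    set v : ℕ → ℝ := fun j => if j ∈ S then c j / D j else 0 with hv
    have h1 : ∀ l ∈ range (K + n), ip n D v (U l) = ∑ j ∈ range n, c j * U l j := by
      intro l hl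
      refine sum_congr rfl fun j hj => ?_
      by_cases hjS : j ∈ S
      · have := (hD j).ne'
        simp only [hv, hjS, if_true]; field_simp
      · simp [hv, hjS, hUS l (mem_range.mp hl) j (mem_range.mp hj) hjS]
    have h2 : ip n D v v = ∑ j ∈ S, c j ^ 2 / D j := by
      unfold ip
      rw [← sum_subset hS (f := fun j => D j * v j * v j)
        (fun j _ hjS => by simp [hv, hjS])]
      refine sum_congr rfl fun j hj => ?_
      have := (hD j).ne'
      simp only [hv, hj, if_true]; field_simp
    have h3 := h.bessel hD v
    rw [h2] at h3
    refine le_trans (le_of_eq ?_) h3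
    exact sum_congr rfl fun l hl => by rw [h1 l hl]
  have htr : ∑ l ∈ range (K + n), Q l / W l ≤ 3 * S.card := by
    calc ∑ l ∈ range (K + n), Q l / W l
        = ∑ i ∈ range n, (s i * ∑ l ∈ range (K + n), (∑ j ∈ range n, a i j * U l j) ^ 2 / W l +
          t i * ∑ l ∈ range (K + n), (∑ j ∈ range n, b i j * U l j) ^ 2 / W l) := by
          simp only [hQ, sum_div]
          rw [sum_comm]
          refine sum_congr rfl fun i _ => ?_
          rw [mul_sum, mul_sum, ← sum_add_distrib]
          exact sum_congr rfl fun l _ => by ring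
      _ ≤ ∑ i ∈ range n, (s i * ∑ j ∈ S, a i j ^ 2 / D j + t i * ∑ j ∈ S, b i j ^ 2 / D j) := by
          refine sum_le_sum fun i _ => add_le_add ?_ ?_
          · exact mul_le_mul_of_nonneg_left (hbes _) (hs i)
          · exact mul_le_mul_of_nonneg_left (hbes _) (ht i)
      _ = ∑ j ∈ S, (∑ i ∈ range n, (s i * a i j ^ 2 + t i * b i j ^ 2)) / D j := by
          simp only [sum_div]
          rw [sum_comm]
          refine sum_congr rfl fun i _ => ?_
          rw [mul_sum, mul_sum, ← sum_add_distrib]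
          exact sum_congr rfl fun l _ => by ring
      _ ≤ ∑ j ∈ S, 3 := by
          refine sum_le_sum fun j hj => ?_
          rw [div_le_iff₀ (hD j)]
          exact hab j hj
      _ = 3 * S.card := by simp [mul_comm]
  have hQ0 : ∀ k, 0 ≤ Q k := fun k => sum_nonneg fun i _ =>
    add_nonneg (mul_nonneg (hs i) (sq_nonneg _)) (mul_nonneg (ht i) (sq_nonneg _))
  -- More than three quarters of the `S.card` nonzero vectors have index at least `K`. If all of
  -- these had ratio above `4`, the trace would exceed `3 * S.card`.
  have hlast : ∑ l ∈ range (K + n), Q l / W l ≥ ∑ l ∈ range n, 4 * (W (K + l) / W (K + l)) := by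
    rw [sum_range_add]
    have : 0 ≤ ∑ l ∈ range K, Q l / W l := sum_nonneg fun l _ => div_nonneg (hQ0 l) (hW0 l)
    refine le_trans (sum_le_sum fun l hl => ?_) (le_add_of_nonneg_left this)
    rcases (hW0 (K + l)).eq_or_lt with h0 | h0
    · rw [← h0]; simp
    · rw [← mul_div_assoc]
      have := hcon (K + l) (by omega) (by have := mem_range.mp hl; omega) h0
      gcongr
  rw [← mul_sum] at hlast
  rw [sum_range_add] at hcount
  have hq' : (4 : ℝ) * Z.card < S.card := by exact_mod_cast hq
  linarith
end

/-! ### The change of the weights in one step -/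

/-- The reason for updating weights by `1 + z + z ^ 2`: it dominates the exponential and needs only
field operations. -/
theorem exp_le_one_add_add_sq {z : ℝ} (hz : |z| ≤ 1) : Real.exp z ≤ 1 + z + z ^ 2 := by
  have := (abs_le.mp (Real.abs_exp_sub_one_sub_id_le hz)).2
  linarith

section
variable {n : ℕ} {h σ : ℝ} {a x w : ℕ → ℝ}

theorem abs_sum_mul_le {c : ℕ → ℝ} {B : ℝ} (hB : ∀ j < n, |c j| ≤ B)
    (hB0 : 0 ≤ B) (hw : ∑ j ∈ range n, |w j| ≤ 1) : |∑ j ∈ range n, c j * w j| ≤ B := by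
  calc |∑ j ∈ range n, c j * w j| ≤ ∑ j ∈ range n, |c j * w j| := abs_sum_le_sum_abs _ _
    _ ≤ ∑ j ∈ range n, B * |w j| := sum_le_sum fun j hj => by
        rw [abs_mul]; exact mul_le_mul_of_nonneg_right (hB j (mem_range.mp hj)) (abs_nonneg _)
    _ = B * ∑ j ∈ range n, |w j| := by rw [mul_sum]
    _ ≤ B := by nlinarith

theorem abs_le_one_of_sum {j : ℕ} (hj : j < n) (hw : ∑ j ∈ range n, |w j| ≤ 1) : |w j| ≤ 1 :=
  (single_le_sum (f := fun j => |w j|) (fun _ _ => abs_nonneg _) (mem_range.mpr hj)).trans hw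

/-- The coefficients of `w` are at most `1 / 32` and `1 / 1024`, and `w` has ℓ¹-norm at most `1`.
Truncation of the entries serves to guarantee `ha`. -/
theorem scaled_sums_le (ha : ∀ j < n, h ^ 2 * a j ^ 2 ≤ 1 / 1024)
    (hx : ∀ j < n, |x j| ≤ 1) (hw : ∑ j ∈ range n, |w j| ≤ 1) :
    |h * ∑ j ∈ range n, a j * w j| ≤ 1 / 32 ∧
    |h ^ 2 * ∑ j ∈ range n, a j ^ 2 * x j * w j| ≤ 1 / 1024 ∧
    0 ≤ h ^ 2 * ∑ j ∈ range n, a j ^ 2 * w j ^ 2 ∧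
    h ^ 2 * ∑ j ∈ range n, a j ^ 2 * w j ^ 2 ≤ 1 / 1024 := by
  refine ⟨?_, ?_, ?_, ?_⟩
  · rw [mul_sum]
    simp_rw [← mul_assoc]
    refine abs_sum_mul_le (fun j hj => ?_) (by norm_num) hw
    refine abs_le_of_sq_le_sq ?_ (by norm_num)
    rw [mul_pow]; linarith [ha j hj]
  · rw [mul_sum]
    simp_rw [← mul_assoc]
    refine abs_sum_mul_le (fun j hj => ?_) (by norm_num) hw
    rw [abs_mul, abs_of_nonneg (by positivity)]
    have := ha j hj
    have := hx j hj
    have h0 : 0 ≤ h ^ 2 * a j ^ 2 := by positivity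
    nlinarith [abs_nonneg (x j)]
  · exact mul_nonneg (sq_nonneg _) (sum_nonneg fun j _ => by positivity)
  · rw [mul_sum]
    refine le_trans (le_abs_self _) ?_
    have := abs_sum_mul_le (n := n) (w := w) (c := fun j => h ^ 2 * a j ^ 2 * w j)
      (B := 1 / 1024) (fun j hj => ?_) (by norm_num) hw
    · rwa [sum_congr rfl fun j _ => show h ^ 2 * (a j ^ 2 * w j ^ 2) =
        h ^ 2 * a j ^ 2 * w j * w j by ring]
    · rw [abs_mul, abs_of_nonneg (by positivity)]
      have := ha j hj
      have := abs_le_one_of_sum hj hw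
      have h0 : 0 ≤ h ^ 2 * a j ^ 2 := by positivity
      nlinarith [abs_nonneg (w j)]

/-- The logarithmic increment of a weight, to first order; `h` may have either sign. -/
def incr (n : ℕ) (h σ : ℝ) (a x w : ℕ → ℝ) : ℝ :=
  h * σ * (∑ j ∈ range n, a j * w j) + 8 * h ^ 2 * σ *
    (-2 * (∑ j ∈ range n, a j ^ 2 * x j * w j) - σ * ∑ j ∈ range n, a j ^ 2 * w j ^ 2)

theorem abs_incr_le (hσ : 0 ≤ σ) (hσ1 : σ ≤ 1) (ha : ∀ j < n, h ^ 2 * a j ^ 2 ≤ 1 / 1024)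
    (hx : ∀ j < n, |x j| ≤ 1) (hw : ∑ j ∈ range n, |w j| ≤ 1) :
    |incr n h σ a x w| ≤ 1 / 2 := by
  obtain ⟨h1, h2, h3, h4⟩ := scaled_sums_le ha hx hw
  have e : incr n h σ a x w = σ * (h * (∑ j ∈ range n, a j * w j) -
      16 * (h ^ 2 * ∑ j ∈ range n, a j ^ 2 * x j * w j) -
      8 * (σ * (h ^ 2 * ∑ j ∈ range n, a j ^ 2 * w j ^ 2))) := by
    unfold incr; ring
  generalize h * (∑ j ∈ range n, a j * w j) = p at *
  generalize h ^ 2 * (∑ j ∈ range n, a j ^ 2 * x j * w j) = q at *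
  generalize h ^ 2 * (∑ j ∈ range n, a j ^ 2 * w j ^ 2) = r at *
  rw [e, abs_mul, abs_of_nonneg hσ]
  have h5 : 0 ≤ σ * r := by positivity
  have h6 : σ * r ≤ r := by nlinarith
  have h7 : |p - 16 * q - 8 * (σ * r)| ≤ 1 / 2 := by
    rw [abs_le] at *
    constructor <;> linarith
  calc σ * |p - 16 * q - 8 * (σ * r)| ≤ 1 * (1 / 2) := by gcongr
    _ = 1 / 2 := by norm_num

/-- An exact difference along the step: drift minus `8 * h ^ 2` times the gain in energy. Hence
increments telescope. -/
theorem incr_eq_sub : incr n h σ a x w = h * ∑ j ∈ range n, a j * (x j + σ * w j - x j) +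
    8 * h ^ 2 * (∑ j ∈ range n, a j ^ 2 * x j ^ 2 -
      ∑ j ∈ range n, a j ^ 2 * (x j + σ * w j) ^ 2) := by
  unfold incr
  rw [← sum_sub_distrib]
  have e1 : ∑ j ∈ range n, a j * (x j + σ * w j - x j) = σ * ∑ j ∈ range n, a j * w j := by
    rw [mul_sum]; exact sum_congr rfl fun _ _ => by ring
  have e2 : ∑ j ∈ range n, (a j ^ 2 * x j ^ 2 - a j ^ 2 * (x j + σ * w j) ^ 2) =
      σ * (-2 * (∑ j ∈ range n, a j ^ 2 * x j * w j) -
        σ * ∑ j ∈ range n, a j ^ 2 * w j ^ 2) := by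
    simp only [mul_sum, ← sum_sub_distrib]
    exact sum_congr rfl fun _ _ => by ring
  rw [e1, e2]; ring

/-- Under the two linear constraints only the negative energy term of `z` remains, and `z + z ^ 2 ≤
0` for `-1 ≤ z ≤ 0`. -/
theorem incr_factor_le_one (hσ : 0 ≤ σ) (hσ1 : σ ≤ 1)
    (ha : ∀ j < n, h ^ 2 * a j ^ 2 ≤ 1 / 1024)
    (hx : ∀ j < n, |x j| ≤ 1) (hw : ∑ j ∈ range n, |w j| ≤ 1)
    (h1 : ∑ j ∈ range n, a j * w j = 0) (h2 : ∑ j ∈ range n, a j ^ 2 * x j * w j = 0) :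
    1 + incr n h σ a x w + incr n h σ a x w ^ 2 ≤ 1 := by
  have hz := abs_incr_le hσ hσ1 ha hx hw
  obtain ⟨-, -, h3, -⟩ := scaled_sums_le ha hx hw
  have hle : incr n h σ a x w ≤ 0 := by
    have : incr n h σ a x w = -(8 * σ ^ 2 * (h ^ 2 * ∑ j ∈ range n, a j ^ 2 * w j ^ 2)) := by
      unfold incr; rw [h1, h2]; ring
    rw [this]
    have : 0 ≤ 8 * σ ^ 2 * (h ^ 2 * ∑ j ∈ range n, a j ^ 2 * w j ^ 2) := by positivity
    linarith
  have := (abs_le.mp hz).1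
  nlinarith

theorem incr_neg : incr n (-h) σ a x w = -(h * σ * (∑ j ∈ range n, a j * w j)) +
    8 * h ^ 2 * σ * (-2 * (∑ j ∈ range n, a j ^ 2 * x j * w j) -
      σ * ∑ j ∈ range n, a j ^ 2 * w j ^ 2) := by
  unfold incr; ring

/-- Twice `(s + t) ^ 2 ≤ 2 * s ^ 2 + 2 * t ^ 2`. The square of `h ^ 2 * ∑ a ^ 2 w ^ 2` is absorbed
by its first power, which is at most `1 / 1024`. -/
theorem incr_sq_le (hσ : 0 ≤ σ) (hσ1 : σ ≤ 1) (ha : ∀ j < n, h ^ 2 * a j ^ 2 ≤ 1 / 1024)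
    (hx : ∀ j < n, |x j| ≤ 1) (hw : ∑ j ∈ range n, |w j| ≤ 1) :
    incr n h σ a x w ^ 2 ≤ σ ^ 2 * (2 * h ^ 2 * (∑ j ∈ range n, a j * w j) ^ 2 +
      1024 * h ^ 4 * (∑ j ∈ range n, a j ^ 2 * x j * w j) ^ 2 +
      h ^ 2 * ∑ j ∈ range n, a j ^ 2 * w j ^ 2) := by
  obtain ⟨h1, h2, h3, h4⟩ := scaled_sums_le ha hx hw
  unfold incr
  generalize (∑ j ∈ range n, a j * w j) = p at *
  generalize (∑ j ∈ range n, a j ^ 2 * x j * w j) = q at *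
  generalize (∑ j ∈ range n, a j ^ 2 * w j ^ 2) = r at *
  have e : (h * σ * p + 8 * h ^ 2 * σ * (-2 * q - σ * r)) ^ 2 =
      σ ^ 2 * (h * p + 8 * h ^ 2 * (-2 * q - σ * r)) ^ 2 := by ring
  rw [e]
  refine mul_le_mul_of_nonneg_left ?_ (sq_nonneg _)
  have hR : 0 ≤ h ^ 2 * r := h3
  have hr2 : 256 * σ ^ 2 * (h ^ 2 * r) ^ 2 ≤ h ^ 2 * r := by
    have : σ ^ 2 ≤ 1 := by nlinarith
    have h5 : (h ^ 2 * r) ^ 2 ≤ (h ^ 2 * r) * (1 / 1024) := by nlinarith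
    have : σ ^ 2 * (h ^ 2 * r) ^ 2 ≤ 1 * ((h ^ 2 * r) * (1 / 1024)) := by gcongr
    linarith
  have s1 := sq_nonneg (h * p - 8 * h ^ 2 * (-2 * q - σ * r))
  have s2 := sq_nonneg (h ^ 2 * (2 * q - σ * r))
  nlinarith

end

/-- The total weight grows by at most four times the squared step length if the direction `w` is
stationary to first order and satisfies the quadratic inequality. -/
theorem weight_step {n : ℕ} {σ : ℝ} {h P M x w : ℕ → ℝ} {a : ℕ → ℕ → ℝ}
    (hσ : 0 ≤ σ) (hσ1 : σ ≤ 1) (ha : ∀ i < n, ∀ j < n, h i ^ 2 * a i j ^ 2 ≤ 1 / 1024)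
    (hx : ∀ j < n, |x j| ≤ 1) (hw : ∑ j ∈ range n, |w j| ≤ 1)
    (hP : ∀ i < n, 0 ≤ P i) (hM : ∀ i < n, 0 ≤ M i)
    (hlin : ∑ i ∈ range n, ((P i - M i) * h i * (∑ j ∈ range n, a i j * w j) -
      16 * h i ^ 2 * (P i + M i) * ∑ j ∈ range n, a i j ^ 2 * x j * w j) = 0)
    (hquad : ∑ i ∈ range n, ((P i + M i) * (2 * h i ^ 2) * (∑ j ∈ range n, a i j * w j) ^ 2 +
      (P i + M i) * (1024 * h i ^ 4) * (∑ j ∈ range n, a i j ^ 2 * x j * w j) ^ 2) ≤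
      4 * ∑ j ∈ range n, (1 + ∑ i ∈ range n, (P i + M i) * h i ^ 2 * a i j ^ 2) * w j * w j) :
    ∑ i ∈ range n, (P i * (1 + incr n (h i) σ (a i) x w + incr n (h i) σ (a i) x w ^ 2) +
      M i * (1 + incr n (-h i) σ (a i) x w + incr n (-h i) σ (a i) x w ^ 2)) ≤
      ∑ i ∈ range n, (P i + M i) + 4 * (σ ^ 2 * ∑ j ∈ range n, w j ^ 2) := by
  set p : ℕ → ℝ := fun i => ∑ j ∈ range n, a i j * w j with hp
  set q : ℕ → ℝ := fun i => ∑ j ∈ range n, a i j ^ 2 * x j * w j with hq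
  set r : ℕ → ℝ := fun i => ∑ j ∈ range n, a i j ^ 2 * w j ^ 2 with hr
  have e1 : ∑ j ∈ range n, (1 + ∑ i ∈ range n, (P i + M i) * h i ^ 2 * a i j ^ 2) * w j * w j =
      ∑ j ∈ range n, w j ^ 2 + ∑ i ∈ range n, (P i + M i) * (h i ^ 2 * r i) := by
    simp only [hr, mul_sum]
    rw [sum_comm (s := range n) (t := range n) (f := fun i j => (P i + M i) *
      (h i ^ 2 * (a i j ^ 2 * w j ^ 2))), ← sum_add_distrib]
    refine sum_congr rfl fun j _ => ?_
    rw [add_mul, add_mul, one_mul, sum_mul, sum_mul]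
    congr 1
    · ring
    · exact sum_congr rfl fun _ _ => by ring
  rw [e1] at hquad
  -- The drift enters `P` and `M` with opposite signs, the energy term with the same sign. The
  -- latter contributes `-8` and the square at most `+1`, which leaves `-7`.
  have hrow : ∀ i ∈ range n,
      P i * (1 + incr n (h i) σ (a i) x w + incr n (h i) σ (a i) x w ^ 2) +
        M i * (1 + incr n (-h i) σ (a i) x w + incr n (-h i) σ (a i) x w ^ 2) ≤
      (P i + M i) + σ * ((P i - M i) * h i * p i - 16 * h i ^ 2 * (P i + M i) * q i) +
        σ ^ 2 * ((P i + M i) * (2 * h i ^ 2) * p i ^ 2 +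
          (P i + M i) * (1024 * h i ^ 4) * q i ^ 2) -
        7 * (σ ^ 2 * ((P i + M i) * (h i ^ 2 * r i))) := by
    intro i hi
    have hi' := mem_range.mp hi
    have z1 := incr_sq_le (h := h i) hσ hσ1 (ha i hi') hx hw
    have z2 := incr_sq_le (h := -h i) (n := n) hσ hσ1 (a := a i)
      (fun j hj => by rw [neg_sq]; exact ha i hi' j hj) hx hw
    have e2 : incr n (h i) σ (a i) x w =
      h i * σ * p i + 8 * h i ^ 2 * σ * (-2 * q i - σ * r i) := rfl
    have e3 : incr n (-h i) σ (a i) x w =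
      -(h i * σ * p i) + 8 * h i ^ 2 * σ * (-2 * q i - σ * r i) := incr_neg
    rw [neg_sq, Even.neg_pow (by decide)] at z2
    change _ ≤ σ ^ 2 * (2 * h i ^ 2 * p i ^ 2 + 1024 * h i ^ 4 * q i ^ 2 + h i ^ 2 * r i) at z1 z2
    have y1 := mul_le_mul_of_nonneg_left z1 (hP i hi')
    have y2 := mul_le_mul_of_nonneg_left z2 (hM i hi')
    generalize hz1 : incr n (h i) σ (a i) x w = u at *
    generalize hz2 : incr n (-h i) σ (a i) x w = v at *
    have t1 : P i * (1 + u + u ^ 2) = P i + P i * u + P i * u ^ 2 := by ring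
    have t2 : M i * (1 + v + v ^ 2) = M i + M i * v + M i * v ^ 2 := by ring
    rw [t1, t2]
    have t3 : P i * u + M i * v =
      σ * ((P i - M i) * h i * p i - 16 * h i ^ 2 * (P i + M i) * q i) -
      8 * (σ ^ 2 * ((P i + M i) * (h i ^ 2 * r i))) := by rw [e2, e3]; ring
    nlinarith
  refine (sum_le_sum hrow).trans ?_
  rw [sum_sub_distrib, sum_add_distrib, sum_add_distrib, ← mul_sum, ← mul_sum, ← mul_sum,
    ← mul_sum, hlin]
  have hσ2 : 0 ≤ σ ^ 2 := sq_nonneg _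
  have hR : 0 ≤ ∑ i ∈ range n, (P i + M i) * (h i ^ 2 * r i) := by
    refine sum_nonneg fun i hi => mul_nonneg ?_ ?_
    · have := hP i (mem_range.mp hi); have := hM i (mem_range.mp hi); linarith
    · exact mul_nonneg (sq_nonneg _) (sum_nonneg fun j _ => by positivity)
  -- The energy part of the metric enters with the factor `4` and is outweighed by the `-7`.
  have h1 := mul_le_mul_of_nonneg_left hquad hσ2
  have h2 : 0 ≤ σ ^ 2 * ∑ i ∈ range n, (P i + M i) * (h i ^ 2 * r i) := by positivity
  linarith

/-! ### The quantities computed in an iteration -/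

/-- The indicator of the coordinates that are not yet close to a sign. -/
noncomputable def aliveR (n : ℕ) (x : ℕ → ℝ) (j : ℕ) : ℝ :=
  if x j * x j < (1 - 1 / n) * (1 - 1 / n) then 1 else 0

noncomputable def aliveN (n : ℕ) (x : ℕ → ℝ) : ℝ := ∑ j ∈ range n, aliveR n x j

noncomputable def aliveSet (n : ℕ) (x : ℕ → ℝ) : Finset ℕ := (range n).filter fun j => aliveR n x j = 1

def rowSq (n : ℕ) (A : ℕ → ℕ → ℝ) (i : ℕ) : ℝ := ∑ j ∈ range n, A i j * A i j

noncomputable def aliveSq (n : ℕ) (A : ℕ → ℕ → ℝ) (x : ℕ → ℝ) (i : ℕ) : ℝ :=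
  ∑ j ∈ range n, aliveR n x j * (A i j * A i j)

/-- The energy that row `i` has if it is spread evenly over all columns and `m` are left. -/
noncomputable def base (n : ℕ) (A : ℕ → ℕ → ℝ) (m : ℝ) (i : ℕ) : ℝ := m / n * rowSq n A i

/-- The number of rows whose energy is in excess of the expected one by more than `θ`. -/
noncomputable def badN (n : ℕ) (A : ℕ → ℕ → ℝ) (x : ℕ → ℝ) (m θ : ℝ) : ℝ :=
  ∑ i ∈ range n, if base n A m i + θ < aliveSq n A x i then 1 else 0

/-- The harmonic number, in the role of a logarithm. -/
noncomputable def harm (n : ℕ) : ℝ := ∑ k ∈ range n, 1 / ((k : ℝ) + 1)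

/-- An approximate square root. -/
noncomputable def rootN (n : ℕ) (p : ℝ) : ℝ :=
  ∑ k ∈ range (3 * n + 2), if p < (k : ℝ) * k then 0 else 1

/-- The value `v` for rows that are to be watched, and `0` for the others. -/
noncomputable def whenAct (n : ℕ) (A : ℕ → ℕ → ℝ) (x : ℕ → ℝ) (m θ : ℝ) (i : ℕ) (v : ℝ) : ℝ :=
  if base n A m i + θ < aliveSq n A x i then 0 else if 100 < base n A m i then 0 else v

/-- Up to a factor of `2`, this is `1 / √base` for a row with base energy above `θ`, and `√(harm n /
θ)` for a row about to be locked. Extending the fraction by `harm n` makes the radicand at least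
`1`, where an integer square root is accurate to a factor of `2`. -/
noncomputable def newScale (n : ℕ) (A : ℕ → ℕ → ℝ) (m θ : ℝ) (i : ℕ) : ℝ :=
  harm n / rootN n (if θ < base n A m i then harm n * harm n * base n A m i else harm n * θ)

/-- The small entries of `A`, relative to the scales `h`. -/
noncomputable def trunc (A : ℕ → ℕ → ℝ) (h : ℕ → ℝ) (i j : ℕ) : ℝ :=
  if 1 / 1024 < h i * h i * (A i j * A i j) then 0 else A i j

/-- The indicator of the rows that must not move. -/
noncomputable def prot (h P M : ℕ → ℝ) (i : ℕ) : ℝ :=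
  if 0 < h i then (if 900 < P i + M i then 1 else 0) else 1

/-- Measured in this norm, the diagonal of the quadratic form is at most `3`, however uneven the
weights are. -/
def metric (n : ℕ) (a : ℕ → ℕ → ℝ) (h P M : ℕ → ℝ) (j : ℕ) : ℝ :=
  1 + ∑ i ∈ range n, (P i + M i) * (h i * h i) * (a i j * a i j)

/-- The gradient of the first-order change of the total weight. -/
def slope (n : ℕ) (a : ℕ → ℕ → ℝ) (x h P M : ℕ → ℝ) (j : ℕ) : ℝ :=
  ∑ i ∈ range n, ((P i - M i) * h i * a i j - 16 * (h i * h i) * (P i + M i) * (a i j * a i j * x j))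

/-- The quadratic form that has to be small in the direction of a step. -/
def quadForm (n : ℕ) (a : ℕ → ℕ → ℝ) (x h P M u : ℕ → ℝ) : ℝ :=
  ∑ i ∈ range n, (P i + M i) * (2 * (h i * h i) *
      ((∑ j ∈ range n, a i j * u j) * ∑ j ∈ range n, a i j * u j) +
    1024 * (h i * h i * (h i * h i)) *
      ((∑ j ∈ range n, a i j * a i j * x j * u j) * ∑ j ∈ range n, a i j * a i j * x j * u j))

/-- The list of vectors to be orthogonalized: the constraints, then the unit vectors. -/
noncomputable def conVec (n : ℕ) (a : ℕ → ℕ → ℝ) (x h P M D : ℕ → ℝ) (k j : ℕ) : ℝ :=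
  -- The factor `aliveR` confines all vectors to the alive coordinates, and the division by `D j`
  -- turns the weighted inner product into the plain one. The last case is a Kronecker delta written
  -- with real comparisons.
  aliveR n x j *
    if (k : ℝ) < n then prot h P M k * a k j / D j
    else if (k : ℝ) < n + n then prot h P M (k - n) * (a (k - n) j * a (k - n) j * x j) / D j
    else if (k : ℝ) < n + n + 1 then x j / D j
    else if (k : ℝ) < n + n + 2 then slope n a x h P M j / D j
    else if (k : ℝ) < n + n + 2 + j then 0 else if (n : ℝ) + n + 2 + j < k then 0 else 1

noncomputable def goodR (n : ℕ) (a : ℕ → ℕ → ℝ) (x h P M D : ℕ → ℝ) (U : ℕ → ℕ → ℝ) (k : ℕ) : ℝ :=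
  if (k : ℝ) < n + n + 2 then 0 else
    if 0 < ip n D (U k) (U k) then
      if 4 * ip n D (U k) (U k) < quadForm n a x h P M (U k) then 0 else 1
    else 0

/-- The first good vector among the `U k`. -/
noncomputable def pick (n : ℕ) (good : ℕ → ℝ) (U : ℕ → ℕ → ℝ) (j : ℕ) : ℝ :=
  ∑ k ∈ range (3 * n + 2), (if 0 < ∑ l ∈ range (3 * n + 2), (if (l : ℝ) < k then good l else 0)
    then 0 else good k) * U k j

/-- With fewer than `20` coordinates alive the direction is `0`, so surplus iterations do not move
the point. -/
noncomputable def normalize (n : ℕ) (x w : ℕ → ℝ) (j : ℕ) : ℝ :=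
  if aliveN n x < 20 then 0 else w j / ∑ j ∈ range n, if w j < 0 then 0 - w j else w j

/-- The part of the memory that outlives an iteration: the point `x`, for each row a scale `h`,
weights `P` and `M` and a lock, the excess threshold `θ` and the size `m` of the stage. -/
structure Cfg where
  x : ℕ → ℝ
  h : ℕ → ℝ
  P : ℕ → ℝ
  M : ℕ → ℝ
  lk : ℕ → ℝ
  θ : ℝ
  m : ℝ

/-- What is required of the direction of a step. -/
structure GoodDir (n : ℕ) (A : ℕ → ℕ → ℝ) (c : Cfg) (w : ℕ → ℝ) : Prop where
  dead : ∀ j < n, aliveR n c.x j = 0 → w j = 0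
  l1 : ∑ j ∈ range n, |w j| = 1
  prot₁ : ∀ i < n, prot c.h c.P c.M i = 1 → ∑ j ∈ range n, trunc A c.h i j * w j = 0
  prot₂ : ∀ i < n, prot c.h c.P c.M i = 1 → ∑ j ∈ range n, trunc A c.h i j ^ 2 * c.x j * w j = 0
  orth : ∑ j ∈ range n, c.x j * w j = 0
  lin : ∑ j ∈ range n, slope n (trunc A c.h) c.x c.h c.P c.M j * w j = 0
  quad : quadForm n (trunc A c.h) c.x c.h c.P c.M w ≤
    4 * ip n (metric n (trunc A c.h) c.h c.P c.M) w w

/-! ### Existence and selection of a good direction -/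

theorem aliveR_eq_or (n : ℕ) (x : ℕ → ℝ) (j : ℕ) : aliveR n x j = 0 ∨ aliveR n x j = 1 := by
  unfold aliveR; split_ifs <;> simp

theorem prot_eq_or (h P M : ℕ → ℝ) (i : ℕ) : prot h P M i = 0 ∨ prot h P M i = 1 := by
  unfold prot; split_ifs <;> simp

theorem aliveN_eq_card (n : ℕ) (x : ℕ → ℝ) : aliveN n x = (aliveSet n x).card := by
  unfold aliveN aliveSet
  rw [card_filter, Nat.cast_sum]
  refine sum_congr rfl fun j _ => ?_
  rcases aliveR_eq_or n x j with h | h <;> simp [h]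

theorem trunc_sq_le (A : ℕ → ℕ → ℝ) (h : ℕ → ℝ) (i j : ℕ) :
    h i ^ 2 * trunc A h i j ^ 2 ≤ 1 / 1024 := by
  unfold trunc
  split_ifs with H
  · norm_num
  · rw [sq, sq]; linarith

theorem metric_pos {n : ℕ} {a : ℕ → ℕ → ℝ} {h P M : ℕ → ℝ} (hP : ∀ i < n, 0 ≤ P i)
    (hM : ∀ i < n, 0 ≤ M i) (j : ℕ) : 0 < metric n a h P M j := by
  have : 0 ≤ ∑ i ∈ range n, (P i + M i) * (h i * h i) * (a i j * a i j) :=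
    sum_nonneg fun i hi => mul_nonneg (mul_nonneg (add_nonneg (hP i (mem_range.mp hi))
      (hM i (mem_range.mp hi))) (mul_self_nonneg _)) (mul_self_nonneg _)
  unfold metric; linarith

theorem quadForm_smul (n : ℕ) (a : ℕ → ℕ → ℝ) (x h P M u : ℕ → ℝ) (c : ℝ) :
    quadForm n a x h P M (fun j => u j / c) = quadForm n a x h P M u / c ^ 2 := by
  unfold quadForm
  rw [sum_div]
  refine sum_congr rfl fun i _ => ?_
  simp only [mul_div_assoc', ← sum_div]
  ring

theorem ip_smul (n : ℕ) (D u : ℕ → ℝ) (c : ℝ) :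
    ip n D (fun j => u j / c) (fun j => u j / c) = ip n D u u / c ^ 2 := by
  unfold ip
  rw [sum_div]
  exact sum_congr rfl fun i _ => by ring

theorem sum_abs_ite (n : ℕ) (w : ℕ → ℝ) :
    ∑ j ∈ range n, (if w j < 0 then 0 - w j else w j) = ∑ j ∈ range n, |w j| := by
  refine sum_congr rfl fun j _ => ?_
  split_ifs with h
  · rw [abs_of_neg h, zero_sub]
  · rw [abs_of_nonneg (not_lt.mp h)]

theorem goodR_eq_or (n : ℕ) (a : ℕ → ℕ → ℝ) (x h P M D : ℕ → ℝ) (U : ℕ → ℕ → ℝ) (k : ℕ) :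
    goodR n a x h P M D U k = 0 ∨ goodR n a x h P M D U k = 1 := by
  unfold goodR; split_ifs <;> simp

theorem pick_eq_zero {n : ℕ} {good : ℕ → ℝ} {U : ℕ → ℕ → ℝ}
    (h : ∀ k < 3 * n + 2, good k = 0) (j : ℕ) : pick n good U j = 0 := by
  unfold pick
  refine sum_eq_zero fun k hk => ?_
  rw [h k (mem_range.mp hk)]; simp

theorem pick_eq {n : ℕ} {good : ℕ → ℝ} (U : ℕ → ℕ → ℝ) (hg : ∀ k, good k = 0 ∨ good k = 1)
    (h : ∃ k < 3 * n + 2, good k = 1) :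
    ∃ k < 3 * n + 2, good k = 1 ∧ ∀ j, pick n good U j = U k j := by
  classical
  obtain ⟨h1, h2⟩ := Nat.find_spec h
  refine ⟨Nat.find h, h1, h2, fun j => ?_⟩
  have hmin : ∀ l < Nat.find h, l < 3 * n + 2 → good l = 0 := fun l hl hl' =>
    (hg l).resolve_right fun hc => Nat.find_min h hl ⟨hl', hc⟩
  generalize Nat.find h = k at *
  unfold pick
  rw [sum_eq_single k]
  · rw [if_neg, h2, one_mul]
    rw [sum_eq_zero]
    · exact lt_irrefl 0
    · intro l hl
      split_ifs with hlk
      · exact hmin l (by exact_mod_cast hlk) (mem_range.mp hl)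
      · rfl
  · intro l hl hne
    rcases lt_or_gt_of_ne hne with hlt | hgt
    · rw [hmin l hlt (mem_range.mp hl)]; simp
    · rw [if_pos, zero_mul]
      have hle := single_le_sum (s := range (3 * n + 2))
        (f := fun l' : ℕ => if (l' : ℝ) < l then good l' else 0) (fun l' _ => by
          rcases hg l' with h | h <;> simp only [h] <;> split_ifs <;> norm_num)
        (mem_range.mpr h1)
      have hkl : (k : ℝ) < l := by exact_mod_cast hgt
      simp only [hkl, if_true, h2] at hle
      linarith
  · exact fun h => absurd (mem_range.mpr h1) h

section
variable {n : ℕ} {a : ℕ → ℕ → ℝ} {x h P M D : ℕ → ℝ}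

theorem conVec_row {k : ℕ} (hk : k < n) (j : ℕ) :
    conVec n a x h P M D k j = aliveR n x j * (prot h P M k * a k j / D j) := by
  have : (k : ℝ) < n := by exact_mod_cast hk
  simp [conVec, this]

theorem conVec_row_sq {k : ℕ} (hk : k < n) (j : ℕ) :
    conVec n a x h P M D (n + k) j =
      aliveR n x j * (prot h P M k * (a k j * a k j * x j) / D j) := by
  have h1 : ¬ ((n + k : ℕ) : ℝ) < n := by rw [not_lt]; exact_mod_cast Nat.le_add_right n k
  have h2 : ((n + k : ℕ) : ℝ) < n + n := by exact_mod_cast Nat.add_lt_add_left hk n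
  simp only [conVec, h1, h2, if_true, if_false, Nat.add_sub_cancel_left]

theorem conVec_point (j : ℕ) :
    conVec n a x h P M D (n + n) j = aliveR n x j * (x j / D j) := by
  have h1 : ¬ ((n + n : ℕ) : ℝ) < n := by rw [not_lt]; exact_mod_cast Nat.le_add_right n n
  simp only [conVec, h1, if_false]
  simp

theorem conVec_slope (j : ℕ) :
    conVec n a x h P M D (n + n + 1) j = aliveR n x j * (slope n a x h P M j / D j) := by
  have h1 : ¬ ((n + n + 1 : ℕ) : ℝ) < n := by rw [not_lt]; exact_mod_cast by omega
  have h2 : ¬ ((n + n + 1 : ℕ) : ℝ) < n + n := by rw [not_lt]; exact_mod_cast by omega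
  have h3 : ¬ ((n + n + 1 : ℕ) : ℝ) < n + n + 1 := by rw [not_lt]; exact_mod_cast le_rfl
  have h4 : ((n + n + 1 : ℕ) : ℝ) < n + n + 2 := by exact_mod_cast by omega
  simp only [conVec, h1, h2, h3, h4, if_false, if_true]

theorem conVec_unit (i j : ℕ) :
    conVec n a x h P M D (2 * n + 2 + i) j = if j = i then aliveR n x j else 0 := by
  have h1 : ¬ ((2 * n + 2 + i : ℕ) : ℝ) < n := by rw [not_lt]; exact_mod_cast by omega
  have h2 : ¬ ((2 * n + 2 + i : ℕ) : ℝ) < n + n := by rw [not_lt]; exact_mod_cast by omega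
  have h3 : ¬ ((2 * n + 2 + i : ℕ) : ℝ) < n + n + 1 := by rw [not_lt]; exact_mod_cast by omega
  have h4 : ¬ ((2 * n + 2 + i : ℕ) : ℝ) < n + n + 2 := by rw [not_lt]; exact_mod_cast by omega
  have h5 : ((2 * n + 2 + i : ℕ) : ℝ) < n + n + 2 + j ↔ i < j := by
    constructor
    · intro h; have : 2 * n + 2 + i < n + n + 2 + j := by exact_mod_cast h
      omega
    · intro h; exact_mod_cast (by omega : 2 * n + 2 + i < n + n + 2 + j)
  have h6 : (n : ℝ) + n + 2 + j < ((2 * n + 2 + i : ℕ) : ℝ) ↔ j < i := by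
    constructor
    · intro h; have : n + n + 2 + j < 2 * n + 2 + i := by exact_mod_cast h
      omega
    · intro h; exact_mod_cast (by omega : n + n + 2 + j < 2 * n + 2 + i)
  simp only [conVec, h1, h2, h3, h4, h5, h6, if_false]
  rcases lt_trichotomy i j with hij | rfl | hij
  · simp [hij, hij.ne']
  · simp
  · simp [hij, hij.ne, hij.not_gt]

theorem sum_eq_zero_of_conVec {w v : ℕ → ℝ} {k : ℕ} (hD : ∀ j, 0 < D j)
    (hw : ∀ j < n, aliveR n x j = 0 → w j = 0)
    (hk : ∀ j, conVec n a x h P M D k j = aliveR n x j * (v j / D j))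
    (h0 : ip n D (conVec n a x h P M D k) w = 0) : ∑ j ∈ range n, v j * w j = 0 := by
  rw [← h0]
  refine sum_congr rfl fun j hj => ?_
  rw [hk j]
  rcases aliveR_eq_or n x j with h1 | h1
  · rw [hw j (mem_range.mp hj) h1]; ring
  · have := (hD j).ne'
    rw [h1]; field_simp

end

/-- The direction computed in an iteration is good or zero; it is good if some `U k` is. -/
theorem goodDir_normalize {n : ℕ} {A : ℕ → ℕ → ℝ} {c : Cfg} (hP : ∀ i < n, 0 ≤ c.P i)
    (hM : ∀ i < n, 0 ≤ c.M i) {D : ℕ → ℝ} (hDdef : D = metric n (trunc A c.h) c.h c.P c.M)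
    {U : ℕ → ℕ → ℝ}
    (hU : IsOrthogonalization n (3 * n + 2) D (conVec n (trunc A c.h) c.x c.h c.P c.M D) U) :
    let w := normalize n c.x
      (pick n (goodR n (trunc A c.h) c.x c.h c.P c.M D U) U)
    ((∀ j, w j = 0) ∨ GoodDir n A c w) ∧
      (20 ≤ aliveN n c.x → (∃ k < 3 * n + 2, goodR n (trunc A c.h) c.x c.h c.P c.M D U k = 1) →
        GoodDir n A c w) := by
  intro w
  have hD : ∀ j, 0 < D j := fun j => hDdef ▸ metric_pos hP hM j
  by_cases h20 : aliveN n c.x < 20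
  · refine ⟨Or.inl fun j => if_pos h20, fun h => absurd h20 (not_lt.mpr h)⟩
  set good := goodR n (trunc A c.h) c.x c.h c.P c.M D U with hgood
  have main : (∃ k < 3 * n + 2, good k = 1) → GoodDir n A c w := by
    intro hex
    obtain ⟨k, hk, hgk, hpk⟩ := pick_eq U (fun k => goodR_eq_or _ _ _ _ _ _ _ _ k) hex
    have hgk' := hgk
    simp only [goodR] at hgk'
    have hk2 : 2 * n + 2 ≤ k := by
      by_contra hlt
      have : (k : ℝ) < n + n + 2 := by exact_mod_cast (by omega : k < n + n + 2)
      rw [if_pos this] at hgk'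
      norm_num at hgk'
    rw [if_neg (by rw [not_lt]; exact_mod_cast (by omega : n + n + 2 ≤ k))] at hgk'
    have hpos : 0 < ip n D (U k) (U k) := by
      by_contra hlt
      rw [if_neg hlt] at hgk'
      norm_num at hgk'
    rw [if_pos hpos] at hgk'
    have hquad : quadForm n (trunc A c.h) c.x c.h c.P c.M (U k) ≤ 4 * ip n D (U k) (U k) := by
      by_contra hlt
      rw [if_pos (not_le.mp hlt)] at hgk'
      norm_num at hgk'
    set s := ∑ j ∈ range n, |U k j| with hs
    have hw : w = fun j => U k j / s := by
      funext j
      simp only [w, normalize, if_neg h20, hpk, sum_abs_ite, hs]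
    have hs0 : 0 < s := by
      have h0 : 0 ≤ s := sum_nonneg fun _ _ => abs_nonneg _
      refine lt_of_le_of_ne h0 fun h => hpos.ne ?_
      symm
      refine sum_eq_zero fun j hj => ?_
      have := (sum_eq_zero_iff_of_nonneg (fun j _ => abs_nonneg (U k j))).mp h.symm j hj
      rw [abs_eq_zero.mp this]; ring
    -- The vectors `conVec` vanish on dead coordinates, hence so do their combinations.
    have hdead : ∀ k < 3 * n + 2, ∀ j < n, aliveR n c.x j = 0 → U k j = 0 := by
      intro k
      induction k using Nat.strong_induction_on with
      | _ k ih =>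
        intro hk j hj hjS
        rw [hU k hk j hj, sum_eq_zero, sub_zero]
        · simp [conVec, hjS]
        · intro l hl
          rw [ih l (mem_range.mp hl) ((mem_range.mp hl).trans hk) j hj hjS, mul_zero]
    have hz : ∀ l < 2 * n + 2, ∀ v : ℕ → ℝ,
        (∀ j, conVec n (trunc A c.h) c.x c.h c.P c.M D l j = aliveR n c.x j * (v j / D j)) →
        ∑ j ∈ range n, v j * w j = 0 := by
      intro l hl v hv
      have h0 := sum_eq_zero_of_conVec hD (hdead k hk) hv
        (hU.ip_V_eq_zero hD hk (lt_of_lt_of_le hl hk2))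
      simp only [hw, mul_div_assoc', ← sum_div, h0, zero_div]
    refine ⟨?_, ?_, ?_, ?_, ?_, ?_, ?_⟩
    · intro j hj hj0
      simp only [hw, hdead k hk j hj hj0, zero_div]
    · simp only [hw, abs_div, abs_of_pos hs0, ← sum_div]
      exact div_self hs0.ne'
    · intro i hi hp
      refine hz i (by omega) (fun j => trunc A c.h i j) fun j => ?_
      rw [conVec_row hi, hp, one_mul]
    · intro i hi hp
      refine hz (n + i) (by omega) (fun j => trunc A c.h i j ^ 2 * c.x j) fun j => ?_
      rw [conVec_row_sq hi, hp, one_mul, sq]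
    · exact hz (n + n) (by omega) c.x fun j => conVec_point j
    · exact hz (n + n + 1) (by omega) _ fun j => conVec_slope j
    · rw [hw, quadForm_smul, ip_smul, ← mul_div_assoc, ← hDdef]
      exact div_le_div_of_nonneg_right hquad (sq_nonneg _)
  refine ⟨?_, fun _ => main⟩
  by_cases hex : ∃ k < 3 * n + 2, good k = 1
  · exact Or.inr (main hex)
  · left
    push Not at hex
    intro j
    simp only [w, normalize, if_neg h20]
    rw [pick_eq_zero (fun k hk => (goodR_eq_or _ _ _ _ _ _ _ _ k).resolve_right (hex k hk)) j,
      zero_div]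

/-- Some `U k` is good if few rows are protected. -/
theorem exists_good {n : ℕ} {a : ℕ → ℕ → ℝ} {x h P M D : ℕ → ℝ} {U : ℕ → ℕ → ℝ}
    (hP : ∀ i < n, 0 ≤ P i) (hM : ∀ i < n, 0 ≤ M i) (hx : ∀ j < n, |x j| ≤ 1)
    (ha : ∀ i j, h i ^ 2 * a i j ^ 2 ≤ 1 / 1024) (hDdef : D = metric n a h P M)
    (hU : IsOrthogonalization n (3 * n + 2) D (conVec n a x h P M D) U)
    (hprot : 8 * (((range n).filter fun i => prot h P M i = 1).card : ℝ) + 8 < aliveN n x) :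
    ∃ k < 3 * n + 2, goodR n a x h P M D U k = 1 := by
  classical
  have hD : ∀ j, 0 < D j := fun j => hDdef ▸ metric_pos hP hM j
  set R := (range n).filter fun i => prot h P M i = 1 with hR
  -- Unprotected rows give zero vectors, so only two constraints per protected row count, besides
  -- the point and the slope.
  set Z : Finset ℕ := R ∪ R.image (n + ·) ∪ {n + n, n + n + 1} with hZ
  have hZcard : Z.card ≤ 2 * R.card + 2 := by
    have h1 := card_union_le (R ∪ R.image (n + ·)) {n + n, n + n + 1}
    have h2 := card_union_le R (R.image (n + ·))
    have h3 : (R.image (n + ·)).card ≤ R.card := card_image_le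
    have h4 : ({n + n, n + n + 1} : Finset ℕ).card ≤ 2 := card_le_two
    rw [hZ]
    omega
  rw [aliveN_eq_card] at hprot
  have hprot' : 8 * R.card + 8 < (aliveSet n x).card := by exact_mod_cast hprot
  have e3 : 3 * n + 2 = 2 * n + 2 + n := by ring
  set s : ℕ → ℝ := fun i => if i < n then (P i + M i) * (2 * h i ^ 2) else 0 with hs
  set t : ℕ → ℝ := fun i => if i < n then (P i + M i) * (1024 * h i ^ 4) else 0 with ht
  have hs0 : ∀ i, 0 ≤ s i := fun i => by
    simp only [hs]; split_ifs with hi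
    · exact mul_nonneg (add_nonneg (hP i hi) (hM i hi)) (by positivity)
    · exact le_rfl
  have ht0 : ∀ i, 0 ≤ t i := fun i => by
    simp only [ht]; split_ifs with hi
    · exact mul_nonneg (add_nonneg (hP i hi) (hM i hi)) (by positivity)
    · exact le_rfl
  have hVS : ∀ k < 2 * n + 2 + n, ∀ j < n, j ∉ aliveSet n x → conVec n a x h P M D k j = 0 := by
    intro k hk j hj hjS
    have : aliveR n x j = 0 := (aliveR_eq_or n x j).resolve_right fun h1 =>
      hjS (mem_filter.mpr ⟨mem_range.mpr hj, h1⟩)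
    simp [conVec, this]
  have hVe : ∀ i ∈ aliveSet n x, ∀ j < n, conVec n a x h P M D (2 * n + 2 + i) j =
      if j = i then 1 else 0 := by
    intro i hi j hj
    rw [conVec_unit]
    split_ifs with hij
    · rw [hij]; exact (mem_filter.mp hi).2
    · rfl
  have hVZ : ∀ k < 2 * n + 2, k ∉ Z → ∀ j < n, conVec n a x h P M D k j = 0 := by
    intro k hk hkZ j hj
    have hp0 : ∀ i < n, i ∉ R → prot h P M i = 0 := fun i hi hiR =>
      (prot_eq_or h P M i).resolve_right fun h1 => hiR (mem_filter.mpr ⟨mem_range.mpr hi, h1⟩)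
    simp only [hZ, mem_union, mem_insert, mem_singleton, mem_image, not_or, not_exists,
      not_and] at hkZ
    obtain ⟨⟨hk1, hk2⟩, hk3, hk4⟩ := hkZ
    by_cases hkn : k < n
    · rw [conVec_row hkn, hp0 k hkn hk1]; simp
    · obtain ⟨i, rfl⟩ := Nat.exists_eq_add_of_le (not_lt.mp hkn)
      have hi : i < n := by omega
      rw [conVec_row_sq hi, hp0 i hi fun h1 => hk2 i h1 rfl]; simp
  have hab : ∀ j ∈ aliveSet n x, ∑ i ∈ range n, (s i * a i j ^ 2 + t i * (a i j ^ 2 * x j) ^ 2) ≤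
      3 * D j := by
    intro j hj
    have hjn : j < n := mem_range.mp (mem_filter.mp hj).1
    rw [hDdef]
    unfold metric
    rw [mul_add, mul_sum]
    refine le_trans (sum_le_sum fun i hi => ?_) (le_add_of_nonneg_left (by norm_num))
    have hi' := mem_range.mp hi
    simp only [hs, ht, hi', if_true]
    have hG := add_nonneg (hP i hi') (hM i hi')
    have h1 := ha i j
    have hx2 : x j ^ 2 ≤ 1 := (sq_le_one_iff_abs_le_one _).mpr (hx j hjn)
    have h2 : 0 ≤ h i ^ 2 * a i j ^ 2 := by positivity
    -- As `h ^ 2 * a ^ 2 ≤ 1 / 1024`, the quartic term costs at most one more `h ^ 2 * a ^ 2`, which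
    -- makes `2 + 1 = 3`.
    have h3 : 1024 * (h i ^ 2 * a i j ^ 2) * (h i ^ 2 * a i j ^ 2) * x j ^ 2 ≤
        1 * (h i ^ 2 * a i j ^ 2) * 1 := by gcongr; linarith
    have h4 := mul_le_mul_of_nonneg_left h3 hG
    linarith
  rw [e3] at hU
  obtain ⟨k, hk1, hk2, hk3, hk4⟩ := hU.exists_small hD (aliveSet n x) (filter_subset _ _)
    hVS hVe Z hVZ (by omega) s t a (fun i j => a i j ^ 2 * x j) hs0 ht0 hab
  refine ⟨k, by omega, ?_⟩
  unfold goodR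
  rw [if_neg (by rw [not_lt]; exact_mod_cast (by omega : n + n + 2 ≤ k)), if_pos hk3, if_neg]
  rw [not_lt]
  refine le_trans (le_of_eq ?_) hk4
  refine sum_congr rfl fun i hi => ?_
  simp only [hs, ht, mem_range.mp hi, if_true, sq]
  ring

/-! ### Weights bound the movement of a row -/

/-- The exponent of the lower bound for a weight, as the point moves from `y` to `x`. -/
def expo (n : ℕ) (h : ℝ) (a x y : ℕ → ℝ) : ℝ :=
  h * ∑ j ∈ range n, a j * (x j - y j) +
    8 * h ^ 2 * (∑ j ∈ range n, a j ^ 2 * y j ^ 2 - ∑ j ∈ range n, a j ^ 2 * x j ^ 2)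

theorem expo_self (n : ℕ) (h : ℝ) (a x : ℕ → ℝ) : expo n h a x x = 0 := by simp [expo]

/-- This additivity lets the exponential lower bounds of `Watched` survive a step. -/
theorem expo_add_incr (n : ℕ) (h σ : ℝ) (a x y w : ℕ → ℝ) :
    expo n h a x y + incr n h σ a x w = expo n h a (fun j => x j + σ * w j) y := by
  rw [incr_eq_sub]
  unfold expo
  have : ∑ j ∈ range n, a j * (x j + σ * w j - y j) =
      ∑ j ∈ range n, a j * (x j - y j) + ∑ j ∈ range n, a j * (x j + σ * w j - x j) := by
    rw [← sum_add_distrib]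
    exact sum_congr rfl fun _ _ => by ring
  rw [this]; ring

/-- The weights of row `i` bound how far it has moved since the point was `y`. -/
structure Watched (n : ℕ) (A : ℕ → ℕ → ℝ) (c : Cfg) (i : ℕ) (y : ℕ → ℝ) (W ε Q : ℝ) : Prop where
  hpos : 0 < c.h i
  yb : ∀ j < n, |y j| ≤ 1
  lowP : W * Real.exp (expo n (c.h i) (trunc A c.h i) c.x y) ≤ c.P i
  lowM : W * Real.exp (expo n (-c.h i) (trunc A c.h i) c.x y) ≤ c.M i
  agree : ∀ j < n, aliveR n y j = 0 → c.x j = y j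
  energy : aliveSq n A y i ≤ 2 * ε
  epos : 0 < ε
  wpos : 0 < W
  scale₁ : c.h i ^ 2 * ε ≤ Q
  scale₂ : Q ≤ 4 * (c.h i ^ 2 * ε)

theorem aliveR_nonneg (n : ℕ) (x : ℕ → ℝ) (j : ℕ) : 0 ≤ aliveR n x j := by
  rcases aliveR_eq_or n x j with h | h <;> simp [h]

theorem trunc_sq_le_sq (A : ℕ → ℕ → ℝ) (h : ℕ → ℝ) (i j : ℕ) :
    trunc A h i j ^ 2 ≤ A i j * A i j := by
  unfold trunc
  split_ifs
  · simpa using mul_self_nonneg _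
  · rw [sq]

section
variable {n : ℕ} {A : ℕ → ℕ → ℝ} {c : Cfg} {i : ℕ} {y : ℕ → ℝ} {W ε Q : ℝ}

/-- Only coordinates alive at `y` can have moved since, and each contributes at most `A i j ^ 2`. -/
theorem Watched.energy_le (H : Watched n A c i y W ε Q) (hx : ∀ j < n, |c.x j| ≤ 1) :
    ∑ j ∈ range n, trunc A c.h i j ^ 2 * c.x j ^ 2 -
      ∑ j ∈ range n, trunc A c.h i j ^ 2 * y j ^ 2 ≤ 2 * ε := by
  refine le_trans ?_ H.energy
  rw [← sum_sub_distrib]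
  refine sum_le_sum fun j hj => ?_
  rcases aliveR_eq_or n y j with h0 | h1
  · rw [H.agree j (mem_range.mp hj) h0, h0]; simp
  · rw [h1, one_mul]
    have hx2 : c.x j ^ 2 ≤ 1 := (sq_le_one_iff_abs_le_one _).mpr (hx j (mem_range.mp hj))
    have ht := trunc_sq_le_sq A c.h i j
    have h2 : 0 ≤ trunc A c.h i j ^ 2 := sq_nonneg _
    have h3 : 0 ≤ trunc A c.h i j ^ 2 * y j ^ 2 := by positivity
    nlinarith

/-- Neither weight exceeds `2700`, so both exponents are at most `log (2700 / W)`. Their drifts have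
opposite signs, and the energy term costs at most `16 * Q`. -/
theorem Watched.trunc_bound (H : Watched n A c i y W ε Q) (hx : ∀ j < n, |c.x j| ≤ 1)
    (hcap : c.P i + c.M i ≤ 2700) :
    |∑ j ∈ range n, trunc A c.h i j * (c.x j - y j)| ≤
      (Real.log (2700 / W) + 16 * Q) / c.h i := by
  have hE := H.energy_le hx
  have hh := H.hpos
  have hW := H.wpos
  have hP0 : 0 < c.P i := lt_of_lt_of_le (mul_pos hW (Real.exp_pos _)) H.lowP
  have hM0 : 0 < c.M i := lt_of_lt_of_le (mul_pos hW (Real.exp_pos _)) H.lowM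
  have key : ∀ X : ℝ, W * Real.exp X ≤ 2700 → X ≤ Real.log (2700 / W) := fun X hX => by
    rw [Real.le_log_iff_exp_le (by positivity), le_div_iff₀ hW]; linarith
  have k1 := key _ (H.lowP.trans (by linarith))
  have k2 := key _ (H.lowM.trans (by linarith))
  have h8 : 8 * c.h i ^ 2 * (∑ j ∈ range n, trunc A c.h i j ^ 2 * c.x j ^ 2 -
      ∑ j ∈ range n, trunc A c.h i j ^ 2 * y j ^ 2) ≤ 16 * Q := by
    have := mul_le_mul_of_nonneg_left hE (by positivity : 0 ≤ 8 * c.h i ^ 2)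
    linarith [H.scale₁]
  unfold expo at k1 k2
  rw [neg_sq] at k2
  rw [le_div_iff₀ hh, show ∀ t : ℝ, |t| * c.h i = |t * c.h i| from fun t => by rw [abs_mul, abs_of_pos hh], abs_le]
  constructor <;> nlinarith

/-- A truncated entry satisfies `1 ≤ 32 * h * |A i j|`, so its contribution of at most `2 * |A i j|`
is at most `64 * h * A i j ^ 2`. These sum to a multiple of the energy. -/
theorem Watched.rest_bound (H : Watched n A c i y W ε Q) (hx : ∀ j < n, |c.x j| ≤ 1) :
    |∑ j ∈ range n, (A i j - trunc A c.h i j) * (c.x j - y j)| ≤ 128 * (c.h i * ε) := by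
  have hh := H.hpos
  refine (abs_sum_le_sum_abs _ _).trans ?_
  have : ∀ j ∈ range n, |(A i j - trunc A c.h i j) * (c.x j - y j)| ≤
      64 * c.h i * (aliveR n y j * (A i j * A i j)) := by
    intro j hj
    have hj' := mem_range.mp hj
    rcases aliveR_eq_or n y j with h0 | h1
    · rw [H.agree j hj' h0]; simp [h0]
    · rw [h1, one_mul]
      unfold trunc
      split_ifs with hb
      · rw [sub_zero, abs_mul]
        have h2 : |c.x j - y j| ≤ 2 := by
          have := abs_sub (c.x j) (y j)
          linarith [hx j hj', H.yb j hj']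
        have h3 : 1 ≤ 32 * (c.h i * |A i j|) := by
          refine le_of_sq_le_sq ?_ (by positivity)
          rw [mul_pow, mul_pow, sq_abs]; linarith
        have h4 : |A i j| * |A i j| = A i j * A i j := abs_mul_abs_self _
        have h5 : |A i j| * 1 ≤ |A i j| * (32 * (c.h i * |A i j|)) :=
          mul_le_mul_of_nonneg_left h3 (abs_nonneg _)
        calc |A i j| * |c.x j - y j| ≤ |A i j| * 2 :=
              mul_le_mul_of_nonneg_left h2 (abs_nonneg _)
          _ ≤ 64 * c.h i * (|A i j| * |A i j|) := by linarith
          _ = _ := by rw [h4]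
      · rw [sub_self, zero_mul, abs_zero]
        have := mul_self_nonneg (A i j)
        positivity
  refine (sum_le_sum this).trans ?_
  rw [← mul_sum]
  have := mul_le_mul_of_nonneg_left H.energy (by positivity : 0 ≤ 64 * c.h i)
  unfold aliveSq at this
  linarith

theorem Watched.bound (H : Watched n A c i y W ε Q) (hx : ∀ j < n, |c.x j| ≤ 1)
    (hcap : c.P i + c.M i ≤ 2700) :
    |∑ j ∈ range n, A i j * c.x j - ∑ j ∈ range n, A i j * y j| ≤
      (Real.log (2700 / W) + 16 * Q) / c.h i + 128 * (c.h i * ε) := by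
  have e : ∑ j ∈ range n, A i j * c.x j - ∑ j ∈ range n, A i j * y j =
      ∑ j ∈ range n, trunc A c.h i j * (c.x j - y j) +
      ∑ j ∈ range n, (A i j - trunc A c.h i j) * (c.x j - y j) := by
    rw [← sum_sub_distrib, ← sum_add_distrib]
    exact sum_congr rfl fun _ _ => by ring
  rw [e]
  exact (abs_add_le _ _).trans (add_le_add (H.trunc_bound hx hcap) (H.rest_bound hx))

theorem log_2700_le : Real.log 2700 ≤ 8 := by
  rw [Real.log_le_iff_le_exp (by norm_num)]
  have := Real.exp_one_gt_d9
  have h8 : Real.exp 8 = Real.exp 1 ^ 8 := by rw [← Real.exp_nat_mul]; norm_num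
  rw [h8]
  calc (2700 : ℝ) ≤ 2.7182818283 ^ 8 := by norm_num
    _ ≤ _ := by gcongr

theorem Watched.inv_h_le (H : Watched n A c i y W ε Q) (hQ : 0 < Q) :
    Q / c.h i ≤ 2 * √(ε * Q) ∧ c.h i * ε ≤ √(ε * Q) := by
  have hh := H.hpos
  have he := H.epos
  constructor
  · have : Q / c.h i ≤ √(4 * (ε * Q)) := by
      refine Real.le_sqrt_of_sq_le ?_
      rw [div_pow, div_le_iff₀ (by positivity)]
      nlinarith [H.scale₂]
    rwa [Real.sqrt_mul (by norm_num), show (4 : ℝ) = 2 ^ 2 by norm_num,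
      Real.sqrt_sq (by norm_num)] at this
  · refine Real.le_sqrt_of_sq_le ?_
    nlinarith [H.scale₁]

/-- The movement of a row with expected energy `b` within a stage. -/
theorem Watched.bound_stage {b : ℝ} (H : Watched n A c i y b b 1) (hx : ∀ j < n, |c.x j| ≤ 1)
    (hcap : c.P i + c.M i ≤ 2700) (hb : b ≤ 100) :
    |∑ j ∈ range n, A i j * c.x j - ∑ j ∈ range n, A i j * y j| ≤ 600 * √√b := by
  have hbpos := H.epos
  have h0 := H.bound hx hcap
  obtain ⟨h1, h2⟩ := H.inv_h_le one_pos
  rw [mul_one] at h1 h2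
  -- In terms of `u`, the logarithmic loss is at most `4 / u` up to a constant, and the factor `√b =
  -- u ^ 2` from the scale leaves `O(u)`; `b ≤ 100` gives `u ≤ 3.2`.
  set u := √√b with hu
  have hu0 : 0 < u := Real.sqrt_pos.mpr (Real.sqrt_pos.mpr hbpos)
  have hu2 : √b = u ^ 2 := (Real.sq_sqrt (Real.sqrt_nonneg _)).symm
  have hu4 : b = u ^ 4 := by
    rw [show u ^ 4 = (u ^ 2) ^ 2 by ring, ← hu2, Real.sq_sqrt hbpos.le]
  have hu10 : u ≤ 3.2 := by
    have : u ^ 4 ≤ 3.2 ^ 4 := by rw [← hu4]; norm_num; linarith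
    exact le_of_pow_le_pow_left₀ (by norm_num) (by norm_num) this
  have hlog : Real.log (2700 / b) ≤ 8 + 4 * (1 / u) := by
    rw [Real.log_div (by norm_num) hbpos.ne', hu4, Real.log_pow]
    have h3 := Real.log_le_sub_one_of_pos (inv_pos.mpr hu0)
    rw [Real.log_inv] at h3
    have := log_2700_le
    push_cast
    rw [one_div]
    linarith
  rw [hu2] at h1 h2
  have h4 : (Real.log (2700 / b) + 16 * 1) / c.h i ≤ (8 + 4 * (1 / u) + 16) * (2 * u ^ 2) := by
    rw [div_eq_mul_one_div]
    refine mul_le_mul (by linarith) h1 (one_div_nonneg.mpr H.hpos.le) (by positivity)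
  have h5 : (8 + 4 * (1 / u) + 16) * (2 * u ^ 2) = 48 * u ^ 2 + 8 * u := by
    field_simp; ring
  have h6 : u ^ 2 ≤ 3.2 * u := by nlinarith
  linarith

/-- The movement of a row since it was locked. -/
theorem Watched.bound_locked {m : ℝ} {L : ℝ} (H : Watched n A c i y ((m / n) ^ 5) ε L)
    (hx : ∀ j < n, |c.x j| ≤ 1) (hcap : c.P i + c.M i ≤ 2700) (hn : 0 < n) (hm : 1 ≤ m)
    (hL : 1 ≤ L) (hlog : Real.log n ≤ L) :
    |∑ j ∈ range n, A i j * c.x j - ∑ j ∈ range n, A i j * y j| ≤ 200 * √(ε * L) := by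
  have h0 := H.bound hx hcap
  obtain ⟨h1, h2⟩ := H.inv_h_le (by linarith)
  have hn' : (0 : ℝ) < n := by exact_mod_cast hn
  -- As `1 ≤ m`, the weight bound is at least `n ^ (-5)` and its logarithm costs at most `5 * log
  -- n`.
  have h3 : Real.log (2700 / (m / n) ^ 5) ≤ 8 + 5 * Real.log n := by
    rw [Real.log_div (by norm_num) (by positivity), Real.log_pow,
      Real.log_div (by positivity) hn'.ne']
    have := log_2700_le
    have := Real.log_nonneg hm
    push_cast
    linarith
  have h4 : (Real.log (2700 / (m / n) ^ 5) + 16 * L) / c.h i ≤ 29 * (2 * √(ε * L)) := by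
    calc (Real.log (2700 / (m / n) ^ 5) + 16 * L) / c.h i ≤ 29 * L / c.h i :=
          div_le_div_of_nonneg_right (by linarith) H.hpos.le
      _ = 29 * (L / c.h i) := by ring
      _ ≤ _ := by linarith
  have := Real.sqrt_nonneg (ε * L)
  linarith

/-- The configuration after a step. -/
noncomputable def Cfg.move (n : ℕ) (A : ℕ → ℕ → ℝ) (c : Cfg) (w : ℕ → ℝ) : Cfg where
  x j := c.x j + 1 / n * w j
  h := c.h
  P i := c.P i * (1 + incr n (c.h i) (1 / n) (trunc A c.h i) c.x w +
    incr n (c.h i) (1 / n) (trunc A c.h i) c.x w ^ 2)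
  M i := c.M i * (1 + incr n (-c.h i) (1 / n) (trunc A c.h i) c.x w +
    incr n (-c.h i) (1 / n) (trunc A c.h i) c.x w ^ 2)
  lk := c.lk
  θ := c.θ
  m := c.m

theorem aliveR_congr {n : ℕ} {x y : ℕ → ℝ} {j : ℕ} (h : x j = y j) :
    aliveR n x j = aliveR n y j := by simp [aliveR, h]

/-- The update factor dominates the exponential of the increment, and dead coordinates stay put. -/
theorem Watched.move {w : ℕ → ℝ} (H : Watched n A c i y W ε Q) (hn : 1 ≤ n)
    (hx : ∀ j < n, |c.x j| ≤ 1) (hw : ∑ j ∈ range n, |w j| ≤ 1)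
    (hdead : ∀ j < n, aliveR n c.x j = 0 → w j = 0) :
    Watched n A (c.move n A w) i y W ε Q := by
  have hn' : (1 : ℝ) ≤ n := by exact_mod_cast hn
  have hσ : (0 : ℝ) ≤ 1 / n := by positivity
  have hσ1 : (1 : ℝ) / n ≤ 1 := by rw [div_le_one (by linarith)]; exact hn'
  have z1 := abs_incr_le (h := c.h i) hσ hσ1 (fun j _ => trunc_sq_le A c.h i j) hx hw
  have z2 := abs_incr_le (h := -c.h i) (a := trunc A c.h i) hσ hσ1
    (fun j _ => by rw [neg_sq]; exact trunc_sq_le A c.h i j) hx hw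
  have hstep : ∀ {V z : ℝ}, |z| ≤ 1 / 2 → ∀ X, W * Real.exp X ≤ V →
      W * Real.exp (X + z) ≤ V * (1 + z + z ^ 2) := by
    intro V z hz X hX
    rw [Real.exp_add, ← mul_assoc]
    exact mul_le_mul hX (exp_le_one_add_add_sq (by linarith)) (Real.exp_pos _).le
      ((mul_pos H.wpos (Real.exp_pos _)).le.trans hX)
  refine ⟨H.hpos, H.yb, ?_, ?_, ?_, H.energy, H.epos, H.wpos, H.scale₁, H.scale₂⟩
  · have := hstep z1 _ H.lowP
    rwa [expo_add_incr] at this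
  · have := hstep z2 _ H.lowM
    rwa [expo_add_incr] at this
  · intro j hj h0
    have h1 := H.agree j hj h0
    change c.x j + 1 / n * w j = y j
    rw [hdead j hj (by rw [aliveR_congr h1, h0]), h1]; ring

end

/-! ### The invariant and its preservation within a stage -/

/-- The state of row `i` if the current stage began at the point `Y`: either it is not locked, and
stands still or is watched since then, or it was locked at some point and is watched since. -/
def RowInv (n : ℕ) (A : ℕ → ℕ → ℝ) (c : Cfg) (Y : ℕ → ℝ) (i : ℕ) : Prop :=
  (c.lk i = 0 ∧
    |∑ j ∈ range n, A i j * Y j| ≤ 4000 * (√√100 - √√(min (base n A c.m i) 100)) ∧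
    ((c.h i = 0 ∧ ∑ j ∈ range n, A i j * c.x j = ∑ j ∈ range n, A i j * Y j) ∨
      (base n A c.m i ≤ 100 ∧ Watched n A c i Y (base n A c.m i) (base n A c.m i) 1))) ∨
  (c.lk i = 1 ∧ ∃ y θ', θ' ≤ c.θ ∧ |∑ j ∈ range n, A i j * y j| ≤ 4000 * √√100 ∧
    Watched n A c i y ((c.m / n) ^ 5) θ' (harm n))

structure Inv (n : ℕ) (A : ℕ → ℕ → ℝ) (c : Cfg) (Y : ℕ → ℝ) : Prop where
  xb : ∀ j < n, |c.x j| ≤ 1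
  Yb : ∀ j < n, |Y j| ≤ 1
  agree : ∀ j < n, aliveR n Y j = 0 → c.x j = Y j
  P0 : ∀ i < n, 0 ≤ c.P i
  M0 : ∀ i < n, 0 ≤ c.M i
  h0 : ∀ i < n, 0 ≤ c.h i
  psi : ∑ i ∈ range n, (c.P i + c.M i) ≤
    5 * c.m + 4 * (∑ j ∈ range n, c.x j ^ 2 - ∑ j ∈ range n, Y j ^ 2)
  cap : ∀ i < n, c.P i + c.M i ≤ 2700
  mY : aliveN n Y ≤ c.m
  m_le : c.m ≤ 2 * n
  th₁ : 1 / harm n ≤ c.θ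
  th₂ : c.θ ≤ 2 * n
  rows : ∀ i < n, RowInv n A c Y i

/-- Few rows stand still. -/
def FewStill (n : ℕ) (c : Cfg) : Prop :=
  50 * (((range n).filter fun i => c.h i = 0).card : ℝ) ≤ c.m

theorem harm_ge_one {n : ℕ} (hn : 1 ≤ n) : 1 ≤ harm n := by
  unfold harm
  have := single_le_sum (s := range n) (f := fun k : ℕ => 1 / ((k : ℝ) + 1))
    (fun k _ => by positivity) (mem_range.mpr hn)
  simpa using this

theorem harm_eq_harmonic (n : ℕ) : harm n = (harmonic n : ℝ) := by
  unfold harm harmonic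
  push_cast
  exact sum_congr rfl fun k _ => by rw [one_div]

theorem log_le_harm {n : ℕ} (hn : 1 ≤ n) : Real.log n ≤ harm n := by
  rw [harm_eq_harmonic]
  refine le_trans (Real.log_le_log (by exact_mod_cast hn) ?_) (log_add_one_le_harmonic n)
  push_cast; linarith

theorem harm_le_one_add_log (n : ℕ) : harm n ≤ 1 + Real.log n := by
  rw [harm_eq_harmonic]
  exact harmonic_le_one_add_log n

section
variable {n : ℕ} {A : ℕ → ℕ → ℝ} {c : Cfg} {Y w : ℕ → ℝ}

theorem rowSq_nonneg (n : ℕ) (A : ℕ → ℕ → ℝ) (i : ℕ) : 0 ≤ rowSq n A i :=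
  sum_nonneg fun _ _ => mul_self_nonneg _

/-- Halving multiplies a fourth root by less than `0.85`, and `4000 * 0.15 = 600`. This makes the
movements in successive stages telescope, without counting stages. -/
theorem sqrt_sqrt_half {b b' : ℝ} (hb : 0 ≤ b) (hb' : b' ≤ b / 2) :
    600 * √√b ≤ 4000 * (√√b - √√b') := by
  have h1 : √√b' ≤ 0.85 * √√b := by
    have h2 : (0.85 : ℝ) * √√b = √√(0.85 ^ 4 * b) := by
      rw [Real.sqrt_mul (by norm_num), Real.sqrt_mul (Real.sqrt_nonneg _),
        show (0.85 : ℝ) ^ 4 = (0.85 ^ 2) ^ 2 by norm_num, Real.sqrt_sq (by norm_num),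
        Real.sqrt_sq (by norm_num)]
    rw [h2]
    refine Real.sqrt_le_sqrt (Real.sqrt_le_sqrt ?_)
    norm_num; linarith
  have := Real.sqrt_nonneg (√b)
  linarith

/-- The discrepancy of a row that is not locked, when at least half of the stage is over. -/
theorem RowInv.unlocked_bound {i : ℕ} (H : RowInv n A c Y i) (hlk : c.lk i = 0)
    (hx : ∀ j < n, |c.x j| ≤ 1) (hcap : c.P i + c.M i ≤ 2700) {b' : ℝ}
    (hb0 : 0 ≤ base n A c.m i) (hb' : b' ≤ base n A c.m i / 2) :
    |∑ j ∈ range n, A i j * c.x j| ≤ 4000 * (√√100 - √√(min b' 100)) := by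
  rcases H with ⟨-, h1, h2⟩ | ⟨h1, -⟩
  · rcases h2 with ⟨-, h2⟩ | ⟨h2, h3⟩
    · rw [h2]
      refine h1.trans ?_
      have : √√(min b' 100) ≤ √√(min (base n A c.m i) 100) :=
        Real.sqrt_le_sqrt (Real.sqrt_le_sqrt (min_le_min_right _ (by linarith)))
      linarith
    · have h4 := h3.bound_stage hx hcap h2
      rw [min_eq_left h2] at h1
      rw [min_eq_left (by linarith)]
      have h5 := sqrt_sqrt_half hb0 hb'
      have := abs_add_le (∑ j ∈ range n, A i j * c.x j - ∑ j ∈ range n, A i j * Y j)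
        (∑ j ∈ range n, A i j * Y j)
      rw [sub_add_cancel] at this
      linarith
  · rw [h1] at hlk; norm_num at hlk

theorem RowInv.bound {i : ℕ} (H : RowInv n A c Y i) (hx : ∀ j < n, |c.x j| ≤ 1)
    (hcap : c.P i + c.M i ≤ 2700) (hn : 1 ≤ n) (hm : 1 ≤ c.m) :
    |∑ j ∈ range n, A i j * c.x j| ≤ 4000 * √√100 + 200 * √(c.θ * harm n) := by
  have hs := Real.sqrt_nonneg (c.θ * harm n)
  have hb0 : 0 ≤ base n A c.m i :=
    mul_nonneg (div_nonneg (by linarith) (Nat.cast_nonneg _)) (rowSq_nonneg _ _ _)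
  have H' := H
  rcases H with ⟨h1, -⟩ | ⟨-, y, θ', h1, h2, h3⟩
  · have h2 := H'.unlocked_bound h1 hx hcap hb0 le_rfl
    have h3 := Real.sqrt_nonneg (√(min (base n A c.m i / 2) 100))
    exact h2.trans (by nlinarith)
  · have hL := harm_ge_one hn
    have h4 := h3.bound_locked hx hcap (by omega) hm hL (log_le_harm hn)
    have h5 : √(θ' * harm n) ≤ √(c.θ * harm n) :=
      Real.sqrt_le_sqrt (mul_le_mul_of_nonneg_right h1 (by linarith))
    have := abs_add_le (∑ j ∈ range n, A i j * c.x j - ∑ j ∈ range n, A i j * y j)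
      (∑ j ∈ range n, A i j * y j)
    rw [sub_add_cancel] at this
    linarith

theorem sum_slope (a : ℕ → ℕ → ℝ) (x h P M w : ℕ → ℝ) :
    ∑ j ∈ range n, slope n a x h P M j * w j =
      ∑ i ∈ range n, ((P i - M i) * h i * (∑ j ∈ range n, a i j * w j) -
      16 * h i ^ 2 * (P i + M i) * ∑ j ∈ range n, a i j ^ 2 * x j * w j) := by
  simp only [slope, sum_mul, mul_sum]
  rw [sum_comm]
  refine sum_congr rfl fun i _ => ?_
  rw [← sum_sub_distrib]
  exact sum_congr rfl fun j _ => by ring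

theorem GoodDir.sum_sq_move (H : GoodDir n A c w) :
    ∑ j ∈ range n, (c.move n A w).x j ^ 2 =
      ∑ j ∈ range n, c.x j ^ 2 + (1 / n : ℝ) ^ 2 * ∑ j ∈ range n, w j ^ 2 := by
  have : ∑ j ∈ range n, (c.move n A w).x j ^ 2 = ∑ j ∈ range n, c.x j ^ 2 +
      2 * (1 / n) * ∑ j ∈ range n, c.x j * w j + (1 / n : ℝ) ^ 2 * ∑ j ∈ range n, w j ^ 2 := by
    rw [mul_sum, mul_sum, ← sum_add_distrib, ← sum_add_distrib]
    exact sum_congr rfl fun j _ => by simp only [Cfg.move]; ring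
  rw [this, H.orth]; ring

/-- Pythagoras, and Cauchy-Schwarz: a vector of ℓ¹-norm `1` has squared ℓ²-norm at least `1 / n`. -/
theorem GoodDir.progress (H : GoodDir n A c w) (hn : 1 ≤ n) :
    ∑ j ∈ range n, c.x j ^ 2 + 1 / (n : ℝ) ^ 3 ≤ ∑ j ∈ range n, (c.move n A w).x j ^ 2 := by
  rw [H.sum_sq_move]
  have hn' : (0 : ℝ) < n := by exact_mod_cast hn
  have h1 := sq_sum_le_card_mul_sum_sq (s := range n) (f := fun j => |w j|)
  rw [H.l1, card_range] at h1
  simp only [sq_abs] at h1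
  have h2 : 1 / (n : ℝ) ≤ ∑ j ∈ range n, w j ^ 2 := by
    rw [div_le_iff₀ hn']; linarith
  have h3 : 1 / (n : ℝ) ^ 3 = (1 / n) ^ 2 * (1 / n) := by field_simp
  rw [h3]
  gcongr

theorem GoodDir.weight_le (H : GoodDir n A c w) (I : Inv n A c Y) (hn : 1 ≤ n) :
    ∑ i ∈ range n, ((c.move n A w).P i + (c.move n A w).M i) ≤
      ∑ i ∈ range n, (c.P i + c.M i) + 4 * ((1 / n : ℝ) ^ 2 * ∑ j ∈ range n, w j ^ 2) := by
  have hn' : (1 : ℝ) ≤ n := by exact_mod_cast hn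
  refine weight_step (by positivity) (by rw [div_le_one (by linarith)]; exact hn')
    (fun i _ j _ => trunc_sq_le A c.h i j) I.xb H.l1.le I.P0 I.M0 ?_ ?_
  · rw [← sum_slope, H.lin]
  · refine le_trans (le_of_eq ?_) (H.quad.trans (le_of_eq ?_))
    · refine sum_congr rfl fun i _ => ?_
      simp only [sq]; ring
    · unfold ip metric
      simp only [sq]

/-- A coordinate moves by at most `1 / n`, the margin that alive coordinates have. An unprotected
weight is at most `900` and at most triples; a protected one does not grow. -/
theorem GoodDir.inv_move (H : GoodDir n A c w) (I : Inv n A c Y) (hn : 1 ≤ n) :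
    Inv n A (c.move n A w) Y := by
  have hn' : (1 : ℝ) ≤ n := by exact_mod_cast hn
  have hn0 : (0 : ℝ) < n := by linarith
  have hσ : (0 : ℝ) ≤ 1 / n := by positivity
  have hσ1 : (1 : ℝ) / n ≤ 1 := by rw [div_le_one (by linarith)]; exact hn'
  have hw1 : ∀ j < n, |w j| ≤ 1 := fun j hj => abs_le_one_of_sum hj H.l1.le
  have hz1 : ∀ i, |incr n (c.h i) (1 / n) (trunc A c.h i) c.x w| ≤ 1 / 2 := fun i =>
    abs_incr_le hσ hσ1 (fun j _ => trunc_sq_le A c.h i j) I.xb H.l1.le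
  have hz2 : ∀ i, |incr n (-c.h i) (1 / n) (trunc A c.h i) c.x w| ≤ 1 / 2 := fun i =>
    abs_incr_le hσ hσ1 (fun j _ => by rw [neg_sq]; exact trunc_sq_le A c.h i j) I.xb H.l1.le
  have hf : ∀ z : ℝ, |z| ≤ 1 / 2 → 0 ≤ 1 + z + z ^ 2 ∧ 1 + z + z ^ 2 ≤ 3 := by
    intro z hz
    rw [abs_le] at hz
    constructor <;> nlinarith
  have hP : ∀ i < n, 0 ≤ (c.move n A w).P i := fun i hi =>
    mul_nonneg (I.P0 i hi) (hf _ (hz1 i)).1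
  have hM : ∀ i < n, 0 ≤ (c.move n A w).M i := fun i hi =>
    mul_nonneg (I.M0 i hi) (hf _ (hz2 i)).1
  refine ⟨?_, I.Yb, ?_, hP, hM, I.h0, ?_, ?_, I.mY, I.m_le, I.th₁, I.th₂, ?_⟩
  · intro j hj
    change |c.x j + 1 / n * w j| ≤ 1
    by_cases ha : aliveR n c.x j = 0
    · rw [H.dead j hj ha, mul_zero, add_zero]; exact I.xb j hj
    · have h1 : c.x j * c.x j < (1 - 1 / n) * (1 - 1 / n) := by
        by_contra hc
        exact ha (if_neg hc)
      have h2 : |c.x j| ≤ 1 - 1 / n := abs_le_of_sq_le_sq (by nlinarith) (by linarith)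
      have h3 : |1 / (n : ℝ) * w j| ≤ 1 / n := by
        rw [abs_mul, abs_of_nonneg hσ]
        nlinarith [hw1 j hj]
      have := abs_add_le (c.x j) (1 / n * w j)
      linarith
  · intro j hj h0
    change c.x j + 1 / n * w j = Y j
    have h1 := I.agree j hj h0
    rw [H.dead j hj (by rw [aliveR_congr h1, h0]), h1]; ring
  · have h1 := H.weight_le I hn
    have h2 := I.psi
    rw [H.sum_sq_move]
    change _ ≤ 5 * c.m + _
    linarith
  · intro i hi
    have e1 := (hf _ (hz1 i))
    have e2 := (hf _ (hz2 i))
    have hPi := I.P0 i hi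
    have hMi := I.M0 i hi
    change c.P i * _ + c.M i * _ ≤ 2700
    rcases prot_eq_or c.h c.P c.M i with h0 | h1
    · have hle : c.P i + c.M i ≤ 900 := by
        unfold prot at h0
        split_ifs at h0 with g1 g2
        · norm_num at h0
        · exact not_lt.mp g2
        · norm_num at h0
      have := mul_le_mul_of_nonneg_left e1.2 hPi
      have := mul_le_mul_of_nonneg_left e2.2 hMi
      linarith
    · have g1 := incr_factor_le_one hσ hσ1 (fun j _ => trunc_sq_le A c.h i j) I.xb H.l1.le
        (H.prot₁ i hi h1) (H.prot₂ i hi h1)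
      have g2 := incr_factor_le_one (h := -c.h i) hσ hσ1
        (fun j _ => by rw [neg_sq]; exact trunc_sq_le A c.h i j) I.xb H.l1.le
        (H.prot₁ i hi h1) (H.prot₂ i hi h1)
      have := mul_le_mul_of_nonneg_left g1 hPi
      have := mul_le_mul_of_nonneg_left g2 hMi
      linarith [I.cap i hi]
  · intro i hi
    rcases I.rows i hi with ⟨h1, h2, h3⟩ | ⟨h1, y, θ', h2, h3, h4⟩
    · refine Or.inl ⟨h1, h2, ?_⟩
      rcases h3 with ⟨h3, h4⟩ | ⟨h3, h4⟩
      · refine Or.inl ⟨h3, ?_⟩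
        have hp : prot c.h c.P c.M i = 1 := by simp [prot, h3]
        have h5 := H.prot₁ i hi hp
        -- Scale `0` switches the truncation off, so the protection constraint fixes the full row.
        have h6 : ∀ j, trunc A c.h i j = A i j := fun j => by
          unfold trunc
          rw [if_neg]
          rw [h3]; norm_num
        simp only [h6] at h5
        rw [← h4]
        change ∑ j ∈ range n, A i j * (c.x j + 1 / n * w j) = _
        have : ∑ j ∈ range n, A i j * (c.x j + 1 / n * w j) =
            ∑ j ∈ range n, A i j * c.x j + 1 / n * ∑ j ∈ range n, A i j * w j := by
          rw [mul_sum, ← sum_add_distrib]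
          exact sum_congr rfl fun _ _ => by ring
        rw [this, h5]; ring
      · exact Or.inr ⟨h3, h4.move hn I.xb H.l1.le H.dead⟩
    · exact Or.inr ⟨h1, y, θ', h2, h3, h4.move hn I.xb H.l1.le H.dead⟩

theorem aliveN_nonneg (n : ℕ) (x : ℕ → ℝ) : 0 ≤ aliveN n x :=
  sum_nonneg fun _ _ => aliveR_nonneg _ _ _

theorem aliveN_le (n : ℕ) (x : ℕ → ℝ) : aliveN n x ≤ n := by
  refine (sum_le_sum (g := fun _ => (1 : ℝ)) fun j _ => ?_).trans (by simp)
  rcases aliveR_eq_or n x j with h | h <;> simp [h]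

/-- Coordinates dead at the start of the stage are unchanged, and each other one gains at most `1`.
-/
theorem Inv.sq_sub_le (I : Inv n A c Y) :
    ∑ j ∈ range n, c.x j ^ 2 - ∑ j ∈ range n, Y j ^ 2 ≤ c.m := by
  refine le_trans ?_ I.mY
  rw [← sum_sub_distrib]
  refine sum_le_sum fun j hj => ?_
  have hj' := mem_range.mp hj
  rcases aliveR_eq_or n Y j with h | h
  · rw [I.agree j hj' h, h, sub_self]
  · rw [h]
    have : c.x j ^ 2 ≤ 1 := (sq_le_one_iff_abs_le_one _).mpr (I.xb j hj')
    nlinarith [sq_nonneg (Y j)]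

theorem Inv.weight_le (I : Inv n A c Y) : ∑ i ∈ range n, (c.P i + c.M i) ≤ 9 * c.m := by
  have := I.psi
  have := I.sq_sub_le
  linarith

/-- Markov's inequality for finite sums. -/
theorem card_mul_le_sum {s : Finset ℕ} {f : ℕ → ℝ} (hf : ∀ i ∈ s, 0 ≤ f i) (t : ℝ) :
    t * ((s.filter fun i => t < f i).card : ℝ) ≤ ∑ i ∈ s, f i := by
  calc t * ((s.filter fun i => t < f i).card : ℝ) = ∑ i ∈ s.filter fun i => t < f i, t := by
        rw [sum_const, nsmul_eq_mul, mul_comm]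
    _ ≤ ∑ i ∈ s.filter fun i => t < f i, f i :=
        sum_le_sum fun i hi => (mem_filter.mp hi).2.le
    _ ≤ _ := sum_le_sum_of_subset_of_nonneg (filter_subset _ _) fun i hi _ => hf i hi

/-- At most `m / 50` rows stand still, and by Markov at most `9 * m / 900` rows have weight above
`900`. -/
theorem Inv.card_prot_le (I : Inv n A c Y) (hF : FewStill n c) :
    100 * (((range n).filter fun i => prot c.h c.P c.M i = 1).card : ℝ) ≤ 3 * c.m := by
  have h1 := card_mul_le_sum (s := range n) (f := fun i => c.P i + c.M i)
    (fun i hi => add_nonneg (I.P0 i (mem_range.mp hi)) (I.M0 i (mem_range.mp hi))) 900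
  have h2 := I.weight_le
  unfold FewStill at hF
  have h3 : ((range n).filter fun i => prot c.h c.P c.M i = 1).card ≤
      ((range n).filter fun i => c.h i = 0).card +
      ((range n).filter fun i => 900 < c.P i + c.M i).card := by
    refine le_trans (card_le_card fun i hi => ?_) (card_union_le _ _)
    obtain ⟨hi1, hi2⟩ := mem_filter.mp hi
    rw [mem_union, mem_filter, mem_filter]
    unfold prot at hi2
    split_ifs at hi2 with g1 g2
    · exact Or.inr ⟨hi1, g2⟩
    · norm_num at hi2
    · exact Or.inl ⟨hi1, le_antisymm (not_lt.mp g1) (I.h0 i (mem_range.mp hi1))⟩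
  have h4 : (((range n).filter fun i => prot c.h c.P c.M i = 1).card : ℝ) ≤
      ((range n).filter fun i => c.h i = 0).card +
      ((range n).filter fun i => 900 < c.P i + c.M i).card := by exact_mod_cast h3
  linarith

/-- In the middle of a stage there is a good direction. -/
theorem Inv.exists_good (I : Inv n A c Y) (hF : FewStill n c) (h20 : 20 ≤ aliveN n c.x)
    (hm : c.m < 2 * aliveN n c.x) {D : ℕ → ℝ} (hD : D = metric n (trunc A c.h) c.h c.P c.M)
    {U : ℕ → ℕ → ℝ}
    (hU : IsOrthogonalization n (3 * n + 2) D (conVec n (trunc A c.h) c.x c.h c.P c.M D) U) :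
    ∃ k < 3 * n + 2, goodR n (trunc A c.h) c.x c.h c.P c.M D U k = 1 :=
  -- As `m < 2 * aliveN`, at most `0.06 * aliveN` rows are protected, and `0.48 * aliveN + 8 <
  -- aliveN` when `aliveN ≥ 20`.
  PseudoKomlos.exists_good I.P0 I.M0 I.xb (trunc_sq_le A c.h) hD hU (by
    have := I.card_prot_le hF
    linarith)

end

/-! ### Thresholds, scales and the change of stage -/

/-- The sum counts the integers `k` with `k ^ 2 ≤ p`, so it is `⌊√p⌋ + 1` if the range is long
enough. -/
theorem rootN_spec {n : ℕ} {p : ℝ} (h1 : 1 ≤ p) (h2 : p < (3 * n + 2) ^ 2) :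
    p < rootN n p ^ 2 ∧ rootN n p ^ 2 ≤ 4 * p ∧ 0 < rootN n p := by
  have hs1 : 1 ≤ √p := Real.one_le_sqrt.mpr h1
  have hsq : √p ^ 2 = p := Real.sq_sqrt (by linarith)
  have hs2 : √p < 3 * n + 2 := by
    rw [Real.sqrt_lt' (by positivity)]; exact h2
  have hfl : ⌊√p⌋₊ < 3 * n + 2 := by
    rw [Nat.floor_lt (by linarith)]; push_cast; exact hs2
  have e : rootN n p = ⌊√p⌋₊ + 1 := by
    unfold rootN
    have : ∀ k ∈ range (3 * n + 2), (if p < (k : ℝ) * k then (0 : ℝ) else 1) =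
        if k ∈ range (⌊√p⌋₊ + 1) then 1 else 0 := by
      intro k _
      have hk : p < (k : ℝ) * k ↔ ¬ k ∈ range (⌊√p⌋₊ + 1) := by
        rw [mem_range, Nat.lt_succ_iff, Nat.le_floor_iff (by linarith),
          Real.le_sqrt (Nat.cast_nonneg k) (by linarith), not_le, sq]
      simp only [hk, ite_not]
    rw [sum_congr rfl this, sum_boole, filter_mem_eq_inter,
      inter_eq_right.mpr (range_subset_range.mpr hfl), card_range]
    push_cast; rfl
  have hf1 := Nat.lt_floor_add_one √p
  have hf2 := Nat.floor_le (Real.sqrt_nonneg p)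
  rw [e]
  refine ⟨?_, ?_, by positivity⟩ <;> nlinarith

/-- Double the threshold if too many rows exceed it. -/
noncomputable def thetaStep (n : ℕ) (A : ℕ → ℕ → ℝ) (x : ℕ → ℝ) (m θ : ℝ) : ℝ :=
  if m < 100 * badN n A x m θ then θ + θ else θ

/-- The start of a new stage, if it is time for one. -/
noncomputable def Cfg.stage (n : ℕ) (A : ℕ → ℕ → ℝ) (c : Cfg) : Cfg :=
  if c.m < 2 * aliveN n c.x then c else
    let m := aliveN n c.x
    let θ := (thetaStep n A c.x m)^[3 * n + 2] c.θ
    { x := c.x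
      h := fun i => if 0 < c.lk i then c.h i else whenAct n A c.x m θ i (newScale n A m θ i)
      P := fun i => if 0 < c.lk i then c.P i * (m / (16 * c.m)) else
        whenAct n A c.x m θ i (if θ < base n A m i then base n A m i else m / n)
      M := fun i => if 0 < c.lk i then c.M i * (m / (16 * c.m)) else
        whenAct n A c.x m θ i (if θ < base n A m i then base n A m i else m / n)
      lk := fun i => if 0 < c.lk i then c.lk i else
        whenAct n A c.x m θ i (if θ < base n A m i then 0 else 1)
      θ := θ
      m := m }

/-- The columns of `A` have norm at most `1`. -/
def ColNorm (n : ℕ) (A : ℕ → ℕ → ℝ) : Prop := ∀ j < n, ∑ i ∈ range n, A i j * A i j ≤ 1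

section
variable {n : ℕ} {A : ℕ → ℕ → ℝ} {c : Cfg} {Y x : ℕ → ℝ} {m θ : ℝ}

theorem ColNorm.sq_le (hA : ColNorm n A) {i j : ℕ} (hi : i < n) (hj : j < n) :
    A i j * A i j ≤ 1 :=
  (single_le_sum (f := fun i => A i j * A i j) (fun _ _ => mul_self_nonneg _)
    (mem_range.mpr hi)).trans (hA j hj)

theorem ColNorm.sum_rowSq_le (hA : ColNorm n A) : ∑ i ∈ range n, rowSq n A i ≤ n := by
  unfold rowSq
  rw [sum_comm]
  refine (sum_le_sum fun j hj => hA j (mem_range.mp hj)).trans (by simp)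

theorem base_nonneg (hm : 0 ≤ m) (i : ℕ) : 0 ≤ base n A m i :=
  mul_nonneg (div_nonneg hm (Nat.cast_nonneg _)) (rowSq_nonneg _ _ _)

theorem ColNorm.sum_base_le (hA : ColNorm n A) (hm : 0 ≤ m) (hn : 1 ≤ n) :
    ∑ i ∈ range n, base n A m i ≤ m := by
  unfold base
  rw [← mul_sum]
  have hn' : (0 : ℝ) < n := by exact_mod_cast hn
  calc m / n * ∑ i ∈ range n, rowSq n A i ≤ m / n * n := by
        gcongr; exact hA.sum_rowSq_le
    _ = m := by field_simp

theorem ColNorm.aliveSq_le (hA : ColNorm n A) {i : ℕ} (hi : i < n) : aliveSq n A x i ≤ n := by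
  refine (sum_le_sum (g := fun _ => (1 : ℝ)) fun j hj => ?_).trans (by simp)
  have := hA.sq_le hi (mem_range.mp hj)
  have h0 := mul_self_nonneg (A i j)
  rcases aliveR_eq_or n x j with h | h <;> rw [h] <;> linarith

theorem badN_anti {θ' : ℝ} (h : θ ≤ θ') : badN n A x m θ' ≤ badN n A x m θ := by
  refine sum_le_sum fun i _ => ?_
  split_ifs with h1 h2
  · exact le_rfl
  · exact absurd (by linarith) h2
  · norm_num
  · exact le_rfl

theorem ColNorm.lt_of_bad (hA : ColNorm n A) (hm : 0 ≤ m) (h : m < 100 * badN n A x m θ) :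
    θ < n := by
  by_contra hθ
  have : badN n A x m θ = 0 := by
    refine sum_eq_zero fun i hi => if_neg ?_
    have := hA.aliveSq_le (x := x) (mem_range.mp hi)
    have := base_nonneg (n := n) (A := A) hm i
    linarith
  rw [this] at h
  linarith

theorem le_thetaStep (h0 : 0 ≤ θ) : θ ≤ thetaStep n A x m θ := by
  unfold thetaStep; split_ifs <;> linarith

/-- The threshold is doubled only while it is too small, so it never exceeds both its start and
twice a failing value. -/
theorem iterate_thetaStep_le {B : ℝ} (hB : ∀ θ, m < 100 * badN n A x m θ → 2 * θ ≤ B)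
    (h : θ ≤ B) (k : ℕ) : (thetaStep n A x m)^[k] θ ≤ B := by
  induction k with
  | zero => exact h
  | succ k ih =>
    rw [Function.iterate_succ_apply']
    generalize (thetaStep n A x m)^[k] θ = t at ih
    unfold thetaStep
    split_ifs with hb
    · linarith [hB _ hb]
    · exact ih

theorem iterate_thetaStep_mono (h0 : 0 ≤ θ) {k l : ℕ} (hkl : k ≤ l) :
    (thetaStep n A x m)^[k] θ ≤ (thetaStep n A x m)^[l] θ := by
  have hpos : ∀ k, 0 ≤ (thetaStep n A x m)^[k] θ := by
    intro k
    induction k with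
    | zero => exact h0
    | succ k ih => rw [Function.iterate_succ_apply']; exact ih.trans (le_thetaStep ih)
  refine monotone_nat_of_le_succ (f := fun k => (thetaStep n A x m)^[k] θ) (fun k => ?_) hkl
  rw [Function.iterate_succ_apply']
  exact le_thetaStep (hpos k)

/-- Repeated doubling makes the threshold large enough. -/
theorem ColNorm.iterate_thetaStep_good (hA : ColNorm n A) (hm : 0 ≤ m) (h0 : 1 / (n : ℝ) ≤ θ)
    (hn : 1 ≤ n) : 100 * badN n A x m ((thetaStep n A x m)^[3 * n + 2] θ) ≤ m := by
  have hn' : (0 : ℝ) < n := by exact_mod_cast hn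
  have hθ0 : 0 ≤ θ := le_trans (by positivity) h0
  by_contra hc
  rw [not_le] at hc
  have hall : ∀ k ≤ 3 * n + 2, m < 100 * badN n A x m ((thetaStep n A x m)^[k] θ) := by
    intro k hk
    have := badN_anti (n := n) (A := A) (x := x) (m := m) (iterate_thetaStep_mono (n := n)
      (A := A) (x := x) (m := m) hθ0 hk)
    linarith
  have hpow : ∀ k ≤ 3 * n + 2, (thetaStep n A x m)^[k] θ = 2 ^ k * θ := by
    intro k
    induction k with
    | zero => intro _; simp
    | succ k ih =>
      intro hk
      rw [Function.iterate_succ_apply']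
      have hb := hall k (by omega)
      rw [ih (by omega)] at hb ⊢
      unfold thetaStep
      rw [if_pos hb]; ring
  have h1 := hA.lt_of_bad hm hc
  rw [hpow _ le_rfl] at h1
  -- The doublings take `1 / n` to at least `n`, where no row can be in excess.
  have h2 : (n : ℝ) * n ≤ 2 ^ (3 * n + 2) := by
    have hlt : n * n ≤ 2 ^ (3 * n + 2) := by
      have h3 := (Nat.lt_two_pow_self (n := n)).le
      calc n * n ≤ 2 ^ n * 2 ^ n := Nat.mul_le_mul h3 h3
        _ = 2 ^ (n + n) := (pow_add 2 n n).symm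
        _ ≤ _ := Nat.pow_le_pow_right (by norm_num) (by omega)
    exact_mod_cast hlt
  have h3 : (n : ℝ) * n * (1 / n) ≤ 2 ^ (3 * n + 2) * θ := by gcongr
  have h4 : (n : ℝ) * n * (1 / n) = n := by field_simp
  linarith

/-- A crude bound from the tangent of the logarithm at `20`. It keeps the radicands within the range
of `rootN`, and `1 / harm n` above `1 / n`. -/
theorem harm_le {n : ℕ} (hn : 20 ≤ n) : harm n ≤ 3 + n / 20 := by
  have hn' : (20 : ℝ) ≤ n := by exact_mod_cast hn
  have h1 := harm_le_one_add_log n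
  have h2 : Real.log n = Real.log 20 + Real.log (n / 20) := by
    rw [← Real.log_mul (by norm_num) (by positivity)]
    congr 1; ring
  have h3 := Real.log_le_sub_one_of_pos (show (0 : ℝ) < n / 20 by positivity)
  have h4 : Real.log 20 ≤ 3 := by
    rw [Real.log_le_iff_le_exp (by norm_num)]
    have h5 : Real.exp 3 = Real.exp 1 ^ 3 := by rw [← Real.exp_nat_mul]; norm_num
    rw [h5]
    calc (20 : ℝ) ≤ 2.7182818283 ^ 3 := by norm_num
      _ ≤ _ := by have := Real.exp_one_gt_d9; gcongr
  linarith

theorem newScale_young {i : ℕ} (hn : 20 ≤ n) (hθ : 1 / harm n ≤ θ) (h1 : θ < base n A m i)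
    (h2 : base n A m i ≤ 100) : 0 < newScale n A m θ i ∧
      newScale n A m θ i ^ 2 * base n A m i ≤ 1 ∧
      1 ≤ 4 * (newScale n A m θ i ^ 2 * base n A m i) := by
  have hL := harm_ge_one (by omega : 1 ≤ n)
  have hL2 := harm_le hn
  have hn' : (20 : ℝ) ≤ n := by exact_mod_cast hn
  unfold newScale
  rw [if_pos h1]
  generalize base n A m i = b at *
  generalize harm n = L at *
  have h3 : 1 < L * b := by
    rw [div_le_iff₀ (by linarith)] at hθ
    nlinarith
  obtain ⟨g1, g2, g3⟩ := rootN_spec (n := n) (p := L * L * b) (by nlinarith) (by nlinarith)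
  generalize rootN n (L * L * b) = g at *
  refine ⟨by positivity, ?_, ?_⟩
  · rw [div_pow, div_mul_eq_mul_div, div_le_one (by positivity)]; nlinarith
  · rw [div_pow, div_mul_eq_mul_div, ← mul_div_assoc, le_div_iff₀ (by positivity)]; nlinarith

theorem newScale_locked {i : ℕ} (hn : 20 ≤ n) (hθ : 1 / harm n ≤ θ) (h1 : ¬ θ < base n A m i)
    (h2 : θ ≤ 2 * n) : 0 < newScale n A m θ i ∧
      newScale n A m θ i ^ 2 * θ ≤ harm n ∧
      harm n ≤ 4 * (newScale n A m θ i ^ 2 * θ) := by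
  have hL := harm_ge_one (by omega : 1 ≤ n)
  have hL2 := harm_le hn
  have hn' : (20 : ℝ) ≤ n := by exact_mod_cast hn
  unfold newScale
  rw [if_neg h1]
  generalize harm n = L at *
  have h3 : 1 ≤ L * θ := by
    rw [div_le_iff₀ (by linarith)] at hθ
    nlinarith
  obtain ⟨g1, g2, g3⟩ := rootN_spec (n := n) (p := L * θ) h3 (by
    have : L * θ ≤ n * (2 * n) := by
      refine mul_le_mul (by linarith) h2 ?_ (by linarith)
      exact le_trans (by positivity) hθ
    nlinarith)
  generalize rootN n (L * θ) = g at *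
  refine ⟨by positivity, ?_, ?_⟩
  · rw [div_pow, div_mul_eq_mul_div, div_le_iff₀ (by positivity)]; nlinarith
  · rw [div_pow, div_mul_eq_mul_div, ← mul_div_assoc, le_div_iff₀ (by positivity)]; nlinarith

/-- At a change of stage the total weight must restart below `5 * m`. Old locked weights contribute
at most `9 * c.m * (m / (16 * c.m)) = 9 / 16 * m`, rows with base energy above `θ` at most `2 * m`,
newly locked rows at most `2 * m`. The rescaling of locked weights is absorbed by the fifth power in
`RowInv`: since `2 * m ≤ c.m`, `(m / c.m) ^ 5 ≤ m / (16 * c.m)`. -/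
theorem Inv.stage (I : Inv n A c Y) (hn : 20 ≤ n) (hA : ColNorm n A)
    (h20 : 20 ≤ aliveN n c.x) (hF : 2 * aliveN n c.x ≤ c.m ∨ FewStill n c) {B : ℝ}
    (hB : ∀ x θ, aliveN n x < 100 * badN n A x (aliveN n x) θ → 2 * θ ≤ B) (hcB : c.θ ≤ B) :
    (∃ Y', Inv n A (c.stage n A) Y') ∧ FewStill n (c.stage n A) ∧
      (c.stage n A).m < 2 * aliveN n c.x ∧ (c.stage n A).θ ≤ B ∧ (c.stage n A).x = c.x := by
  by_cases hst : c.m < 2 * aliveN n c.x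
  · have e : c.stage n A = c := if_pos hst
    rw [e]
    exact ⟨⟨Y, I⟩, hF.resolve_left (not_le.mpr hst), hst, hcB, rfl⟩
  have hn1 : 1 ≤ n := by omega
  have hn' : (20 : ℝ) ≤ n := by exact_mod_cast hn
  have hL := harm_ge_one hn1
  set m := aliveN n c.x with hm
  set θ := (thetaStep n A c.x m)^[3 * n + 2] c.θ with hθ
  have hθ0 : 0 ≤ c.θ := le_trans (by positivity) I.th₁
  have hθc : c.θ ≤ θ := iterate_thetaStep_mono hθ0 (Nat.zero_le _)
  have hθ1 : 1 / harm n ≤ θ := I.th₁.trans hθc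
  have hθpos : 0 < θ := lt_of_lt_of_le (by positivity) hθ1
  have hm0 : 0 ≤ m := by linarith
  have hmn : m ≤ n := aliveN_le n c.x
  have hθ2 : θ ≤ 2 * n := iterate_thetaStep_le
    (fun t ht => by have := hA.lt_of_bad hm0 ht; linarith) I.th₂ _
  have hθB : θ ≤ B := iterate_thetaStep_le (hB c.x) hcB _
  have hgood : 100 * badN n A c.x m θ ≤ m := by
    refine hA.iterate_thetaStep_good hm0 ?_ hn1
    refine le_trans ?_ I.th₁
    exact one_div_le_one_div_of_le (by linarith) (by linarith [harm_le hn])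
  have hmc : 2 * m ≤ c.m := not_lt.mp hst
  set c' := c.stage n A with hc'
  have ec : c' = { x := c.x
                   h := fun i => if 0 < c.lk i then c.h i else
                     whenAct n A c.x m θ i (newScale n A m θ i)
                   P := fun i => if 0 < c.lk i then c.P i * (m / (16 * c.m)) else
                     whenAct n A c.x m θ i (if θ < base n A m i then base n A m i else m / n)
                   M := fun i => if 0 < c.lk i then c.M i * (m / (16 * c.m)) else
                     whenAct n A c.x m θ i (if θ < base n A m i then base n A m i else m / n)
                   lk := fun i => if 0 < c.lk i then c.lk i else
                     whenAct n A c.x m θ i (if θ < base n A m i then 0 else 1)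
                   θ := θ
                   m := m } := if_neg hst
  clear_value c'
  have hratio0 : 0 ≤ m / (16 * c.m) := div_nonneg hm0 (by linarith)
  have hratio1 : m / (16 * c.m) ≤ 1 := by rw [div_le_one (by linarith)]; linarith
  have hbase0 : ∀ i, 0 ≤ base n A m i := base_nonneg hm0
  have hmn0 : 0 ≤ m / n := by positivity
  have hmn1 : m / n ≤ 1 := by rw [div_le_one (by linarith)]; exact hmn
  -- the possible new states of a row
  have hcases : ∀ i < n, (c.lk i = 1 ∧ c'.lk i = 1 ∧ c'.h i = c.h i ∧
        c'.P i = c.P i * (m / (16 * c.m)) ∧ c'.M i = c.M i * (m / (16 * c.m))) ∨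
      (c.lk i = 0 ∧ ((base n A m i + θ < aliveSq n A c.x i ∨ 100 < base n A m i) ∧
          c'.lk i = 0 ∧ c'.h i = 0 ∧ c'.P i = 0 ∧ c'.M i = 0 ∨
        aliveSq n A c.x i ≤ base n A m i + θ ∧ base n A m i ≤ 100 ∧
          c'.h i = newScale n A m θ i ∧
          (θ < base n A m i ∧ c'.lk i = 0 ∧ c'.P i = base n A m i ∧ c'.M i = base n A m i ∨
            ¬ θ < base n A m i ∧ c'.lk i = 1 ∧ c'.P i = m / n ∧ c'.M i = m / n))) := by
    intro i hi
    rcases I.rows i hi with ⟨h1, -⟩ | ⟨h1, -⟩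
    · right
      refine ⟨h1, ?_⟩
      have h0 : ¬ 0 < c.lk i := by rw [h1]; exact lt_irrefl 0
      simp only [ec, if_neg h0, whenAct]
      by_cases hb : base n A m i + θ < aliveSq n A c.x i
      · left; simp [hb]
      · by_cases hb' : 100 < base n A m i
        · left; simp [hb']
        · right
          simp only [hb, hb', if_false]
          refine ⟨not_lt.mp hb, not_lt.mp hb', trivial, ?_⟩
          by_cases hy : θ < base n A m i
          · left; simp [hy]
          · right; simp [hy]
    · left
      have h0 : 0 < c.lk i := by rw [h1]; exact one_pos
      simp only [ec, if_pos h0]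
      simp [h1]
  have ex : c'.x = c.x := by rw [ec]
  have em : c'.m = m := by rw [ec]
  have eθ : c'.θ = θ := by rw [ec]
  have hself : ∀ h' (i : ℕ), expo n h' (trunc A c'.h i) c'.x c.x = 0 := fun h' i => by
    rw [ex, expo_self]
  -- The stage size has at least halved, and the base energy with it.
  have hbound : ∀ i < n, c.lk i = 0 →
      |∑ j ∈ range n, A i j * c.x j| ≤ 4000 * (√√100 - √√(min (base n A m i) 100)) := by
    intro i hi h0
    refine (I.rows i hi).unlocked_bound h0 I.xb (I.cap i hi)
      (base_nonneg (by linarith) i) ?_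
    have : base n A m i = base n A (2 * m) i / 2 := by unfold base; ring
    rw [this]
    have hle : base n A (2 * m) i ≤ base n A c.m i := by
      unfold base
      have := rowSq_nonneg n A i
      gcongr
    linarith
  have hnn : ∀ i < n, 0 ≤ c'.P i ∧ 0 ≤ c'.M i ∧ 0 ≤ c'.h i ∧ c'.P i + c'.M i ≤ 2700 ∧
      c'.P i + c'.M i ≤ (c.P i + c.M i) * (m / (16 * c.m)) + (2 * base n A m i + 2 * (m / n)) := by
    intro i hi
    have hP := I.P0 i hi
    have hM := I.M0 i hi
    have hb := hbase0 i
    have hcap := I.cap i hi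
    have hr : 0 ≤ (c.P i + c.M i) * (m / (16 * c.m)) := by positivity
    have hr2 : (c.P i + c.M i) * (m / (16 * c.m)) ≤ c.P i + c.M i := by nlinarith
    rcases hcases i hi with ⟨-, -, h2, h3, h4⟩ | ⟨-, ⟨-, -, h2, h3, h4⟩ | ⟨-, h5, h2, h6⟩⟩
    · rw [h2, h3, h4]
      refine ⟨by positivity, by positivity, I.h0 i hi, by linarith, by linarith⟩
    · rw [h2, h3, h4]
      refine ⟨le_rfl, le_rfl, le_rfl, by norm_num, by linarith⟩
    · rcases h6 with ⟨h7, -, h3, h4⟩ | ⟨h7, -, h3, h4⟩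
      · rw [h2, h3, h4]
        exact ⟨hb, hb, (newScale_young hn hθ1 h7 h5).1.le, by linarith, by linarith⟩
      · rw [h2, h3, h4]
        exact ⟨hmn0, hmn0, (newScale_locked hn hθ1 h7 hθ2).1.le, by linarith, by linarith⟩
  have htr : ∀ i, c'.h i = c.h i → trunc A c'.h i = trunc A c.h i := by
    intro i hi
    funext j
    simp [trunc, hi]
  refine ⟨⟨c.x, ?_⟩, ?_, by rw [em]; linarith, by rw [eθ]; exact hθB, ex⟩
  · refine ⟨by rw [ex]; exact I.xb, I.xb, fun j _ _ => by rw [ex],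
      fun i hi => (hnn i hi).1, fun i hi => (hnn i hi).2.1, fun i hi => (hnn i hi).2.2.1, ?_,
      fun i hi => (hnn i hi).2.2.2.1, by rw [em], by rw [em]; linarith, by rw [eθ]; exact hθ1,
      by rw [eθ]; exact hθ2, ?_⟩
    · rw [ex, em, sub_self, mul_zero, add_zero]
      refine (sum_le_sum fun i hi => (hnn i (mem_range.mp hi)).2.2.2.2).trans ?_
      rw [sum_add_distrib, sum_add_distrib, ← sum_mul, ← mul_sum]
      have h1 := I.weight_le
      have h2 := hA.sum_base_le hm0 hn1
      have h3 : ∑ i ∈ range n, 2 * (m / n) = 2 * m := by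
        rw [sum_const, card_range, nsmul_eq_mul]; field_simp
      have h4 : (∑ i ∈ range n, (c.P i + c.M i)) * (m / (16 * c.m)) ≤
          9 * c.m * (m / (16 * c.m)) := by gcongr
      have h5 : 9 * c.m * (m / (16 * c.m)) = 9 / 16 * m := by
        have : c.m ≠ 0 := by linarith
        field_simp
      rw [h3]
      linarith
    · intro i hi
      rcases hcases i hi with ⟨h0, h1, h2, h3, h4⟩ | ⟨h0, ⟨-, h1, h2, -, -⟩ | ⟨h5, h6, h2, h7⟩⟩
      · rcases I.rows i hi with ⟨h6, -⟩ | ⟨-, y, θ', g1, g2, g3⟩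
        · rw [h0] at h6; norm_num at h6
        refine Or.inr ⟨h1, y, θ', by rw [eθ]; linarith, g2, ?_⟩
        have hW : (m / n) ^ 5 ≤ (c.m / n) ^ 5 * (m / (16 * c.m)) := by
          have hcm : 0 < c.m := by linarith
          have h6 : (2 * m) ^ 4 ≤ c.m ^ 4 := by gcongr
          have h8 : (c.m / n) ^ 5 * (m / (16 * c.m)) = c.m ^ 4 * m / (16 * (n : ℝ) ^ 5) := by
            field_simp
          rw [h8, div_pow, div_le_div_iff₀ (by positivity) (by positivity)]
          have h9 : m ^ 5 * 16 ≤ c.m ^ 4 * m := by nlinarith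
          have : 0 ≤ (n : ℝ) ^ 5 := by positivity
          nlinarith
        have hscale : ∀ E V : ℝ, (c.m / n) ^ 5 * Real.exp E ≤ V →
            (m / n) ^ 5 * Real.exp E ≤ V * (m / (16 * c.m)) := by
          intro E V hV
          calc (m / n) ^ 5 * Real.exp E ≤ (c.m / n) ^ 5 * (m / (16 * c.m)) * Real.exp E :=
                mul_le_mul_of_nonneg_right hW (Real.exp_pos _).le
            _ = (c.m / n) ^ 5 * Real.exp E * (m / (16 * c.m)) := by ring
            _ ≤ _ := mul_le_mul_of_nonneg_right hV hratio0
        refine ⟨by rw [h2]; exact g3.hpos, g3.yb, ?_, ?_, by rw [ex]; exact g3.agree, g3.energy,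
          g3.epos, by rw [em]; positivity, by rw [h2]; exact g3.scale₁,
          by rw [h2]; exact g3.scale₂⟩
        · rw [em, h2, ex, htr i h2, h3]; exact hscale _ _ g3.lowP
        · rw [em, h2, ex, htr i h2, h4]; exact hscale _ _ g3.lowM
      · exact Or.inl ⟨h1, by rw [em]; exact hbound i hi h0, Or.inl ⟨h2, by rw [ex]⟩⟩
      · rcases h7 with ⟨h8, h1, h3, h4⟩ | ⟨h8, h1, h3, h4⟩
        · obtain ⟨s1, s2, s3⟩ := newScale_young hn hθ1 h8 h6
          refine Or.inl ⟨h1, by rw [em]; exact hbound i hi h0, Or.inr ⟨by rw [em]; exact h6, ?_⟩⟩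
          rw [em]
          refine ⟨by rw [h2]; exact s1, I.xb, ?_, ?_, fun j _ _ => by rw [ex], by linarith,
            by linarith, by linarith, by rw [h2]; exact s2, by rw [h2]; exact s3⟩
          · rw [hself, Real.exp_zero, mul_one, h3]
          · rw [hself, Real.exp_zero, mul_one, h4]
        · obtain ⟨s1, s2, s3⟩ := newScale_locked hn hθ1 h8 hθ2
          have hbd := hbound i hi h0
          have hs := Real.sqrt_nonneg (√(min (base n A m i) 100))
          -- The lock records the current point and threshold; later thresholds are only larger.
          refine Or.inr ⟨h1, c.x, θ, by rw [eθ], hbd.trans (by nlinarith), ?_⟩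
          rw [em]
          have hpow : (m / n) ^ 5 ≤ m / n := by
            calc (m / n) ^ 5 ≤ (m / n) ^ 1 := pow_le_pow_of_le_one hmn0 hmn1 (by norm_num)
              _ = m / n := pow_one _
          refine ⟨by rw [h2]; exact s1, I.xb, ?_, ?_, fun j _ _ => by rw [ex], by linarith,
            hθpos, by positivity, by rw [h2]; exact s2, by rw [h2]; exact s3⟩
          · rw [hself, Real.exp_zero, mul_one, h3]; exact hpow
          · rw [hself, Real.exp_zero, mul_one, h4]; exact hpow
  -- A row stands still if it is in excess, which holds for at most `m / 100` rows by the choice of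
  -- `θ`, or if its base energy is above `100`, for at most `m / 100` rows by Markov.
  · unfold FewStill
    rw [em]
    have h1 := card_mul_le_sum (s := range n) (f := fun i => base n A m i)
      (fun i _ => hbase0 i) 100
    have h2 := hA.sum_base_le hm0 hn1
    have h3 : badN n A c.x m θ =
        ((range n).filter fun i => base n A m i + θ < aliveSq n A c.x i).card := by
      unfold badN; rw [sum_boole]
    have h4 : ((range n).filter fun i => c'.h i = 0).card ≤
        ((range n).filter fun i => base n A m i + θ < aliveSq n A c.x i).card +
        ((range n).filter fun i => 100 < base n A m i).card := by
      refine le_trans (card_le_card fun i hi => ?_) (card_union_le _ _)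
      obtain ⟨hi1, hi2⟩ := mem_filter.mp hi
      rw [mem_union, mem_filter, mem_filter]
      have hi' := mem_range.mp hi1
      rcases hcases i hi' with ⟨h0, -, g2, -, -⟩ | ⟨-, ⟨g, -⟩ | ⟨-, g6, g2, g7⟩⟩
      · exfalso
        rcases I.rows i hi' with ⟨h6, -⟩ | ⟨-, y, θ', -, -, g3⟩
        · rw [h0] at h6; norm_num at h6
        · rw [g2] at hi2; exact g3.hpos.ne' hi2
      · rcases g with g | g
        · exact Or.inl ⟨hi1, g⟩
        · exact Or.inr ⟨hi1, g⟩
      · exfalso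
        rw [g2] at hi2
        rcases g7 with ⟨g8, -⟩ | ⟨g8, -⟩
        · exact (newScale_young hn hθ1 g8 g6).1.ne' hi2
        · exact (newScale_locked hn hθ1 g8 hθ2).1.ne' hi2
    have h5 : (((range n).filter fun i => c'.h i = 0).card : ℝ) ≤
        ((range n).filter fun i => base n A m i + θ < aliveSq n A c.x i).card +
        ((range n).filter fun i => 100 < base n A m i).card := by exact_mod_cast h4
    linarith

end

/-! ### The algorithm as a loop program -/

instance : Add Tm := ⟨.add⟩
instance : Sub Tm := ⟨.sub⟩
instance : Mul Tm := ⟨.mul⟩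
instance : Div Tm := ⟨.div⟩

section
variable (M : Arr) (t u : Tm) (d : ℕ) (ρ : ℕ → ℕ)

@[simp] theorem eval_add : (t + u).eval M d ρ = t.eval M d ρ + u.eval M d ρ := rfl
@[simp] theorem eval_sub : (t - u).eval M d ρ = t.eval M d ρ - u.eval M d ρ := rfl
@[simp] theorem eval_mul : (t * u).eval M d ρ = t.eval M d ρ * u.eval M d ρ := rfl
@[simp] theorem eval_div : (t / u).eval M d ρ = t.eval M d ρ / u.eval M d ρ := rfl
@[simp] theorem eval_rat (q : ℚ) : (Tm.rat q).eval M d ρ = q := rfl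
@[simp] theorem eval_idx (e : IExpr) : (Tm.idx e).eval M d ρ = e.val ρ := rfl
@[simp] theorem eval_get (a : ℕ) (i j : IExpr) :
    (Tm.get a i j).eval M d ρ = M a (i.val ρ) (j.val ρ) := rfl
@[simp] theorem eval_ite (v w : Tm) : (Tm.ite t u v w).eval M d ρ =
    if t.eval M d ρ < u.eval M d ρ then v.eval M d ρ else w.eval M d ρ := by
  rw [Tm.eval]
@[simp] theorem eval_sum (b : Bd) : (Tm.sum b t).eval M d ρ =
    ∑ k ∈ range (b.val (ρ 0)), t.eval M (d + 1) (Function.update ρ (d + 1) k) := rfl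

end

theorem exec_seq (p q : Cmd) (d : ℕ) (ρ : ℕ → ℕ) (M : Arr) :
    (Cmd.seq p q).exec d ρ M = q.exec d ρ (p.exec d ρ M) := rfl

theorem exec_rep (b : Bd) (p : Cmd) (d : ℕ) (ρ : ℕ → ℕ) (M : Arr) : (Cmd.rep b p).exec d ρ M =
    iter (fun k => p.exec (d + 1) (Function.update ρ (d + 1) k)) M (b.val (ρ 0)) := rfl

theorem exec_map {M : Arr} {d : ℕ} {ρ : ℕ → ℕ} (a : ℕ) {b c : Bd} {t : Tm} {i j : ℕ}
    (hi : i < b.val (ρ 0)) (hj : j < c.val (ρ 0)) : (Cmd.map a b c t).exec d ρ M a i j =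
      t.eval M (d + 2) (Function.update (Function.update ρ (d + 1) i) (d + 2) j) := by
  simp [Cmd.exec, hi, hj]

theorem exec_map_ne {M : Arr} {d : ℕ} {ρ : ℕ → ℕ} {a a' : ℕ} (h : a' ≠ a) (b c : Bd) (t : Tm) :
    (Cmd.map a b c t).exec d ρ M a' = M a' := by
  simp [Cmd.exec, h]

/-- The entry `j` of a vector. -/
def ent (a j : ℕ) : Tm := .get a (.const 0) (.var j)
/-- A scalar. -/
def scal (a : ℕ) : Tm := .get a (.const 0) (.const 0)
/-- The entry `(i, j)` of a matrix. -/
def mat (a i j : ℕ) : Tm := .get a (.var i) (.var j)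
def cst (q : ℚ) : Tm := .rat q
def reg (v : ℕ) : Tm := .idx (.var v)

section
variable (M : Arr) (d : ℕ) (ρ : ℕ → ℕ)

@[simp] theorem eval_ent (a j : ℕ) : (ent a j).eval M d ρ = M a 0 (ρ j) := rfl
@[simp] theorem eval_scal (a : ℕ) : (scal a).eval M d ρ = M a 0 0 := rfl
@[simp] theorem eval_mat (a i j : ℕ) : (mat a i j).eval M d ρ = M a (ρ i) (ρ j) := rfl
@[simp] theorem eval_cst (q : ℚ) : (cst q).eval M d ρ = q := rfl
@[simp] theorem eval_reg (v : ℕ) : (reg v).eval M d ρ = ρ v := rfl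

end

/-- Arrays: `0` matrix, `1` point, `2` scales, `3` and `4` weights, `5` locks, `6` threshold, `7`
stage size, `8` harmonic number, then intermediate results. The body runs at depth `4`, so `map`
binds the registers `5` and `6`, and a sum in it binds `7`. Inside a further `rep`, which binds `5`,
these are one higher. -/
def aliveTm (j : ℕ) : Tm :=
  .ite (ent 1 j * ent 1 j) ((cst 1 - cst 1 / reg 0) * (cst 1 - cst 1 / reg 0)) (cst 1) (cst 0)
def aliveNCmd : Cmd := .map 9 .one .one (.sum .dim (aliveTm 7))
-- The decision to start a stage is stored before `sizeCmd` overwrites the size it depends on;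
-- `oldCmd` saves the old size for the rescaling of locked weights.
def flagCmd : Cmd := .map 10 .one .one (.ite (scal 7) (cst 2 * scal 9) (cst 0) (cst 1))
def oldCmd : Cmd := .map 11 .one .one (scal 7)
def sizeCmd : Cmd := .map 7 .one .one (.ite (cst 0) (scal 10) (scal 9) (scal 7))
def baseCmd : Cmd := .map 21 .one .dim
  (scal 7 / reg 0 * .sum .dim (mat 0 6 7 * mat 0 6 7))
def aliveSqCmd : Cmd := .map 22 .one .dim
  (.sum .dim (aliveTm 7 * (mat 0 6 7 * mat 0 6 7)))
def thetaCmd : Cmd := .map 6 .one .one (.ite (cst 0) (scal 10)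
  (.ite (scal 7) (cst 100 * .sum .dim (.ite (ent 21 8 + scal 6) (ent 22 8) (cst 1) (cst 0)))
    (scal 6 + scal 6) (scal 6)) (scal 6))
def whenTm (v : Tm) : Tm :=
  .ite (ent 21 6 + scal 6) (ent 22 6) (cst 0) (.ite (cst 100) (ent 21 6) (cst 0) v)
def stageTm (a : ℕ) (t v : Tm) : Tm :=
  .ite (cst 0) (scal 10) (.ite (cst 0) (ent 5 6) t (whenTm v)) (ent a 6)
def scaleCmd : Cmd := .map 2 .one .dim (stageTm 2 (ent 2 6) (scal 8 / .sum .big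
  (.ite (.ite (scal 6) (ent 21 6) (scal 8 * scal 8 * ent 21 6) (scal 8 * scal 6))
    (reg 7 * reg 7) (cst 0) (cst 1))))
def weightCmd (a : ℕ) : Cmd := .map a .one .dim (stageTm a
  (ent a 6 * (scal 7 / (cst 16 * scal 11)))
  (.ite (scal 6) (ent 21 6) (ent 21 6) (scal 7 / reg 0)))
def lockCmd : Cmd := .map 5 .one .dim (stageTm 5 (ent 5 6)
  (.ite (scal 6) (ent 21 6) (cst 0) (cst 1)))

def stageCmd : Cmd := .seq aliveNCmd <| .seq flagCmd <| .seq oldCmd <| .seq sizeCmd <|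
  .seq baseCmd <| .seq aliveSqCmd <| .seq (.rep .big thetaCmd) <| .seq scaleCmd <|
  .seq (weightCmd 3) <| .seq (weightCmd 4) lockCmd

def truncCmd : Cmd := .map 12 .dim .dim
  (.ite (cst (1 / 1024)) (ent 2 5 * ent 2 5 * (mat 0 5 6 * mat 0 5 6)) (cst 0) (mat 0 5 6))
def metricCmd : Cmd := .map 13 .one .dim
  (cst 1 + .sum .dim ((ent 3 7 + ent 4 7) * (ent 2 7 * ent 2 7) * (mat 12 7 6 * mat 12 7 6)))
def slopeCmd : Cmd := .map 24 .one .dim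
  (.sum .dim ((ent 3 7 - ent 4 7) * ent 2 7 * mat 12 7 6 -
    cst 16 * (ent 2 7 * ent 2 7) * (ent 3 7 + ent 4 7) * (mat 12 7 6 * mat 12 7 6 * ent 1 6)))
def protTm (i : IExpr) : Tm :=
  .ite (cst 0) (.get 2 (.const 0) i)
    (.ite (cst 900) (.get 3 (.const 0) i + .get 4 (.const 0) i) (cst 1) (cst 0)) (cst 1)
def conVecCmd : Cmd := .map 14 .big .dim (aliveTm 6 *
  .ite (reg 5) (reg 0) (protTm (.var 5) * mat 12 5 6 / ent 13 6)
    (.ite (reg 5) (reg 0 + reg 0) (protTm (.sub (.var 5) (.var 0)) *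
        (.get 12 (.sub (.var 5) (.var 0)) (.var 6) * .get 12 (.sub (.var 5) (.var 0)) (.var 6) *
          ent 1 6) / ent 13 6)
      (.ite (reg 5) (reg 0 + reg 0 + cst 1) (ent 1 6 / ent 13 6)
        (.ite (reg 5) (reg 0 + reg 0 + cst 2) (ent 24 6 / ent 13 6)
          (.ite (reg 5) (reg 0 + reg 0 + cst 2 + reg 6) (cst 0)
            (.ite (reg 0 + reg 0 + cst 2 + reg 6) (reg 5) (cst 0) (cst 1)))))))
-- Only the row whose number is the counter of the enclosing `rep`, in register `5`, is rewritten;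
-- the two comparisons test equality.
def orthCmd : Cmd := .map 15 .big .dim (.ite (reg 6) (reg 5) (mat 15 6 7)
  (.ite (reg 5) (reg 6) (mat 15 6 7) (mat 14 5 7 - .sum .big (.ite (reg 8) (reg 5)
    (.sum .dim (ent 13 9 * mat 14 5 9 * mat 15 8 9) /
      .sum .dim (ent 13 9 * mat 15 8 9 * mat 15 8 9) * mat 15 8 7) (cst 0)))))
def quadTm : Tm := .sum .dim ((ent 3 7 + ent 4 7) * (cst 2 * (ent 2 7 * ent 2 7) *
    (.sum .dim (mat 12 7 8 * mat 15 6 8) * .sum .dim (mat 12 7 8 * mat 15 6 8)) +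
  cst 1024 * (ent 2 7 * ent 2 7 * (ent 2 7 * ent 2 7)) *
    (.sum .dim (mat 12 7 8 * mat 12 7 8 * ent 1 8 * mat 15 6 8) *
      .sum .dim (mat 12 7 8 * mat 12 7 8 * ent 1 8 * mat 15 6 8))))
def goodCmd : Cmd := .map 16 .one .big (.ite (reg 6) (reg 0 + reg 0 + cst 2) (cst 0)
  (.ite (cst 0) (.sum .dim (ent 13 7 * mat 15 6 7 * mat 15 6 7))
    (.ite (cst 4 * .sum .dim (ent 13 7 * mat 15 6 7 * mat 15 6 7)) quadTm (cst 0) (cst 1))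
    (cst 0)))
def pickCmd : Cmd := .map 17 .one .dim (.sum .big (.ite (cst 0)
  (.sum .big (.ite (reg 8) (reg 7) (ent 16 8) (cst 0))) (cst 0) (ent 16 7) * mat 15 7 6))
def normalizeCmd : Cmd := .map 18 .one .dim (.ite (.sum .dim (aliveTm 7)) (cst 20) (cst 0)
  (ent 17 6 / .sum .dim (.ite (ent 17 7) (cst 0) (cst 0 - ent 17 7) (ent 17 7))))

def dirCmd : Cmd := .seq truncCmd <| .seq metricCmd <| .seq slopeCmd <| .seq conVecCmd <|
  .seq (.rep .big orthCmd) <| .seq goodCmd <| .seq pickCmd normalizeCmd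

/-! ### The loop program computes the intended quantities -/

/-- The memory `M` holds the matrix `A` and the configuration `c`. -/
structure Rep (n : ℕ) (A : ℕ → ℕ → ℝ) (c : Cfg) (M : Arr) : Prop where
  mat_eq : ∀ i < n, ∀ j < n, M 0 i j = A i j
  x_eq : ∀ j < n, M 1 0 j = c.x j
  h_eq : ∀ i < n, M 2 0 i = c.h i
  P_eq : ∀ i < n, M 3 0 i = c.P i
  M_eq : ∀ i < n, M 4 0 i = c.M i
  lk_eq : ∀ i < n, M 5 0 i = c.lk i
  θ_eq : M 6 0 0 = c.θ
  m_eq : M 7 0 0 = c.m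
  harm_eq : M 8 0 0 = harm n

section
variable {n : ℕ} {A : ℕ → ℕ → ℝ} {c : Cfg} {M M' : Arr} {d : ℕ} {ρ : ℕ → ℕ}

theorem Rep.frame (R : Rep n A c M) (h : ∀ a ≤ 8, M' a = M a) : Rep n A c M' := by
  constructor
  · rw [h 0 (by norm_num)]; exact R.mat_eq
  · rw [h 1 (by norm_num)]; exact R.x_eq
  · rw [h 2 (by norm_num)]; exact R.h_eq
  · rw [h 3 (by norm_num)]; exact R.P_eq
  · rw [h 4 (by norm_num)]; exact R.M_eq
  · rw [h 5 (by norm_num)]; exact R.lk_eq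
  · rw [h 6 (by norm_num)]; exact R.θ_eq
  · rw [h 7 (by norm_num)]; exact R.m_eq
  · rw [h 8 (by norm_num)]; exact R.harm_eq

theorem Rep.eval_aliveTm (R : Rep n A c M) (h0 : ρ 0 = n) {v : ℕ} (hv : ρ v < n) :
    (aliveTm v).eval M d ρ = aliveR n c.x (ρ v) := by
  simp [aliveTm, aliveR, R.x_eq _ hv, h0]

theorem Rep.eval_aliveN (R : Rep n A c M) (h0 : ρ 0 = n) :
    (Tm.sum .dim (aliveTm (d + 1))).eval M d ρ = aliveN n c.x := by
  rw [eval_sum]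
  simp only [Bd.val, h0, aliveN]
  refine sum_congr rfl fun k hk => ?_
  rw [R.eval_aliveTm] <;> simp [h0, mem_range.mp hk]

theorem Rep.eval_base (R : Rep n A c M) (h0 : ρ 0 = n) (h6 : ρ 6 < n) :
    (scal 7 / reg 0 * Tm.sum .dim (mat 0 6 7 * mat 0 6 7)).eval M 6 ρ =
      base n A c.m (ρ 6) := by
  simp [Bd.val, h0, base, rowSq, R.m_eq]
  left
  refine sum_congr rfl fun k hk => ?_
  rw [R.mat_eq _ h6 _ (mem_range.mp hk)]

theorem Rep.eval_aliveSq (R : Rep n A c M) (h0 : ρ 0 = n) (h6 : ρ 6 < n) :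
    (Tm.sum .dim (aliveTm 7 * (mat 0 6 7 * mat 0 6 7))).eval M 6 ρ =
      aliveSq n A c.x (ρ 6) := by
  rw [eval_sum]
  simp only [Bd.val, h0, aliveSq]
  refine sum_congr rfl fun k hk => ?_
  have hk' := mem_range.mp hk
  rw [eval_mul, R.eval_aliveTm] <;> simp [h0, hk', R.mat_eq _ h6 _ hk']

/-- The base energies and the energies are stored. -/
structure Energies (n : ℕ) (A : ℕ → ℕ → ℝ) (c : Cfg) (M : Arr) : Prop where
  base_eq : ∀ i < n, M 21 0 i = base n A c.m i
  sq_eq : ∀ i < n, M 22 0 i = aliveSq n A c.x i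

theorem Energies.eval_badN (E : Energies n A c M) (h0 : ρ 0 = n) (hθ : M 6 0 0 = c.θ) :
    (Tm.sum .dim (.ite (ent 21 8 + scal 6) (ent 22 8) (cst 1) (cst 0))).eval M 7 ρ =
      badN n A c.x c.m c.θ := by
  rw [eval_sum]
  simp only [Bd.val, h0, badN]
  refine sum_congr rfl fun k hk => ?_
  have hk' := mem_range.mp hk
  simp [E.base_eq _ hk', E.sq_eq _ hk', hθ]

theorem Energies.eval_whenTm (E : Energies n A c M) (h6 : ρ 6 < n) (hθ : M 6 0 0 = c.θ) (t : Tm) :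
    (whenTm t).eval M 6 ρ = whenAct n A c.x c.m c.θ (ρ 6) (t.eval M 6 ρ) := by
  simp [whenTm, whenAct, E.base_eq _ h6, E.sq_eq _ h6, hθ]

theorem Energies.eval_newScale (E : Energies n A c M) (h0 : ρ 0 = n) (h6 : ρ 6 < n)
    (hθ : M 6 0 0 = c.θ) (hL : M 8 0 0 = harm n) :
    (scal 8 / Tm.sum .big (.ite (.ite (scal 6) (ent 21 6) (scal 8 * scal 8 * ent 21 6)
      (scal 8 * scal 6)) (reg 7 * reg 7) (cst 0) (cst 1))).eval M 6 ρ =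
      newScale n A c.m c.θ (ρ 6) := by
  simp [newScale, rootN, Bd.val, h0, E.base_eq _ h6, hθ, hL]

theorem Energies.iterate_theta (E : Energies n A c M) (hθ : M 6 0 0 = c.θ) (hm : M 7 0 0 = c.m)
    (h0 : ρ 0 = n) (k : ℕ) :
    let M' := iter (fun k => thetaCmd.exec 5 (Function.update ρ 5 k)) M k
    (M' 6 0 0 = if 0 < M 10 0 0 then (thetaStep n A c.x c.m)^[k] c.θ else c.θ) ∧
      ∀ a ≠ 6, M' a = M a := by
  induction k with
  | zero => exact ⟨by simp [iter, hθ], fun _ _ => rfl⟩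
  | succ k ih =>
    simp only [iter]
    obtain ⟨h1, h2⟩ := ih
    generalize iter (fun k => thetaCmd.exec 5 (Function.update ρ 5 k)) M k = M₁ at *
    refine ⟨?_, fun a ha => by rw [thetaCmd, exec_map_ne ha, h2 a ha]⟩
    rw [thetaCmd, exec_map _ (by simp [Bd.val]) (by simp [Bd.val]), eval_ite]
    simp only [eval_cst, eval_scal, h2 10 (by norm_num), Rat.cast_zero]
    split_ifs with hf
    · rw [if_pos hf] at h1
      have E' : Energies n A { c with θ := (thetaStep n A c.x c.m)^[k] c.θ } M₁ :=
        ⟨by rw [h2 21 (by norm_num)]; exact E.base_eq,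
          by rw [h2 22 (by norm_num)]; exact E.sq_eq⟩
      rw [eval_ite, eval_mul, E'.eval_badN (by simp [h0]) h1, Function.iterate_succ_apply']
      simp [thetaStep, h2 7, hm, h1]
    · rw [if_neg hf] at h1
      exact h1

theorem Rep.stage (R : Rep n A c M) (h0 : ρ 0 = n) :
    Rep n A (c.stage n A) (stageCmd.exec 4 ρ M) := by
  have b1 : (0 : ℕ) < Bd.one.val (ρ 0) := Nat.one_pos
  have bn : ∀ {i}, i < n → i < Bd.dim.val (ρ 0) := fun h => by simpa [Bd.val, h0] using h
  unfold stageCmd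
  simp only [exec_seq]
  -- the size of the stage
  have f1 : ∀ a ≠ 9, aliveNCmd.exec 4 ρ M a = M a := fun a ha => exec_map_ne ha _ _ _
  have e1 : aliveNCmd.exec 4 ρ M 9 0 0 = aliveN n c.x := by
    rw [aliveNCmd, exec_map _ b1 b1, R.eval_aliveN (by simp [h0])]
  generalize aliveNCmd.exec 4 ρ M = M₁ at *
  have R1 : Rep n A c M₁ := R.frame fun a ha => f1 a (by omega)
  have f2 : ∀ a ≠ 10, flagCmd.exec 4 ρ M₁ a = M₁ a := fun a ha => exec_map_ne ha _ _ _
  have e2 : flagCmd.exec 4 ρ M₁ 10 0 0 = if c.m < 2 * aliveN n c.x then 0 else 1 := by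
    rw [flagCmd, exec_map _ b1 b1]
    simp [R1.m_eq, e1]
  generalize flagCmd.exec 4 ρ M₁ = M₂ at *
  have R2 : Rep n A c M₂ := R1.frame fun a ha => f2 a (by omega)
  have f3 : ∀ a ≠ 11, oldCmd.exec 4 ρ M₂ a = M₂ a := fun a ha => exec_map_ne ha _ _ _
  have e3 : oldCmd.exec 4 ρ M₂ 11 0 0 = c.m := by
    rw [oldCmd, exec_map _ b1 b1]
    simp [R2.m_eq]
  generalize oldCmd.exec 4 ρ M₂ = M₃ at *
  have R3 : Rep n A c M₃ := R2.frame fun a ha => f3 a (by omega)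
  have f4 : ∀ a ≠ 7, sizeCmd.exec 4 ρ M₃ a = M₃ a := fun a ha => exec_map_ne ha _ _ _
  have e4 : sizeCmd.exec 4 ρ M₃ 7 0 0 =
      if c.m < 2 * aliveN n c.x then c.m else aliveN n c.x := by
    rw [sizeCmd, exec_map _ b1 b1]
    simp only [eval_ite, eval_cst, eval_scal, R3.m_eq, f3 10 (by norm_num), e2, f3 9 (by norm_num),
      f2 9 (by norm_num), e1]
    split_ifs <;> simp_all
  generalize sizeCmd.exec 4 ρ M₃ = M₄ at *
  set m := if c.m < 2 * aliveN n c.x then c.m else aliveN n c.x with hm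
  have R4 : Rep n A { c with m := m } M₄ := by
    constructor
    · rw [f4 0 (by norm_num)]; exact R3.mat_eq
    · rw [f4 1 (by norm_num)]; exact R3.x_eq
    · rw [f4 2 (by norm_num)]; exact R3.h_eq
    · rw [f4 3 (by norm_num)]; exact R3.P_eq
    · rw [f4 4 (by norm_num)]; exact R3.M_eq
    · rw [f4 5 (by norm_num)]; exact R3.lk_eq
    · rw [f4 6 (by norm_num)]; exact R3.θ_eq
    · exact e4
    · rw [f4 8 (by norm_num)]; exact R3.harm_eq
  -- the energies
  have f5 : ∀ a ≠ 21, baseCmd.exec 4 ρ M₄ a = M₄ a := fun a ha => exec_map_ne ha _ _ _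
  have e5 : ∀ i < n, baseCmd.exec 4 ρ M₄ 21 0 i = base n A m i := fun i hi => by
    rw [baseCmd, exec_map _ b1 (bn hi), R4.eval_base] <;> simp [h0, hi]
  generalize baseCmd.exec 4 ρ M₄ = M₅ at *
  have R5 : Rep n A { c with m := m } M₅ := R4.frame fun a ha => f5 a (by omega)
  have f6 : ∀ a ≠ 22, aliveSqCmd.exec 4 ρ M₅ a = M₅ a := fun a ha => exec_map_ne ha _ _ _
  have e6 : ∀ i < n, aliveSqCmd.exec 4 ρ M₅ 22 0 i = aliveSq n A c.x i := fun i hi => by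
    rw [aliveSqCmd, exec_map _ b1 (bn hi), R5.eval_aliveSq] <;> simp [h0, hi]
  generalize aliveSqCmd.exec 4 ρ M₅ = M₆ at *
  have R6 : Rep n A { c with m := m } M₆ := R5.frame fun a ha => f6 a (by omega)
  have E6 : Energies n A { c with m := m } M₆ :=
    ⟨by rw [f6 21 (by norm_num)]; exact e5, e6⟩
  have f10 : M₆ 10 0 0 = if c.m < 2 * aliveN n c.x then 0 else 1 := by
    rw [f6 _ (by norm_num), f5 _ (by norm_num), f4 _ (by norm_num), f3 _ (by norm_num), e2]
  have f11 : M₆ 11 0 0 = c.m := by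
    rw [f6 _ (by norm_num), f5 _ (by norm_num), f4 _ (by norm_num), e3]
  -- the threshold
  obtain ⟨e7, f7⟩ := E6.iterate_theta R6.θ_eq R6.m_eq h0 (3 * n + 2)
  rw [exec_rep]
  simp only [Bd.val, h0]
  generalize iter (fun k => thetaCmd.exec 5 (Function.update ρ 5 k)) M₆ (3 * n + 2) = M₇ at *
  rw [f10] at e7
  replace f10 := (congrFun (congrFun (f7 10 (by norm_num)) 0) 0).trans f10
  replace f11 := (congrFun (congrFun (f7 11 (by norm_num)) 0) 0).trans f11
  simp only at e7
  set θ := if (0 : ℝ) < if c.m < 2 * aliveN n c.x then 0 else 1 then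
    (thetaStep n A c.x m)^[3 * n + 2] c.θ else c.θ with hθ
  have E7 : Energies n A { c with m := m, θ := θ } M₇ :=
    ⟨by rw [f7 21 (by norm_num)]; exact E6.base_eq, by rw [f7 22 (by norm_num)]; exact E6.sq_eq⟩
  have R7 : Rep n A { c with m := m, θ := θ } M₇ := by
    constructor
    · rw [f7 0 (by norm_num)]; exact R6.mat_eq
    · rw [f7 1 (by norm_num)]; exact R6.x_eq
    · rw [f7 2 (by norm_num)]; exact R6.h_eq
    · rw [f7 3 (by norm_num)]; exact R6.P_eq
    · rw [f7 4 (by norm_num)]; exact R6.M_eq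
    · rw [f7 5 (by norm_num)]; exact R6.lk_eq
    · exact e7
    · rw [f7 7 (by norm_num)]; exact R6.m_eq
    · rw [f7 8 (by norm_num)]; exact R6.harm_eq
  -- the rows
  have key : ∀ (N : Arr), Energies n A { c with m := m, θ := θ } N → N 6 0 0 = θ →
      N 10 0 0 = (if c.m < 2 * aliveN n c.x then 0 else 1) → (∀ i < n, N 5 0 i = c.lk i) →
      ∀ (a : ℕ) (t v : Tm) (i : ℕ), i < n → (Cmd.map a .one .dim (stageTm a t v)).exec 4 ρ N a 0 i =
        if c.m < 2 * aliveN n c.x then N a 0 i else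
          if 0 < c.lk i then t.eval N 6 (Function.update (Function.update ρ 5 0) 6 i) else
            whenAct n A c.x m θ i (v.eval N 6 (Function.update (Function.update ρ 5 0) 6 i)) := by
    intro N E hN6 hN10 hN5 a t v i hi
    rw [exec_map _ b1 (bn hi)]
    simp only [stageTm, eval_ite]
    rw [E.eval_whenTm (by simpa using hi) hN6]
    simp only [eval_cst, eval_scal, eval_ent, Rat.cast_zero, hN10, Function.update_self, hN5 i hi]
    by_cases hst : c.m < 2 * aliveN n c.x
    · simp [hst]
    · simp only [hst, if_false, zero_lt_one, if_true]
  set V := fun i => if θ < base n A m i then base n A m i else m / n with hV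
  have f8 : ∀ a ≠ 2, scaleCmd.exec 4 ρ M₇ a = M₇ a := fun a ha => exec_map_ne ha _ _ _
  have e8 : ∀ i < n, scaleCmd.exec 4 ρ M₇ 2 0 i = if c.m < 2 * aliveN n c.x then c.h i else
      if 0 < c.lk i then c.h i else whenAct n A c.x m θ i (newScale n A m θ i) := fun i hi => by
    rw [scaleCmd, key M₇ E7 e7 f10 R7.lk_eq _ _ _ i hi, E7.eval_newScale (by simp [h0])
      (by simpa using hi) e7 R7.harm_eq]
    simp [R7.h_eq i hi]
  generalize scaleCmd.exec 4 ρ M₇ = M₈ at *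
  -- This serves both weights: among the arrays `2`, `3`, `4`, the command for one weight reads only
  -- its own, so earlier overwriting is harmless.
  have key' : ∀ (N : Arr) (a : ℕ) (C : ℕ → ℝ), (∀ b, b ≠ 2 → b ≠ 3 → b ≠ 4 → N b = M₇ b) →
      (∀ i < n, N a 0 i = C i) → ∀ i < n, (weightCmd a).exec 4 ρ N a 0 i =
        if c.m < 2 * aliveN n c.x then C i else if 0 < c.lk i then C i * (m / (16 * c.m)) else
          whenAct n A c.x m θ i (V i) := by
    intro N a C hN hC i hi
    have E : Energies n A { c with m := m, θ := θ } N :=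
      ⟨by rw [hN 21 (by norm_num) (by norm_num) (by norm_num)]; exact E7.base_eq,
        by rw [hN 22 (by norm_num) (by norm_num) (by norm_num)]; exact E7.sq_eq⟩
    have g6 : N 6 0 0 = θ := by rw [hN 6 (by norm_num) (by norm_num) (by norm_num)]; exact e7
    have g7 : N 7 0 0 = m := by rw [hN 7 (by norm_num) (by norm_num) (by norm_num)]; exact R7.m_eq
    have g11 : N 11 0 0 = c.m := by rw [hN 11 (by norm_num) (by norm_num) (by norm_num)]; exact f11
    rw [weightCmd, key N E g6 (by rw [hN 10 (by norm_num) (by norm_num) (by norm_num)]; exact f10)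
      (by rw [hN 5 (by norm_num) (by norm_num) (by norm_num)]; exact R7.lk_eq) _ _ _ i hi]
    simp [hC i hi, g6, g7, g11, E.base_eq i hi, h0, hV]
  have f9 : ∀ a ≠ 3, (weightCmd 3).exec 4 ρ M₈ a = M₈ a := fun a ha => exec_map_ne ha _ _ _
  have e9 := key' M₈ 3 c.P (fun b hb _ _ => f8 b hb)
    (by rw [f8 3 (by norm_num)]; exact R7.P_eq)
  generalize (weightCmd 3).exec 4 ρ M₈ = M₉ at *
  have g10 : ∀ a ≠ 4, (weightCmd 4).exec 4 ρ M₉ a = M₉ a := fun a ha => exec_map_ne ha _ _ _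
  have e10 := key' M₉ 4 c.M (fun b hb hb' _ => by rw [f9 b hb', f8 b hb])
    (by rw [f9 4 (by norm_num), f8 4 (by norm_num)]; exact R7.M_eq)
  generalize (weightCmd 4).exec 4 ρ M₉ = M₁₀ at *
  have g11 : ∀ a ≠ 5, lockCmd.exec 4 ρ M₁₀ a = M₁₀ a := fun a ha => exec_map_ne ha _ _ _
  have hN : ∀ b, b ≠ 2 → b ≠ 3 → b ≠ 4 → M₁₀ b = M₇ b := fun b h2 h3 h4 => by
    rw [g10 b h4, f9 b h3, f8 b h2]
  have e11 : ∀ i < n, lockCmd.exec 4 ρ M₁₀ 5 0 i = if c.m < 2 * aliveN n c.x then c.lk i else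
      if 0 < c.lk i then c.lk i else
        whenAct n A c.x m θ i (if θ < base n A m i then 0 else 1) := fun i hi => by
    have E : Energies n A { c with m := m, θ := θ } M₁₀ :=
      ⟨by rw [hN 21 (by norm_num) (by norm_num) (by norm_num)]; exact E7.base_eq,
        by rw [hN 22 (by norm_num) (by norm_num) (by norm_num)]; exact E7.sq_eq⟩
    have g6 : M₁₀ 6 0 0 = θ := by rw [hN 6 (by norm_num) (by norm_num) (by norm_num)]; exact e7
    have g5 : ∀ i < n, M₁₀ 5 0 i = c.lk i := by
      rw [hN 5 (by norm_num) (by norm_num) (by norm_num)]; exact R7.lk_eq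
    rw [lockCmd, key M₁₀ E g6 (by rw [hN 10 (by norm_num) (by norm_num) (by norm_num)]; exact f10)
      g5 _ _ _ i hi]
    simp [g5 i hi, g6, E.base_eq i hi]
  generalize lockCmd.exec 4 ρ M₁₀ = M₁₁ at *
  have hN' : ∀ b, b ≠ 2 → b ≠ 3 → b ≠ 4 → b ≠ 5 → M₁₁ b = M₇ b := fun b h2 h3 h4 h5 => by
    rw [g11 b h5, hN b h2 h3 h4]
  have e8' : ∀ i, M₁₁ 2 0 i = M₈ 2 0 i := fun i => by
    rw [g11 2 (by norm_num), g10 2 (by norm_num), f9 2 (by norm_num)]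
  have e9' : ∀ i, M₁₁ 3 0 i = M₉ 3 0 i := fun i => by
    rw [g11 3 (by norm_num), g10 3 (by norm_num)]
  have e10' : ∀ i, M₁₁ 4 0 i = M₁₀ 4 0 i := fun i => by rw [g11 4 (by norm_num)]
  clear key key' f1 e1 f2 e2 f3 e3 f4 e4 R4 E7
  have q0 : M₁₁ 0 = M₇ 0 := hN' 0 (by norm_num) (by norm_num) (by norm_num) (by norm_num)
  have q1 : M₁₁ 1 = M₇ 1 := hN' 1 (by norm_num) (by norm_num) (by norm_num) (by norm_num)
  have q6 : M₁₁ 6 = M₇ 6 := hN' 6 (by norm_num) (by norm_num) (by norm_num) (by norm_num)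
  have q7 : M₁₁ 7 = M₇ 7 := hN' 7 (by norm_num) (by norm_num) (by norm_num) (by norm_num)
  have q8 : M₁₁ 8 = M₇ 8 := hN' 8 (by norm_num) (by norm_num) (by norm_num) (by norm_num)
  by_cases hst : c.m < 2 * aliveN n c.x
  · simp only [hst, if_true, lt_irrefl, if_false] at e8 e9 e10 e11 hm hθ
    rw [Cfg.stage, if_pos hst]
    exact ⟨q0 ▸ R7.mat_eq, q1 ▸ R7.x_eq, fun i hi => (e8' i).trans (e8 i hi),
      fun i hi => (e9' i).trans (e9 i hi), fun i hi => (e10' i).trans (e10 i hi), e11,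
      by rw [q6, e7, hθ], by rw [q7, R7.m_eq]; exact hm, by rw [q8]; exact R7.harm_eq⟩
  · simp only [hst, if_true, zero_lt_one, if_false] at e8 e9 e10 e11 hm hθ
    rw [Cfg.stage, if_neg hst]
    rw [hm] at hθ e8 e9 e10 e11
    rw [hθ] at e8 e9 e10 e11
    simp only [hV, hm, hθ] at e9 e10
    exact ⟨q0 ▸ R7.mat_eq, q1 ▸ R7.x_eq, fun i hi => (e8' i).trans (e8 i hi),
      fun i hi => (e9' i).trans (e9 i hi), fun i hi => (e10' i).trans (e10 i hi), e11,
      by rw [q6, e7, hθ], by rw [q7, R7.m_eq]; exact hm, by rw [q8]; exact R7.harm_eq⟩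

end

section
variable {n : ℕ} {A : ℕ → ℕ → ℝ} {c : Cfg} {M M' : Arr} {d : ℕ} {ρ : ℕ → ℕ}

theorem Rep.eval_truncCmd (R : Rep n A c M) (h0 : ρ 0 = n) {i j : ℕ} (hi : i < n) (hj : j < n) :
    truncCmd.exec 4 ρ M 12 i j = trunc A c.h i j := by
  rw [truncCmd, exec_map _ (by simpa [Bd.val, h0]) (by simpa [Bd.val, h0])]
  simp [trunc, R.h_eq i hi, R.mat_eq i hi j hj]

/-- The memory holds the truncated matrix `a`. -/
def HoldsMat (n : ℕ) (a : ℕ → ℕ → ℝ) (M : Arr) : Prop := ∀ i < n, ∀ j < n, M 12 i j = a i j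

theorem Rep.eval_metricCmd (R : Rep n A c M) (h0 : ρ 0 = n) {a : ℕ → ℕ → ℝ}
    (ha : HoldsMat n a M) {j : ℕ} (hj : j < n) :
    metricCmd.exec 4 ρ M 13 0 j = metric n a c.h c.P c.M j := by
  rw [metricCmd, exec_map _ (by simp [Bd.val]) (by simpa [Bd.val, h0]), metric, eval_add,
    eval_sum]
  congr 1
  · simp
  · simp only [Bd.val]
    refine sum_congr (by simp [h0]) fun i hi => ?_
    have hi' : i < n := by simpa [h0] using hi
    simp [R.h_eq i hi', R.P_eq i hi', R.M_eq i hi', ha i hi' j hj]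

theorem Rep.eval_slopeCmd (R : Rep n A c M) (h0 : ρ 0 = n) {a : ℕ → ℕ → ℝ}
    (ha : HoldsMat n a M) {j : ℕ} (hj : j < n) :
    slopeCmd.exec 4 ρ M 24 0 j = slope n a c.x c.h c.P c.M j := by
  rw [slopeCmd, exec_map _ (by simp [Bd.val]) (by simpa [Bd.val, h0]), slope, eval_sum]
  simp only [Bd.val]
  refine sum_congr (by simp [h0]) fun i hi => ?_
  have hi' : i < n := by simpa [h0] using hi
  simp [R.h_eq i hi', R.P_eq i hi', R.M_eq i hi', R.x_eq j hj, ha i hi' j hj]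

theorem Rep.eval_protTm (R : Rep n A c M) {e : IExpr} (he : e.val ρ < n) :
    (protTm e).eval M d ρ = prot c.h c.P c.M (e.val ρ) := by
  simp [protTm, prot, R.h_eq _ he, R.P_eq _ he, R.M_eq _ he]

theorem Rep.eval_conVecCmd (R : Rep n A c M) (h0 : ρ 0 = n) {a : ℕ → ℕ → ℝ} {D : ℕ → ℝ}
    (ha : HoldsMat n a M) (hD : ∀ j < n, M 13 0 j = D j)
    (hs : ∀ j < n, M 24 0 j = slope n a c.x c.h c.P c.M j) {k j : ℕ} (hk : k < 3 * n + 2)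
    (hj : j < n) : conVecCmd.exec 4 ρ M 14 k j = conVec n a c.x c.h c.P c.M D k j := by
  rw [conVecCmd, exec_map _ (by simpa [Bd.val, h0]) (by simpa [Bd.val, h0]), eval_mul,
    R.eval_aliveTm (by simp [h0]) (by simpa), conVec]
  simp only [eval_ite, eval_reg, eval_add, eval_cst]
  have q0 : Function.update (Function.update ρ (4 + 1) k) (4 + 2) j 0 = n := by simp [h0]
  have q5 : Function.update (Function.update ρ (4 + 1) k) (4 + 2) j 5 = k := by simp
  have q6 : Function.update (Function.update ρ (4 + 1) k) (4 + 2) j 6 = j := by simp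
  generalize Function.update (Function.update ρ (4 + 1) k) (4 + 2) j = ρ' at *
  simp only [q0, q5, q6, Rat.cast_one, Rat.cast_ofNat, Rat.cast_zero]
  congr 1
  split_ifs with h1 h2 h3 h4
  · have : k < n := by exact_mod_cast h1
    rw [eval_div, eval_mul, R.eval_protTm (by simpa [q5])]
    simp [q5, q6, ha k this j hj, hD j hj]
  · have h1' : n ≤ k := by exact_mod_cast not_lt.mp h1
    have h2' : k < n + n := by exact_mod_cast h2
    have : k - n < n := by omega
    rw [eval_div, eval_mul, R.eval_protTm (by simpa [q5, q0])]
    simp [q0, q5, q6, ha _ this j hj, hD j hj, R.x_eq j hj]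
  · simp [q6, hD j hj, R.x_eq j hj]
  · simp [q6, hD j hj, hs j hj]
  · rfl
  · rfl
  · rfl

/-- Each row depends only on earlier rows, which no later pass changes. -/
theorem iterate_orthCmd (h0 : ρ 0 = n) {D : ℕ → ℝ} {V : ℕ → ℕ → ℝ}
    (hD : ∀ j < n, M 13 0 j = D j) (hV : ∀ k < 3 * n + 2, ∀ j < n, M 14 k j = V k j) {k : ℕ}
    (hk : k ≤ 3 * n + 2) :
    let M' := iter (fun k => orthCmd.exec 5 (Function.update ρ 5 k)) M k
    IsOrthogonalization n k D V (M' 15) ∧ ∀ a ≠ 15, M' a = M a := by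
  induction k with
  | zero => exact ⟨fun k hk => absurd hk (Nat.not_lt_zero k), fun _ _ => rfl⟩
  | succ k ih =>
    obtain ⟨h1, h2⟩ := ih (by omega)
    simp only [iter]
    generalize iter (fun k => orthCmd.exec 5 (Function.update ρ 5 k)) M k = N at *
    refine ⟨?_, fun a ha => by rw [orthCmd, exec_map_ne ha, h2 a ha]⟩
    have hsame : ∀ l ≠ k, ∀ j, orthCmd.exec 5 (Function.update ρ 5 k) N 15 l j = N 15 l j := by
      intro l hl j
      by_cases hlj : l < 3 * n + 2 ∧ j < n
      · rw [orthCmd, exec_map _ (by simpa [Bd.val, h0] using hlj.1)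
          (by simpa [Bd.val, h0] using hlj.2)]
        rcases lt_or_gt_of_ne hl with h | h
        · simp [h]
        · simp [h]
      · simp [orthCmd, Cmd.exec, Bd.val, h0, hlj]
    have hnew : ∀ j < n, orthCmd.exec 5 (Function.update ρ 5 k) N 15 k j =
        V k j - ∑ l ∈ range k, ip n D (V k) (N 15 l) / ip n D (N 15 l) (N 15 l) * N 15 l j := by
      intro j hj
      rw [orthCmd, exec_map _ (by simpa [Bd.val, h0]) (by simpa [Bd.val, h0])]
      simp only [eval_ite, eval_sub, eval_sum, Bd.val]
      simp only [eval_reg, eval_mat, eval_mul, eval_div, eval_ent, eval_cst, eval_sum, Bd.val]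
      simp [h0]
      rw [h2 14 (by norm_num), hV k (by omega) j hj, ← sum_filter]
      congr 1
      have : (range (3 * n + 2)).filter (fun l => l < k) = range k := by
        ext l; simp; omega
      rw [this]
      refine sum_congr rfl fun l _ => ?_
      congr 2
      · refine sum_congr rfl fun i hi => ?_
        have hi' := mem_range.mp hi
        rw [h2 13 (by norm_num), hD i hi', hV k (by omega) i hi']
      · refine sum_congr rfl fun i hi => ?_
        rw [h2 13 (by norm_num), hD i (mem_range.mp hi)]
    intro l hl j hj
    rcases Nat.lt_succ_iff_lt_or_eq.mp hl with h | rfl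
    · rw [hsame l h.ne, h1 l h j hj]
      congr 1
      refine sum_congr rfl fun l' hl' => ?_
      have : orthCmd.exec 5 (Function.update ρ 5 k) N 15 l' = N 15 l' :=
        funext (hsame l' ((mem_range.mp hl').trans h).ne)
      rw [this]
    · rw [hnew j hj]
      congr 1
      refine sum_congr rfl fun l' hl' => ?_
      have : orthCmd.exec 5 (Function.update ρ 5 l) N 15 l' = N 15 l' :=
        funext (hsame l' (mem_range.mp hl').ne)
      rw [this]

theorem Rep.eval_goodCmd (R : Rep n A c M) (h0 : ρ 0 = n) {a : ℕ → ℕ → ℝ} {D : ℕ → ℝ}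
    (ha : HoldsMat n a M) (hD : ∀ j < n, M 13 0 j = D j) {k : ℕ} (hk : k < 3 * n + 2) :
    goodCmd.exec 4 ρ M 16 0 k = goodR n a c.x c.h c.P c.M D (M 15) k := by
  have hip : ∑ j ∈ range n, M 13 0 j * M 15 k j * M 15 k j = ip n D (M 15 k) (M 15 k) :=
    sum_congr rfl fun j hj => by rw [hD j (mem_range.mp hj)]
  rw [goodCmd, exec_map _ (by simp [Bd.val]) (by simpa [Bd.val, h0]), goodR]
  have hq : quadTm.eval M 6 (Function.update (Function.update ρ 5 0) 6 k) =
      quadForm n a c.x c.h c.P c.M (M 15 k) := by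
    rw [quadTm, eval_sum, quadForm]
    simp only [Bd.val]
    refine sum_congr (by simp [h0]) fun i hi => ?_
    have hi' : i < n := by simpa [h0] using hi
    have s1 : ∑ j ∈ range n, M 12 i j * M 15 k j = ∑ j ∈ range n, a i j * M 15 k j :=
      sum_congr rfl fun j hj => by rw [ha i hi' j (mem_range.mp hj)]
    have s2 : ∑ j ∈ range n, M 12 i j * M 12 i j * M 1 0 j * M 15 k j =
        ∑ j ∈ range n, a i j * a i j * c.x j * M 15 k j :=
      sum_congr rfl fun j hj => by
        rw [ha i hi' j (mem_range.mp hj), R.x_eq j (mem_range.mp hj)]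
    simp [Bd.val, h0, s1, s2, R.h_eq i hi', R.P_eq i hi', R.M_eq i hi']
  simp only [eval_ite]
  rw [hq]
  simp [Bd.val, h0, hip]

theorem eval_pickCmd (h0 : ρ 0 = n) {good : ℕ → ℝ} (hg : ∀ k < 3 * n + 2, M 16 0 k = good k)
    {j : ℕ} (hj : j < n) : pickCmd.exec 4 ρ M 17 0 j = pick n good (M 15) j := by
  rw [pickCmd, exec_map _ (by simp [Bd.val]) (by simpa [Bd.val, h0]), pick]
  simp [Bd.val, h0]
  refine sum_congr rfl fun k hk => ?_
  rw [hg k (mem_range.mp hk)]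
  have : ∑ l ∈ range (3 * n + 2), (if l < k then M 16 0 l else 0) =
      ∑ l ∈ range (3 * n + 2), (if l < k then good l else 0) :=
    sum_congr rfl fun l hl => by rw [hg l (mem_range.mp hl)]
  rw [this]

theorem Rep.eval_normalizeCmd (R : Rep n A c M) (h0 : ρ 0 = n) {w : ℕ → ℝ}
    (hw : ∀ j < n, M 17 0 j = w j) {j : ℕ} (hj : j < n) :
    normalizeCmd.exec 4 ρ M 18 0 j = normalize n c.x w j := by
  rw [normalizeCmd, exec_map _ (by simp [Bd.val]) (by simpa [Bd.val, h0]), normalize, eval_ite,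
    R.eval_aliveN (by simp [h0])]
  simp [Bd.val, h0, hw j hj]
  have : ∑ l ∈ range n, (if M 17 0 l < 0 then -M 17 0 l else M 17 0 l) =
      ∑ l ∈ range n, (if w l < 0 then -w l else w l) :=
    sum_congr rfl fun l hl => by rw [hw l (mem_range.mp hl)]
  rw [this]

/-- The computation of the direction. -/
theorem Rep.direction (R : Rep n A c M) (h0 : ρ 0 = n) :
    Rep n A c (dirCmd.exec 4 ρ M) ∧ HoldsMat n (trunc A c.h) (dirCmd.exec 4 ρ M) ∧
    ∃ U, let D := metric n (trunc A c.h) c.h c.P c.M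
      IsOrthogonalization n (3 * n + 2) D (conVec n (trunc A c.h) c.x c.h c.P c.M D) U ∧
      ∀ j < n, dirCmd.exec 4 ρ M 18 0 j = normalize n c.x
        (pick n (goodR n (trunc A c.h) c.x c.h c.P c.M D U) U) j := by
  unfold dirCmd
  simp only [exec_seq]
  set a := trunc A c.h with ha
  set D := metric n a c.h c.P c.M with hD
  have f1 : ∀ b ≠ 12, truncCmd.exec 4 ρ M b = M b := fun b hb => exec_map_ne hb _ _ _
  have e1 : HoldsMat n a (truncCmd.exec 4 ρ M) := fun i hi j hj => R.eval_truncCmd h0 hi hj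
  generalize truncCmd.exec 4 ρ M = M₁ at *
  replace R : Rep n A c M₁ := R.frame fun b hb => f1 b (by omega)
  have f2 : ∀ b ≠ 13, metricCmd.exec 4 ρ M₁ b = M₁ b := fun b hb => exec_map_ne hb _ _ _
  have e2 : ∀ j < n, metricCmd.exec 4 ρ M₁ 13 0 j = D j := fun j hj =>
    R.eval_metricCmd h0 e1 hj
  generalize metricCmd.exec 4 ρ M₁ = M₂ at *
  replace R : Rep n A c M₂ := R.frame fun b hb => f2 b (by omega)
  replace e1 : HoldsMat n a M₂ := by unfold HoldsMat; rw [f2 12 (by norm_num)]; exact e1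
  have f3 : ∀ b ≠ 24, slopeCmd.exec 4 ρ M₂ b = M₂ b := fun b hb => exec_map_ne hb _ _ _
  have e3 : ∀ j < n, slopeCmd.exec 4 ρ M₂ 24 0 j = slope n a c.x c.h c.P c.M j := fun j hj =>
    R.eval_slopeCmd h0 e1 hj
  generalize slopeCmd.exec 4 ρ M₂ = M₃ at *
  replace R : Rep n A c M₃ := R.frame fun b hb => f3 b (by omega)
  replace e1 : HoldsMat n a M₃ := by unfold HoldsMat; rw [f3 12 (by norm_num)]; exact e1
  replace e2 : ∀ j < n, M₃ 13 0 j = D j := by rw [f3 13 (by norm_num)]; exact e2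
  have f4 : ∀ b ≠ 14, conVecCmd.exec 4 ρ M₃ b = M₃ b := fun b hb => exec_map_ne hb _ _ _
  have e4 : ∀ k < 3 * n + 2, ∀ j < n, conVecCmd.exec 4 ρ M₃ 14 k j =
      conVec n a c.x c.h c.P c.M D k j := fun k hk j hj => R.eval_conVecCmd h0 e1 e2 e3 hk hj
  generalize conVecCmd.exec 4 ρ M₃ = M₄ at *
  replace R : Rep n A c M₄ := R.frame fun b hb => f4 b (by omega)
  replace e1 : HoldsMat n a M₄ := by unfold HoldsMat; rw [f4 12 (by norm_num)]; exact e1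
  replace e2 : ∀ j < n, M₄ 13 0 j = D j := by rw [f4 13 (by norm_num)]; exact e2
  obtain ⟨e5, f5⟩ := iterate_orthCmd h0 e2 e4 le_rfl
  rw [exec_rep]
  simp only [Bd.val, h0]
  generalize iter (fun k => orthCmd.exec 5 (Function.update ρ 5 k)) M₄ (3 * n + 2) = M₅ at *
  replace R : Rep n A c M₅ := R.frame fun b hb => f5 b (by omega)
  replace e1 : HoldsMat n a M₅ := by unfold HoldsMat; rw [f5 12 (by norm_num)]; exact e1
  replace e2 : ∀ j < n, M₅ 13 0 j = D j := by rw [f5 13 (by norm_num)]; exact e2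
  have f6 : ∀ b ≠ 16, goodCmd.exec 4 ρ M₅ b = M₅ b := fun b hb => exec_map_ne hb _ _ _
  have e6 : ∀ k < 3 * n + 2, goodCmd.exec 4 ρ M₅ 16 0 k =
      goodR n a c.x c.h c.P c.M D (M₅ 15) k := fun k hk => R.eval_goodCmd h0 e1 e2 hk
  generalize goodCmd.exec 4 ρ M₅ = M₆ at *
  replace R : Rep n A c M₆ := R.frame fun b hb => f6 b (by omega)
  replace e1 : HoldsMat n a M₆ := by unfold HoldsMat; rw [f6 12 (by norm_num)]; exact e1
  have f7 : ∀ b ≠ 17, pickCmd.exec 4 ρ M₆ b = M₆ b := fun b hb => exec_map_ne hb _ _ _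
  have e7 : ∀ j < n, pickCmd.exec 4 ρ M₆ 17 0 j = pick n _ (M₆ 15) j := fun j hj =>
    eval_pickCmd h0 e6 hj
  rw [f6 15 (by norm_num)] at e7
  generalize pickCmd.exec 4 ρ M₆ = M₇ at *
  replace R : Rep n A c M₇ := R.frame fun b hb => f7 b (by omega)
  replace e1 : HoldsMat n a M₇ := by unfold HoldsMat; rw [f7 12 (by norm_num)]; exact e1
  have f8 : ∀ b ≠ 18, normalizeCmd.exec 4 ρ M₇ b = M₇ b := fun b hb => exec_map_ne hb _ _ _
  refine ⟨R.frame fun b hb => f8 b (by omega), ?_, M₅ 15, e5, fun j hj =>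
    R.eval_normalizeCmd h0 e7 hj⟩
  unfold HoldsMat; rw [f8 12 (by norm_num)]; exact e1

/-- The increment of a weight for the scale `t`. -/
def incrTm (t : Tm) : Tm :=
  t * (cst 1 / reg 0) * .sum .dim (mat 12 6 7 * ent 18 7) +
    cst 8 * (t * t) * (cst 1 / reg 0) *
      (cst (-2) * .sum .dim (mat 12 6 7 * mat 12 6 7 * ent 1 7 * ent 18 7) -
        cst 1 / reg 0 * .sum .dim (mat 12 6 7 * mat 12 6 7 * (ent 18 7 * ent 18 7)))
def incrPCmd : Cmd := .map 19 .one .dim (incrTm (ent 2 6))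
def incrMCmd : Cmd := .map 20 .one .dim (incrTm (cst 0 - ent 2 6))
def growCmd (a b : ℕ) : Cmd := .map a .one .dim
  (ent a 6 * (cst 1 + ent b 6 + ent b 6 * ent b 6))
def stepCmd : Cmd := .map 1 .one .dim (ent 1 6 + cst 1 / reg 0 * ent 18 6)

def moveCmd : Cmd := .seq incrPCmd <| .seq incrMCmd <| .seq (growCmd 3 19) <|
  .seq (growCmd 4 20) stepCmd

theorem Rep.eval_incrTm (R : Rep n A c M) (h0 : ρ 0 = n) {a : ℕ → ℕ → ℝ} {w : ℕ → ℝ}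
    (ha : HoldsMat n a M) (hw : ∀ j < n, M 18 0 j = w j) (h6 : ρ 6 < n) (t : Tm) :
    (incrTm t).eval M 6 ρ = incr n (t.eval M 6 ρ) (1 / n) (a (ρ 6)) c.x w := by
  have s1 : ∑ j ∈ range n, M 12 (ρ 6) j * M 18 0 j = ∑ j ∈ range n, a (ρ 6) j * w j :=
    sum_congr rfl fun j hj => by rw [ha _ h6 j (mem_range.mp hj), hw j (mem_range.mp hj)]
  have s2 : ∑ j ∈ range n, M 12 (ρ 6) j * M 12 (ρ 6) j * M 1 0 j * M 18 0 j =
      ∑ j ∈ range n, a (ρ 6) j ^ 2 * c.x j * w j :=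
    sum_congr rfl fun j hj => by
      rw [ha _ h6 j (mem_range.mp hj), hw j (mem_range.mp hj), R.x_eq j (mem_range.mp hj), sq]
  have s3 : ∑ j ∈ range n, M 12 (ρ 6) j * M 12 (ρ 6) j * (M 18 0 j * M 18 0 j) =
      ∑ j ∈ range n, a (ρ 6) j ^ 2 * w j ^ 2 :=
    sum_congr rfl fun j hj => by
      rw [ha _ h6 j (mem_range.mp hj), hw j (mem_range.mp hj), sq, sq]
  simp [incrTm, incr, Bd.val, h0, s1, s2, s3, sq]

theorem Rep.move (R : Rep n A c M) (h0 : ρ 0 = n) (ha : HoldsMat n (trunc A c.h) M) {w : ℕ → ℝ}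
    (hw : ∀ j < n, M 18 0 j = w j) : Rep n A (c.move n A w) (moveCmd.exec 4 ρ M) := by
  unfold moveCmd
  simp only [exec_seq]
  have b1 : (0 : ℕ) < Bd.one.val (ρ 0) := Nat.one_pos
  have bn : ∀ {i}, i < n → i < Bd.dim.val (ρ 0) := fun h => by simpa [Bd.val, h0] using h
  have f1 : ∀ b ≠ 19, incrPCmd.exec 4 ρ M b = M b := fun b hb => exec_map_ne hb _ _ _
  have e1 : ∀ i < n, incrPCmd.exec 4 ρ M 19 0 i =
      incr n (c.h i) (1 / n) (trunc A c.h i) c.x w := fun i hi => by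
    rw [incrPCmd, exec_map _ b1 (bn hi), R.eval_incrTm (by simp [h0]) ha hw (by simpa)]
    simp [R.h_eq i hi]
  generalize incrPCmd.exec 4 ρ M = M₁ at *
  replace R : Rep n A c M₁ := R.frame fun b hb => f1 b (by omega)
  replace ha : HoldsMat n (trunc A c.h) M₁ := by unfold HoldsMat; rw [f1 12 (by norm_num)]; exact ha
  replace hw : ∀ j < n, M₁ 18 0 j = w j := by rw [f1 18 (by norm_num)]; exact hw
  have f2 : ∀ b ≠ 20, incrMCmd.exec 4 ρ M₁ b = M₁ b := fun b hb => exec_map_ne hb _ _ _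
  have e2 : ∀ i < n, incrMCmd.exec 4 ρ M₁ 20 0 i =
      incr n (-c.h i) (1 / n) (trunc A c.h i) c.x w := fun i hi => by
    rw [incrMCmd, exec_map _ b1 (bn hi), R.eval_incrTm (by simp [h0]) ha hw (by simpa)]
    simp [R.h_eq i hi]
  generalize incrMCmd.exec 4 ρ M₁ = M₂ at *
  replace R : Rep n A c M₂ := R.frame fun b hb => f2 b (by omega)
  replace hw : ∀ j < n, M₂ 18 0 j = w j := by rw [f2 18 (by norm_num)]; exact hw
  have f3 : ∀ b ≠ 3, (growCmd 3 19).exec 4 ρ M₂ b = M₂ b := fun b hb => exec_map_ne hb _ _ _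
  have e3 : ∀ i < n, (growCmd 3 19).exec 4 ρ M₂ 3 0 i = (c.move n A w).P i := fun i hi => by
    rw [growCmd, exec_map _ b1 (bn hi)]
    simp [R.P_eq i hi, f2 19, e1 i hi, Cfg.move, sq]
  generalize (growCmd 3 19).exec 4 ρ M₂ = M₃ at *
  have f4 : ∀ b ≠ 4, (growCmd 4 20).exec 4 ρ M₃ b = M₃ b := fun b hb => exec_map_ne hb _ _ _
  have e4 : ∀ i < n, (growCmd 4 20).exec 4 ρ M₃ 4 0 i = (c.move n A w).M i := fun i hi => by
    rw [growCmd, exec_map _ b1 (bn hi)]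
    simp [f3 4, f3 20, R.M_eq i hi, e2 i hi, Cfg.move, sq]
  generalize (growCmd 4 20).exec 4 ρ M₃ = M₄ at *
  have f5 : ∀ b ≠ 1, stepCmd.exec 4 ρ M₄ b = M₄ b := fun b hb => exec_map_ne hb _ _ _
  have e5 : ∀ j < n, stepCmd.exec 4 ρ M₄ 1 0 j = (c.move n A w).x j := fun j hj => by
    rw [stepCmd, exec_map _ b1 (bn hj)]
    simp [f4 1, f3 1, f4 18, f3 18, R.x_eq j hj, hw j hj, Cfg.move, h0]
  generalize stepCmd.exec 4 ρ M₄ = M₅ at *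
  have g : ∀ b, b ≠ 1 → b ≠ 3 → b ≠ 4 → M₅ b = M₂ b := fun b h1 h3 h4 => by
    rw [f5 b h1, f4 b h4, f3 b h3]
  constructor
  · rw [g 0 (by norm_num) (by norm_num) (by norm_num)]; exact R.mat_eq
  · exact e5
  · rw [g 2 (by norm_num) (by norm_num) (by norm_num)]; exact R.h_eq
  · rw [f5 3 (by norm_num), f4 3 (by norm_num)]; exact e3
  · rw [f5 4 (by norm_num)]; exact e4
  · rw [g 5 (by norm_num) (by norm_num) (by norm_num)]; exact R.lk_eq
  · rw [g 6 (by norm_num) (by norm_num) (by norm_num)]; exact R.θ_eq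
  · rw [g 7 (by norm_num) (by norm_num) (by norm_num)]; exact R.m_eq
  · rw [g 8 (by norm_num) (by norm_num) (by norm_num)]; exact R.harm_eq

/-- One iteration of the algorithm. -/
def bodyCmd : Cmd := .seq stageCmd <| .seq dirCmd moveCmd

theorem Rep.body (R : Rep n A c M) (h0 : ρ 0 = n) :
    ∃ U w, let c' := c.stage n A
      let D := metric n (trunc A c'.h) c'.h c'.P c'.M
      IsOrthogonalization n (3 * n + 2) D (conVec n (trunc A c'.h) c'.x c'.h c'.P c'.M D) U ∧
      w = normalize n c'.x (pick n (goodR n (trunc A c'.h) c'.x c'.h c'.P c'.M D U) U) ∧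
      Rep n A (c'.move n A w) (bodyCmd.exec 4 ρ M) := by
  have R' := R.stage (ρ := ρ) h0
  unfold bodyCmd
  simp only [exec_seq]
  obtain ⟨R'', ha, U, hU, hw⟩ := R'.direction (ρ := ρ) h0
  exact ⟨U, _, hU, rfl, R''.move h0 ha hw⟩

end

/-! ### The main loop, its termination and the rounding -/

section
variable {n : ℕ} {A : ℕ → ℕ → ℝ} {c : Cfg} {M : Arr} {d : ℕ} {ρ : ℕ → ℕ}

/-- What is known after `t` iterations: few coordinates are alive and the rows are bounded, or the
invariant holds and the point has moved outwards. -/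
def Progress (n : ℕ) (A : ℕ → ℕ → ℝ) (B : ℝ) (t : ℕ) (c : Cfg) : Prop :=
  (∀ j < n, |c.x j| ≤ 1) ∧
  ((aliveN n c.x < 20 ∧
      ∀ i < n, |∑ j ∈ range n, A i j * c.x j| ≤ 4000 * √√100 + 200 * √(B * harm n)) ∨
    ((∃ Y, Inv n A c Y) ∧ (2 * aliveN n c.x ≤ c.m ∨ FewStill n c) ∧ 1 ≤ c.m ∧ c.θ ≤ B ∧
      (t : ℝ) * (1 / n ^ 3) ≤ ∑ j ∈ range n, c.x j ^ 2))

theorem stage_x (n : ℕ) (A : ℕ → ℕ → ℝ) (c : Cfg) : (c.stage n A).x = c.x := by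
  unfold Cfg.stage; split_ifs <;> rfl

/-- Once fewer than `20` coordinates are alive the direction is `0`, so the row bound, read off the
invariant at that moment, persists. Otherwise a stage is started if due, and a good direction
exists. -/
theorem Progress.body {B : ℝ} {t : ℕ} (H : Progress n A B t c) (hn : 20 ≤ n) (hA : ColNorm n A)
    (hB : ∀ x θ, aliveN n x < 100 * badN n A x (aliveN n x) θ → 2 * θ ≤ B)
    (R : Rep n A c M) (h0 : ρ 0 = n) :
    ∃ c', Rep n A c' (bodyCmd.exec 4 ρ M) ∧ Progress n A B (t + 1) c' := by
  obtain ⟨U, w, hU, hw, R'⟩ := R.body (ρ := ρ) h0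
  refine ⟨_, R', ?_⟩
  obtain ⟨hx, H⟩ := H
  have hn1 : 1 ≤ n := by omega
  by_cases h20 : aliveN n c.x < 20
  · have hbd : ∀ i < n, |∑ j ∈ range n, A i j * c.x j| ≤
        4000 * √√100 + 200 * √(B * harm n) := by
      rcases H with ⟨-, H⟩ | ⟨⟨Y, I⟩, -, hm, hθ, -⟩
      · exact H
      · intro i hi
        refine ((I.rows i hi).bound hx (I.cap i hi) hn1 hm).trans ?_
        have := harm_ge_one hn1
        gcongr
    have e : ((c.stage n A).move n A w).x = c.x := by
      funext j
      simp only [Cfg.move, hw, normalize, stage_x, if_pos h20]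
      ring
    exact ⟨by rwa [e], Or.inl ⟨by rwa [e], by rwa [e]⟩⟩
  · obtain ⟨h, -⟩ | ⟨⟨Y, I⟩, hF, hm, hθ, ht⟩ := H
    · exact absurd h h20
    have h20' := not_lt.mp h20
    obtain ⟨⟨Y', I'⟩, hF', hm', hθ', hx'⟩ := I.stage hn hA h20' hF hB hθ
    have hm1 : 1 ≤ (c.stage n A).m := by
      unfold Cfg.stage
      split_ifs
      · exact hm
      · exact le_trans (by norm_num) h20'
    generalize c.stage n A = c' at *
    have G : GoodDir n A c' w := by
      rw [hw]
      exact (goodDir_normalize I'.P0 I'.M0 rfl hU).2 (by rwa [hx'])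
        (I'.exists_good hF' (by rwa [hx']) (by rwa [hx']) rfl hU)
    have J := G.inv_move I' hn1
    refine ⟨J.xb, Or.inr ⟨⟨Y', J⟩, Or.inr hF', hm1, hθ', ?_⟩⟩
    have := G.progress hn1
    rw [hx'] at this
    push_cast
    linarith

theorem iter_induction {Q : ℕ → Arr → Prop} {f : ℕ → Arr → Arr} {s t : ℕ}
    (h : ∀ k t M, Q t M → Q (t + s) (f k M)) (hM : Q t M) (k : ℕ) : Q (t + k * s) (iter f M k) := by
  induction k with
  | zero => simpa [iter] using hM
  | succ k ih =>
    have := h k _ _ ih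
    rwa [add_assoc, ← Nat.succ_mul] at this

/-- Each level of nesting multiplies the number of executions of the innermost body by `3 * n + 2`.
-/
theorem exec_rep_induction {Q : ℕ → Arr → Prop} {p : Cmd} {s : ℕ}
    (h : ∀ ρ : ℕ → ℕ, ρ 0 = n → ∀ t M, Q t M → Q (t + s) (p.exec (d + 1) ρ M)) :
    ∀ ρ : ℕ → ℕ, ρ 0 = n → ∀ t M, Q t M →
      Q (t + (3 * n + 2) * s) ((Cmd.rep .big p).exec d ρ M) := by
  intro ρ h0 t M hM
  rw [exec_rep]
  simp only [Bd.val, h0]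
  exact iter_induction (fun k t M => h _ (by simp [h0]) t M) hM _

def harmCmd : Cmd := .map 8 .one .one (.sum .dim (cst 1 / (reg 3 + cst 1)))
def initThetaCmd : Cmd := .map 6 .one .one (cst 1 / scal 8)
def initSizeCmd : Cmd := .map 7 .one .one (reg 0 + reg 0)
def roundCmd : Cmd := .map 1 .one .dim (.ite (cst 0) (ent 1 2) (cst 1) (cst (-1)))
def initCmd : Cmd := .seq harmCmd <| .seq initThetaCmd initSizeCmd
-- Each step adds `1 / n ^ 3` to a sum of squares that is at most `n`, so `(3 * n + 2) ^ 4`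
-- iterations suffice.
def loopCmd : Cmd := .rep .big <| .rep .big <| .rep .big <| .rep .big bodyCmd
def mainCmd : Cmd := .seq initCmd <| .seq loopCmd roundCmd

/-- The configuration at the start. -/
noncomputable def Cfg.init (n : ℕ) : Cfg where
  x _ := 0
  h _ := 0
  P _ := 0
  M _ := 0
  lk _ := 0
  θ := 1 / harm n
  -- Large enough for the first iteration to start a stage, as `FewStill` fails while all scales are
  -- `0`.
  m := n + n

theorem rep_init (A : Matrix (Fin n) (Fin n) ℝ) :
    Rep n (startArr A 0) (Cfg.init n) (initCmd.exec 0 (startIdx n) (startArr A)) := by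
  have h0 : startIdx n 0 = n := rfl
  have b1 : (0 : ℕ) < Bd.one.val (startIdx n 0) := Nat.one_pos
  unfold initCmd
  simp only [exec_seq]
  have f1 : ∀ b ≠ 8, harmCmd.exec 0 (startIdx n) (startArr A) b = startArr A b :=
    fun b hb => exec_map_ne hb _ _ _
  have e1 : harmCmd.exec 0 (startIdx n) (startArr A) 8 0 0 = harm n := by
    rw [harmCmd, exec_map _ b1 b1]
    simp [Bd.val, h0, harm]
  generalize harmCmd.exec 0 (startIdx n) (startArr A) = M₁ at *
  have f2 : ∀ b ≠ 6, initThetaCmd.exec 0 (startIdx n) M₁ b = M₁ b :=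
    fun b hb => exec_map_ne hb _ _ _
  have e2 : initThetaCmd.exec 0 (startIdx n) M₁ 6 0 0 = 1 / harm n := by
    rw [initThetaCmd, exec_map _ b1 b1]
    simp [e1]
  generalize initThetaCmd.exec 0 (startIdx n) M₁ = M₂ at *
  have f3 : ∀ b ≠ 7, initSizeCmd.exec 0 (startIdx n) M₂ b = M₂ b :=
    fun b hb => exec_map_ne hb _ _ _
  have e3 : initSizeCmd.exec 0 (startIdx n) M₂ 7 0 0 = n + n := by
    rw [initSizeCmd, exec_map _ b1 b1]
    simp [h0]
  generalize initSizeCmd.exec 0 (startIdx n) M₂ = M₃ at *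
  have g : ∀ b, b ≠ 6 → b ≠ 7 → b ≠ 8 → M₃ b = startArr A b := fun b h6 h7 h8 => by
    rw [f3 b h7, f2 b h6, f1 b h8]
  have z : ∀ b, b ≠ 0 → b ≠ 6 → b ≠ 7 → b ≠ 8 → ∀ j < n, M₃ b 0 j = 0 := fun b h0 h6 h7 h8 j _ => by
    rw [g b h6 h7 h8]; simp [startArr, h0]
  refine ⟨?_, z 1 ?_ ?_ ?_ ?_, z 2 ?_ ?_ ?_ ?_, z 3 ?_ ?_ ?_ ?_, z 4 ?_ ?_ ?_ ?_,
    z 5 ?_ ?_ ?_ ?_, ?_, e3, ?_⟩ <;> try norm_num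
  · rw [g 0 (by norm_num) (by norm_num) (by norm_num)]; intros; rfl
  · rw [f3 6 (by norm_num), e2]; simp [Cfg.init]
  · rw [f3 8 (by norm_num), f2 8 (by norm_num), e1]

theorem progress_init (hn : 20 ≤ n) (A : ℕ → ℕ → ℝ) {B : ℝ} (hB : 1 / harm n ≤ B) :
    Progress n A B 0 (Cfg.init n) := by
  have hn1 : 1 ≤ n := by omega
  have hn' : (20 : ℝ) ≤ n := by exact_mod_cast hn
  have hL := harm_ge_one hn1
  have hal := aliveN_le n (Cfg.init n).x
  refine ⟨fun j _ => by simp [Cfg.init], Or.inr ⟨⟨fun _ => 0, ?_⟩, Or.inl ?_, ?_, hB, ?_⟩⟩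
  · refine ⟨fun j _ => by simp [Cfg.init], fun j _ => by simp, fun j _ _ => rfl,
      fun _ _ => le_rfl, fun _ _ => le_rfl, fun _ _ => le_rfl, ?_, fun i _ => by
        simp [Cfg.init], ?_, ?_, le_rfl, ?_, ?_⟩
    · simp [Cfg.init]
    · change aliveN n (Cfg.init n).x ≤ n + n
      linarith
    · change (n : ℝ) + n ≤ 2 * n; linarith
    · change 1 / harm n ≤ 2 * n
      rw [div_le_iff₀ (by linarith)]; nlinarith
    · intro i _
      refine Or.inl ⟨rfl, ?_, Or.inl ⟨rfl, by simp [Cfg.init]⟩⟩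
      simp
  · change 2 * _ ≤ (n : ℝ) + n; linarith
  · change 1 ≤ (n : ℝ) + n; linarith
  · simp [Cfg.init]

/-- The point that is found by the main loop. -/
theorem loop_spec (hn : 20 ≤ n) (A : Matrix (Fin n) (Fin n) ℝ) (hA : ColNorm n (startArr A 0))
    {B : ℝ} (hB0 : 1 / harm n ≤ B)
    (hB : ∀ x θ, aliveN n x < 100 * badN n (startArr A 0) x (aliveN n x) θ → 2 * θ ≤ B) :
    let x := loopCmd.exec 0 (startIdx n) (initCmd.exec 0 (startIdx n) (startArr A)) 1 0
    ∃ x' : ℕ → ℝ, (∀ j < n, x j = x' j) ∧ (∀ j < n, |x' j| ≤ 1) ∧ aliveN n x' < 20 ∧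
      ∀ i < n, |∑ j ∈ range n, startArr A 0 i j * x' j| ≤
        4000 * √√100 + 200 * √(B * harm n) := by
  intro x
  set Q : ℕ → Arr → Prop := fun t M =>
    ∃ c, Rep n (startArr A 0) c M ∧ Progress n (startArr A 0) B t c with hQ
  have h1 : ∀ ρ : ℕ → ℕ, ρ 0 = n → ∀ t M, Q t M → Q (t + 1) (bodyCmd.exec (3 + 1) ρ M) := by
    rintro ρ h0 t M ⟨c, R, H⟩
    exact H.body hn hA hB R h0
  obtain ⟨c, R, hx, H⟩ := exec_rep_induction (d := 0) (exec_rep_induction (exec_rep_induction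
    (exec_rep_induction h1))) (startIdx n) rfl 0 _
    ⟨_, rep_init A, progress_init hn (startArr A 0) hB0⟩
  refine ⟨c.x, R.x_eq, hx, ?_⟩
  rcases H with H | ⟨-, -, -, -, H⟩
  · exact H
  · exfalso
    have hn' : (20 : ℝ) ≤ n := by exact_mod_cast hn
    have h2 : ∑ j ∈ range n, c.x j ^ 2 ≤ n := by
      refine (sum_le_sum (g := fun _ => (1 : ℝ)) fun j hj => ?_).trans (by simp)
      exact (sq_le_one_iff_abs_le_one _).mpr (hx j (mem_range.mp hj))
    have h3 := H.trans h2
    rw [mul_one_div, div_le_iff₀ (by positivity)] at h3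
    push_cast at h3
    have h4 : (n : ℝ) * n ^ 3 < (3 * n + 2) * ((3 * n + 2) * ((3 * n + 2) * (3 * n + 2))) := by
      calc (n : ℝ) * n ^ 3 = n * (n * (n * n)) := by ring
        _ < _ := by gcongr <;> linarith
    linarith

/-- Rounding a point with few coordinates alive. -/
theorem round_bound {x : ℕ → ℝ} (hn : 1 ≤ n) (hA : ColNorm n A) (hx : ∀ j < n, |x j| ≤ 1) {i : ℕ}
    (hi : i < n) : |∑ j ∈ range n, A i j * (if 0 < x j then 1 else -1)| ≤
      |∑ j ∈ range n, A i j * x j| + (2 * aliveN n x + 1) := by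
  have hn' : (1 : ℝ) ≤ n := by exact_mod_cast hn
  have h1 : ∑ j ∈ range n, A i j * (if 0 < x j then 1 else -1) = ∑ j ∈ range n, A i j * x j +
      ∑ j ∈ range n, A i j * ((if 0 < x j then 1 else -1) - x j) := by
    rw [← sum_add_distrib]
    exact sum_congr rfl fun j _ => by ring
  rw [h1]
  refine (abs_add_le _ _).trans (add_le_add_right ?_ _)
  refine (abs_sum_le_sum_abs _ _).trans ?_
  have h2 : ∀ j ∈ range n, |A i j * ((if 0 < x j then 1 else -1) - x j)| ≤
      2 * aliveR n x j + 1 / n := by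
    intro j hj
    have hj' := mem_range.mp hj
    have h3 : |A i j| ≤ 1 := by
      rw [← sq_le_one_iff_abs_le_one, sq]; exact hA.sq_le hi hj'
    have h4 : |(if 0 < x j then 1 else -1) - x j| = 1 - |x j| := by
      have := abs_le.mp (hx j hj')
      split_ifs with h
      · rw [abs_of_pos h, abs_of_nonneg (by linarith)]
      · rw [abs_of_nonpos (not_lt.mp h), abs_of_nonpos (by linarith)]; ring
    -- A dead coordinate is rounded by at most `1 / n`, all of them together by at most `1`.
    have h5 : 1 - |x j| ≤ 2 * aliveR n x j + 1 / n := by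
      have h0 := abs_nonneg (x j)
      have h6 : (0 : ℝ) ≤ 1 / n := by positivity
      by_cases h : x j * x j < (1 - 1 / n) * (1 - 1 / n)
      · rw [aliveR, if_pos h]; linarith
      · rw [aliveR, if_neg h]
        have h7 : (1 : ℝ) / n ≤ 1 := by rw [div_le_one (by linarith)]; exact hn'
        have h8 : 1 - 1 / (n : ℝ) ≤ |x j| := by
          refine le_of_sq_le_sq ?_ h0
          rw [sq_abs]; nlinarith [not_lt.mp h]
        linarith
    rw [abs_mul, h4]
    have := hx j hj'
    nlinarith [abs_nonneg (A i j)]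
  refine (sum_le_sum h2).trans ?_
  rw [sum_add_distrib, ← mul_sum, sum_const, card_range, nsmul_eq_mul, aliveN]
  have : (n : ℝ) * (1 / n) = 1 := by field_simp
  linarith

end

/-! ### Excess energies and `lam`; the final bound -/

section
variable {n : ℕ} (A : Matrix (Fin n) (Fin n) ℝ)

/-- Without boundedness `sSup` would be the default value `0`. -/
theorem lam_bddAbove : BddAbove {r : ℝ | ∃ u : Fin n → ℝ,
    ‖WithLp.toLp 2 u‖ = 1 ∧ ∑ j, u j = 0 ∧ r = ‖WithLp.toLp 2 ((A ⊙ A) *ᵥ u)‖} := by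
  refine ⟨‖Matrix.toEuclideanCLM (𝕜 := ℝ) (A ⊙ A)‖, ?_⟩
  rintro r ⟨u, hu, -, rfl⟩
  have := (Matrix.toEuclideanCLM (𝕜 := ℝ) (A ⊙ A)).le_opNorm (WithLp.toLp 2 u)
  rwa [hu, mul_one, Matrix.toEuclideanCLM_toLp] at this

theorem lam_nonneg : 0 ≤ lam A := by
  refine Real.sSup_nonneg ?_
  rintro r ⟨u, -, -, rfl⟩
  exact norm_nonneg _

theorem norm_le_lam_mul (u : Fin n → ℝ) (hu : ∑ j, u j = 0) :
    ‖WithLp.toLp 2 ((A ⊙ A) *ᵥ u)‖ ≤ lam A * ‖WithLp.toLp 2 u‖ := by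
  by_cases h0 : ‖WithLp.toLp 2 u‖ = 0
  · have : u = 0 := by
      have := norm_eq_zero.mp h0
      simpa using this
    rw [this]; simp
  have hp : 0 < ‖WithLp.toLp 2 u‖ := lt_of_le_of_ne (norm_nonneg _) (Ne.symm h0)
  set r := ‖WithLp.toLp 2 u‖ with hr
  have h1 : ‖WithLp.toLp 2 ((A ⊙ A) *ᵥ (r⁻¹ • u))‖ ≤ lam A := by
    refine le_csSup (lam_bddAbove A) ⟨r⁻¹ • u, ?_, ?_, rfl⟩
    · rw [WithLp.toLp_smul, norm_smul, ← hr, Real.norm_of_nonneg (by positivity)]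
      exact inv_mul_cancel₀ h0
    · simp [← mul_sum, hu]
  rw [Matrix.mulVec_smul, WithLp.toLp_smul, norm_smul, Real.norm_of_nonneg (by positivity),
    inv_mul_le_iff₀ hp] at h1
  linarith

theorem startArr_apply (i j : Fin n) : startArr A 0 i j = A i j := by
  simp [startArr]

/-- The number of rows with excess energy is small if the threshold is large compared to `lam`. -/
theorem sq_mul_badN_le (hn : 1 ≤ n) (x : ℕ → ℝ) {θ : ℝ} (hθ : 0 ≤ θ) :
    θ ^ 2 * badN n (startArr A 0) x (aliveN n x) θ ≤ lam A ^ 2 * aliveN n x := by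
  have hn' : (0 : ℝ) < n := by exact_mod_cast hn
  set m := aliveN n x with hm
  -- The centred indicator of the alive set: its squared norm is `m - m ^ 2 / n`, and `A ⊙ A` maps
  -- it to the differences between energies and base energies.
  set u : Fin n → ℝ := fun j => aliveR n x j - m / n with hu
  have hmsum : ∑ j : Fin n, aliveR n x j = m := by
    rw [hm, aliveN, Finset.sum_range]
  have hu0 : ∑ j, u j = 0 := by
    simp only [hu, sum_sub_distrib, hmsum, sum_const, card_univ, Fintype.card_fin, nsmul_eq_mul]
    field_simp; ring
  have hu2 : ‖WithLp.toLp 2 u‖ ^ 2 ≤ m := by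
    rw [EuclideanSpace.real_norm_sq_eq]
    have : ∀ j, u j ^ 2 = aliveR n x j - 2 * (m / n) * aliveR n x j + (m / n) ^ 2 := fun j => by
      simp only [hu]
      rcases aliveR_eq_or n x j with h | h <;> rw [h] <;> ring
    simp only [this, sum_add_distrib, sum_sub_distrib, ← mul_sum, hmsum, sum_const, card_univ,
      Fintype.card_fin, nsmul_eq_mul]
    have h1 : (n : ℝ) * (m / n) ^ 2 = m / n * m := by field_simp
    have h2 : 0 ≤ m / n * m := by rw [div_mul_eq_mul_div]; exact div_nonneg (mul_self_nonneg m) hn'.le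
    rw [h1]; linarith
  have hAu : ∀ i : Fin n, ((A ⊙ A) *ᵥ u) i =
      aliveSq n (startArr A 0) x i - base n (startArr A 0) m i := by
    intro i
    unfold aliveSq base rowSq
    rw [Finset.sum_range, Finset.sum_range, mul_sum, ← sum_sub_distrib]
    rw [Matrix.mulVec, dotProduct]
    refine sum_congr rfl fun j _ => ?_
    rw [startArr_apply, Matrix.hadamard_apply]
    simp only [hu]; ring
  -- Chebyshev: each row in excess contributes at least `θ ^ 2` to the squared norm.
  have h1 : θ ^ 2 * badN n (startArr A 0) x m θ ≤ ‖WithLp.toLp 2 ((A ⊙ A) *ᵥ u)‖ ^ 2 := by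
    rw [EuclideanSpace.real_norm_sq_eq, badN, Finset.sum_range, mul_sum]
    refine sum_le_sum fun i _ => ?_
    change _ ≤ ((A ⊙ A) *ᵥ u) i ^ 2
    rw [hAu i]
    split_ifs with h
    · rw [mul_one]
      exact pow_le_pow_left₀ hθ (by linarith) 2
    · rw [mul_zero]; exact sq_nonneg _
  refine h1.trans ?_
  calc ‖WithLp.toLp 2 ((A ⊙ A) *ᵥ u)‖ ^ 2 ≤ (lam A * ‖WithLp.toLp 2 u‖) ^ 2 :=
        pow_le_pow_left₀ (norm_nonneg _) (norm_le_lam_mul A u hu0) 2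
    _ = lam A ^ 2 * ‖WithLp.toLp 2 u‖ ^ 2 := by ring
    _ ≤ _ := by gcongr

/-- If `θ > 10 * lam A`, Chebyshev leaves at most `m / 100` rows in excess. -/
theorem threshold_le (hn : 1 ≤ n) (x : ℕ → ℝ) (θ : ℝ)
    (h : aliveN n x < 100 * badN n (startArr A 0) x (aliveN n x) θ) : 2 * θ ≤ 20 * lam A := by
  have hl := lam_nonneg A
  by_contra hc
  have hθ : 0 ≤ θ := by linarith
  have h1 := sq_mul_badN_le A hn x hθ
  have h0 := aliveN_nonneg n x
  have h2 : 0 < badN n (startArr A 0) x (aliveN n x) θ := by linarith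
  have h3 : (10 * lam A) ^ 2 < θ ^ 2 := pow_lt_pow_left₀ (by linarith) (by linarith) (by norm_num)
  have h4 : lam A ^ 2 * aliveN n x ≤
      lam A ^ 2 * (100 * badN n (startArr A 0) x (aliveN n x) θ) := by gcongr
  nlinarith

theorem colNorm_startArr {A : Matrix (Fin n) (Fin n) ℝ} (hA : IsKomlosInstance A) :
    ColNorm n (startArr A 0) := by
  intro j hj
  have h1 := hA ⟨j, hj⟩
  rw [← sq_le_one_iff₀ (norm_nonneg _), EuclideanSpace.real_norm_sq_eq] at h1
  rw [Finset.sum_range]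
  refine le_trans (le_of_eq (sum_congr rfl fun i _ => ?_)) h1
  rw [show startArr A 0 i j = A i ⟨j, hj⟩ from startArr_apply A i ⟨j, hj⟩, sq]

theorem mainCmd_apply (j : Fin n) : mainCmd.exec 0 (startIdx n) (startArr A) 1 0 j =
    if 0 < loopCmd.exec 0 (startIdx n) (initCmd.exec 0 (startIdx n) (startArr A)) 1 0 j
    then 1 else -1 := by
  unfold mainCmd
  simp only [exec_seq]
  rw [roundCmd, exec_map _ (by simp [Bd.val]) (by simp [Bd.val, startIdx])]
  simp

theorem mulVec_round (x : ℕ → ℝ) (y : Fin n → ℝ) (hy : ∀ j : Fin n, y j = if 0 < x j then 1 else -1)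
    (i : Fin n) : (A *ᵥ y) i =
      ∑ j ∈ range n, startArr A 0 i j * (if 0 < x j then 1 else -1) := by
  rw [Finset.sum_range, Matrix.mulVec, dotProduct]
  refine sum_congr rfl fun j _ => ?_
  rw [startArr_apply, hy]

/-- The bound for the coloring that the program computes. -/
theorem norm_mainCmd_le {A : Matrix (Fin n) (Fin n) ℝ} (hA : IsKomlosInstance A)
    {y : Fin n → ℝ} (hy : ∀ j : Fin n, y j = mainCmd.exec 0 (startIdx n) (startArr A) 1 0 j) :
    ‖A *ᵥ y‖ ≤ 20000 * (1 + √(lam A * Real.log n)) := by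
  have hl := lam_nonneg A
  have hC := colNorm_startArr hA
  set s := √(lam A * Real.log n) with hs
  have hs0 : 0 ≤ s := Real.sqrt_nonneg _
  rw [pi_norm_le_iff_of_nonneg (by positivity)]
  intro i
  rw [Real.norm_eq_abs]
  have hy' : ∀ j, y j = _ := fun j => (hy j).trans (mainCmd_apply A j)
  by_cases hn : n < 20
  · have h1 : |(A *ᵥ y) i| ≤ ∑ j : Fin n, (1 : ℝ) := by
      rw [Matrix.mulVec, dotProduct]
      refine (abs_sum_le_sum_abs _ _).trans (sum_le_sum fun j _ => ?_)
      rw [abs_mul]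
      have h2 : |A i j| ≤ 1 := by
        rw [← sq_le_one_iff_abs_le_one, sq, ← startArr_apply A]; exact hC.sq_le i.2 j.2
      have h3 : |y j| = 1 := by rw [hy' j]; split_ifs <;> simp
      rw [h3, mul_one]; exact h2
    have h4 : (n : ℝ) ≤ 20 := by exact_mod_cast hn.le
    simp at h1
    linarith
  have hn20 := not_lt.mp hn
  have hn1 : 1 ≤ n := by omega
  have hn' : (20 : ℝ) ≤ n := by exact_mod_cast hn20
  have hL := harm_ge_one hn1
  obtain ⟨x, hx1, hx2, hx3, hx4⟩ := loop_spec hn20 A hC (le_max_left (1 / harm n) (20 * lam A))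
    (fun x θ h => (threshold_le A hn1 x θ h).trans (le_max_right _ _))
  rw [mulVec_round A x y (fun j => by rw [hy' j, hx1 j j.2]) i]
  have h1 := round_bound hn1 hC hx2 i.2
  have h2 := hx4 i i.2
  have hlog : 1 ≤ Real.log n := by
    rw [Real.le_log_iff_exp_le (by linarith)]
    linarith [Real.exp_one_lt_d9]
  -- The initial threshold accounts for the `1`; otherwise `harm n ≤ 2 * log n` applies.
  have h3 : max (1 / harm n) (20 * lam A) * harm n ≤ 1 + 40 * (lam A * Real.log n) := by
    have h4 := harm_le_one_add_log n
    have h5 : 0 ≤ lam A * Real.log n := by positivity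
    rcases max_cases (1 / harm n) (20 * lam A) with ⟨h, -⟩ | ⟨h, -⟩
    · rw [h, one_div, inv_mul_cancel₀ (by linarith)]; linarith
    · rw [h]
      have : lam A * harm n ≤ lam A * (2 * Real.log n) := by gcongr; linarith
      linarith
  have h6 : √(max (1 / harm n) (20 * lam A) * harm n) ≤ 1 + 7 * s := by
    rw [Real.sqrt_le_left (by positivity)]
    have : s ^ 2 = lam A * Real.log n := Real.sq_sqrt (by positivity)
    nlinarith
  have h7 : √√(100 : ℝ) ≤ 4 := by
    rw [Real.sqrt_le_left (by norm_num), Real.sqrt_le_left (by norm_num)]; norm_num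
  have h8 : |∑ j ∈ range n, startArr A 0 i j * x j| ≤ 16000 + 200 * (1 + 7 * s) := by
    refine h2.trans (add_le_add ?_ ?_)
    · linarith
    · linarith
  refine h1.trans ?_
  linarith

end

/-- The program that carries out `mainCmd` finds good colorings in polynomial time. -/
theorem exists_prog : ∃ (P : Prog) (T : Polynomial ℕ),
    ∀ (n : ℕ) (A : Matrix (Fin n) (Fin n) ℝ), IsKomlosInstance A →
      ∃ (t : ℕ) (s : State), P.Run (input A) t s ∧ t ≤ T.eval n ∧ IsColoring (output n s) ∧
        ‖A *ᵥ output n s‖ ≤ 20000 * (1 + √(lam A * Real.log n)) := by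
  obtain ⟨P, T, hP⟩ := mainCmd.exists_prog
  refine ⟨P, T, fun n A hA => ?_⟩
  obtain ⟨t, s, h1, h2, h3⟩ := hP n A
  refine ⟨t, s, h1, h2, fun j => ?_, norm_mainCmd_le hA h3⟩
  rw [h3 j, mainCmd_apply]
  split_ifs
  · exact Or.inl rfl
  · exact Or.inr rfl

end PseudoKomlos

theorem mainTheorem1 :
    -- a single program, running in polynomially many steps, that finds the coloring
    (∃ (C : ℝ) (P : RealRAM.Prog) (T : Polynomial ℕ),
      ∀ (n : ℕ) (A : Matrix (Fin n) (Fin n) ℝ), IsKomlosInstance A →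
        ∃ (t : ℕ) (s : RealRAM.State),
          P.Run (RealRAM.input A) t s ∧ t ≤ T.eval n ∧
          IsColoring (RealRAM.output n s) ∧
          ‖A *ᵥ RealRAM.output n s‖ ≤ C * (1 + √(lam A * Real.log n))) ∧
    -- bounded discrepancy when `lam A = O(1 / log n)`
    (∀ K : ℝ, ∃ C : ℝ,
      ∀ (n : ℕ) (A : Matrix (Fin n) (Fin n) ℝ), IsKomlosInstance A →
        (2 ≤ n → lam A ≤ K / Real.log n) →
        ∃ x : Fin n → ℝ, IsColoring x ∧ ‖A *ᵥ x‖ ≤ C) := by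
  obtain ⟨P, T, main⟩ := PseudoKomlos.exists_prog
  refine ⟨⟨20000, P, T, main⟩, fun K => ⟨20000 * (1 + √|K|), fun n A hA hK => ?_⟩⟩
  obtain ⟨t, s, -, -, h1, h2⟩ := main n A hA
  refine ⟨_, h1, h2.trans ?_⟩
  -- The absolute value also covers `n ≤ 1`, where the logarithm vanishes and nothing is assumed
  -- about `lam A`.
  have : lam A * Real.log n ≤ |K| := by
    by_cases hn : 2 ≤ n
    · have hlog : 0 < Real.log n := Real.log_pos (by exact_mod_cast hn)
      have := hK hn
      rw [le_div_iff₀ hlog] at this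
      exact this.trans (le_abs_self K)
    · have : Real.log n = 0 := by
        interval_cases n <;> simp
      rw [this, mul_zero]; exact abs_nonneg K
  gcongr
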